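/- **Setting.** Let $\boldsymbol\Gamma\subset\mathbb R^3$ be a surface of area $1$ that is either the boundary $\partial\Omega$ of a bounded, connected, open set $\Omega$ with $C^2$ boundary, or a relatively open subset of such a $\partial\Omega$; let $\sigma$ be the surface measure. Let $K:\boldsymbol\Gamma\to[0,\infty)$ be continuous and bounded. Fix $T,\omega_M,\overline{\mathbf C},c_0,\rho_c>0$, geometric constants $a,b>0$, a point $x_0\in\mathbb R^3\setminus\overline{\boldsymbol\Gamma}$ and $\theta\in\mathbb R$. For a signal $\lambda\in C^9(\mathbb R)$ with $\lambda=0$ on $(-\infty,0)$ put $$u^{in}(x,t)=\rho_c\,\frac{\lambda(t-c_0^{-1}|x-x_0|)}{|x-x_0|}.$$ *Distribution of bubbles at scale $d>0$.* Up to sets of zero area, $\boldsymbol\Gamma$ is partitioned into measurable patches $\Gamma_1,\dots,\Gamma_M\subseteq\boldsymbol\Gamma$ with $\sigma(\Gamma_m)=d^2$ (so $M=d^{-2}$) and $\operatorname{diam}\Gamma_m\le b\,d$. The patch $\Gamma_m$ contains $N_m$ bubble centres $z_{m_1},\dots,z_{m_{N_m}}$, where $N_m=\lfloor K(z_{m_1})+1\rfloor$,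 and any two distinct centres (of the same or of different patches) are at distance at least $a\,d$. *Interaction.* Put $\theta_{li}=1$ for $l\ne i$ and $\theta_{ll}=\theta$. (For $\theta=0$ the interaction matrices below have zero diagonal; for $\theta=1$ all their entries are of the same form.) *Surface integral equation.* $\mathcal F=(\mathcal F_m)_{m\le M}$, $\mathcal F_m=(\mathcal F_{m_1},\dots,\mathcal F_{m_{N_m}})^t$, where each $\mathcal F_{m_l}$ is defined on $\Gamma_m\times(-\infty,T)$, is $C^2$ in time, vanishes for $t\le0$, and has $\partial_t^2\mathcal F_{m_l}$ measurable in space; $\|\partial_t^2\mathcal F_m\|_{L^\infty(0,T;L^\infty(\Gamma_m))}<\infty$; and for all $m$, $l$, $x\in\Gamma_m$, $t\in(0,T)$ $$\omega_M^2\,\partial_t^2\mathcal F_{m_l}(x,t)+\mathcal F_{m_l}(x,t)+\sum_{j=1}^M\int_{\Gamma_j}\sum_{i=1}^{N_j}\theta_{li}\,\frac{\overline{\mathbf C}}{4\pi|x-y|}\,\partial_t^2\mathcal F_{j_i}\big(y,t-c_0^{-1}|x-y|\big)\,d\sigma(y)=\partial_t^2u^{in}(x,t).$$ *Delay system.* $\mathbb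 Y_m=(Y_{m_1},\dots,Y_{m_{N_m}})^t$, where each $Y_{m_l}$ is $C^2$ on $(-\infty,T)$, vanishes for $t\le0$, and for all $m,l$ and $t\in(0,T)$ $$\omega_M^2\,Y_{m_l}''(t)+Y_{m_l}(t)+\sum_{j\ne m}\sum_{i=1}^{N_j}\theta_{li}\,\frac{\overline{\mathbf C}\,d^2}{4\pi|z_{m_l}-z_{j_i}|}\,Y_{j_i}''\big(t-c_0^{-1}|z_{m_l}-z_{j_i}|\big)=\partial_t^2u^{in}(z_{m_l},t).$$ **Proposition.** There is a constant $C>0$, depending only on $\boldsymbol\Gamma,K,T,\omega_M,\overline{\mathbf C},c_0,\rho_c,x_0,\theta,a,b$ (in particular not on $d$, the distribution of the bubbles, $\lambda$, $\mathcal F$, $\mathbb Y$ or $t$), such that for every distribution of bubbles and every $\lambda$ as above, every solution $\mathcal F$ of the surface integral equation and every solution $\mathbb Y$ of the delay system satisfy, for all $t\in(0,T)$, $$\sum_{m=1}^{M}\sum_{l=1}^{N_m}\big|\mathcal F_{m_l}(z_{m_l},t)-Y_{m_l}(t)\big|^2\;\le\;C\,d^2\sum_{m=1}^{M}\big\|\partial_t^2\mathcal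 F_m\big\|^2_{L^\infty(0,T;L^\infty(\Gamma_m))},$$ where $|\cdot|$ in the norm of the vector $\partial_t^2\mathcal F_m$ is the Euclidean norm. -/

import Mathlib

open Set Filter Topology MeasureTheory
open scoped ENNReal

noncomputable section

namespace BubbleScreen

/-- Three-dimensional Euclidean space. -/
abbrev E3 : Type := EuclideanSpace ℝ (Fin 3)

/-- Surface measure: the two-dimensional Hausdorff measure on `ℝ³`, normalised so that it gives the
usual area. -/
def surf : Measure E3 := Measure.euclideanHausdorffMeasure 2

/-- Bounded, connected, open subsets of `ℝ³` with `C²` boundary: near each boundary point the set is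
the negativity set of a `C²` function with non-vanishing differential. -/
structure IsC2Domain (Ω : Set E3) : Prop where
  isOpen : IsOpen Ω
  isConnected : IsConnected Ω
  isBounded : Bornology.IsBounded Ω
  boundary : ∀ x ∈ frontier Ω, ∃ φ : E3 → ℝ,
    ContDiffAt ℝ 2 φ x ∧ fderiv ℝ φ x ≠ 0 ∧ ∀ᶠ y in 𝓝 x, (y ∈ Ω ↔ φ y < 0)

/-- `Γ` is a `C²` surface of unit area: the whole boundary of a `C²` domain `Ω`, or a relatively
open part of it. -/
structure IsUnitC2Surface (Γ : Set E3) : Prop where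
  exists_domain : ∃ Ω : Set E3, IsC2Domain Ω ∧
    (Γ = frontier Ω ∨ ∃ V : Set E3, IsOpen V ∧ Γ = frontier Ω ∩ V)
  area : surf Γ = 1

/-- A distribution of bubbles on the surface `Γ` with multiplicity function `K`, at scale `d`.
The surface is partitioned (up to sets of zero area) into `M` patches of area exactly `d ^ 2` and of
diameter at most `b * d`; the patch with index `m` carries `count m = ⌊K (z) + 1⌋` centres, where
`z` is its first centre, and distinct centres are at distance at least `a * d`. -/
structure Distribution (Γ : Set E3) (K : E3 → ℝ) (a b : ℝ) where
  /-- number of patches -/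
  M : ℕ
  /-- length scale -/
  d : ℝ
  d_pos : 0 < d
  /-- the patches -/
  patch : Fin M → Set E3
  patch_subset : ∀ m, patch m ⊆ Γ
  patch_measurable : ∀ m, MeasurableSet (patch m)
  patch_disjoint : Pairwise fun m j => AEDisjoint surf (patch m) (patch j)
  patch_cover : surf (Γ \ ⋃ m, patch m) = 0
  patch_area : ∀ m, surf (patch m) = ENNReal.ofReal (d ^ 2)
  patch_diam : ∀ m, ∀ x ∈ patch m, ∀ y ∈ patch m, dist x y ≤ b * d
  /-- number of bubbles in each patch -/
  count : Fin M → ℕ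
  count_pos : ∀ m, 0 < count m
  /-- centres of the bubbles -/
  center : (m : Fin M) → Fin (count m) → E3
  center_mem : ∀ m l, center m l ∈ patch m
  count_eq : ∀ m, count m = ⌊K (center m ⟨0, count_pos m⟩) + 1⌋₊
  separated : ∀ p q : (Σ m, Fin (count m)), p ≠ q →
    a * d ≤ dist (center p.1 p.2) (center q.1 q.2)

/-- The incident wave of a point source at `x₀` with signal `lam`. -/
def incident (ρc c₀ : ℝ) (x₀ : E3) (lam : ℝ → ℝ) (x : E3) (t : ℝ) : ℝ :=
  ρc * lam (t - dist x x₀ / c₀) / dist x x₀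

/-- Entry pattern of the interaction matrices: `1` off the diagonal and `θ` on it. -/
def pattern (θ : ℝ) (l i : ℕ) : ℝ := if l = i then θ else 1

/-- Twice continuously differentiable functions of time on `(-∞, T)` that vanish for `t ≤ 0`; in
particular the function and its first derivative vanish at `0`. -/
def CausalC2 (T : ℝ) (f : ℝ → ℝ) : Prop :=
  ContDiffOn ℝ 2 f (Iio T) ∧ ∀ t ≤ 0, f t = 0

section Systems

variable {Γ : Set E3} {K : E3 → ℝ} {a b : ℝ} (P : Distribution Γ K a b)

/-- The vector `∂ₜ² F_m (y, t)` with its Euclidean norm. -/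
def accel (F : (m : Fin P.M) → Fin (P.count m) → E3 → ℝ → ℝ) (m : Fin P.M) (y : E3) (t : ℝ) :
    EuclideanSpace ℝ (Fin (P.count m)) :=
  WithLp.toLp 2 fun l => iteratedDeriv 2 (F m l y) t

/-- The norm of `∂ₜ² F_m` in `L^∞(0, T; L^∞(Γ_m))`. -/
def accelNorm (T : ℝ) (F : (m : Fin P.M) → Fin (P.count m) → E3 → ℝ → ℝ) (m : Fin P.M) : ℝ≥0∞ :=
  essSup (fun t => eLpNorm (fun y => accel P F m y t) ∞ (surf.restrict (P.patch m)))
    (volume.restrict (Ioo 0 T))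

/-- `F` solves the retarded surface integral equation on `Γ × (0, T)` with zero initial conditions.
`F m l y t` is the component number `l` of the unknown at the point `y` of the patch number `m`;
the unknown has as many components on a patch as the patch has bubbles. The matrix kernel at
`(x, y)` has the entries `pattern θ l i * Cb / (4 π |x - y|)`. -/
structure SolvesSurfaceEquation (T ω Cb c₀ θ : ℝ) (uin : E3 → ℝ → ℝ)
    (F : (m : Fin P.M) → Fin (P.count m) → E3 → ℝ → ℝ) : Prop where
  causal : ∀ m l, ∀ x ∈ P.patch m, CausalC2 T (F m l x)
  measurable : ∀ m l, ∀ t < T,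
    AEStronglyMeasurable (fun y => iteratedDeriv 2 (F m l y) t) (surf.restrict (P.patch m))
  bounded : ∀ m, accelNorm P T F m < ∞
  equation : ∀ m l, ∀ x ∈ P.patch m, ∀ t ∈ Ioo 0 T,
    ω ^ 2 * iteratedDeriv 2 (F m l x) t + F m l x t
      + ∑ j, ∫ y in P.patch j, ∑ i : Fin (P.count j),
          pattern θ l i * (Cb / (4 * Real.pi * dist x y))
            * iteratedDeriv 2 (F j i y) (t - dist x y / c₀) ∂surf
      = iteratedDeriv 2 (uin x) t

/-- `Y` solves the system of delay differential equations for the bubbles on `(0, T)` with zero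
initial conditions; the interaction coefficients are
`pattern θ l i * (Cb * d ^ 2) / (4 π |z_{m,l} - z_{j,i}|)` for `j ≠ m`. -/
structure SolvesDelaySystem (T ω Cb c₀ θ : ℝ) (uin : E3 → ℝ → ℝ)
    (Y : (m : Fin P.M) → Fin (P.count m) → ℝ → ℝ) : Prop where
  causal : ∀ m l, CausalC2 T (Y m l)
  equation : ∀ m l, ∀ t ∈ Ioo 0 T,
    ω ^ 2 * iteratedDeriv 2 (Y m l) t + Y m l t
      + ∑ j ∈ Finset.univ.erase m, ∑ i : Fin (P.count j),
          pattern θ l i * (Cb * P.d ^ 2 / (4 * Real.pi * dist (P.center m l) (P.center j i)))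
            * iteratedDeriv 2 (Y j i) (t - dist (P.center m l) (P.center j i) / c₀)
      = iteratedDeriv 2 (uin (P.center m l)) t

end Systems

end BubbleScreen

end

/-! ### Flatness of `C²` boundaries at small scales -/

namespace BubbleScreen

open scoped RealInnerProductSpace

/-! Both systems are integrated once in time, so that the unknowns become f = ∂ₜF and v = Y'. The
densities in the retarded potentials are then Lipschitz in time, with constant N_q = ‖∂ₜ²F‖ on the
cell q, and differences of delays can be estimated. The coupling with Y is a delay system with
exponentially damped coefficients. In the norm with weight exp(-2αt) and α large, both the double
time integral and the coupling are small compared with ω², so the error is bounded by the residual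
(`sum_weightedSq_le_residual`, `exists_decay_rate`).

The residual consists of two kinds of quadrature error: the change of a potential when its
evaluation point moves within a cell, and the change when a cell is replaced by a point source.
Bounded in absolute value, each is of order d ∑ d²/H² with H the regularised distance, and on a
surface this sum diverges logarithmically. Hence the first order Taylor term is kept apart. It is a
Riesz transform, regularised at scale d, of the density at the undelayed time; what remains has
weight d (d²/H + d³/H³), which Schur's test sums without loss (`exists_abs_potential_sub_le`,
`exists_abs_point_sub_potential_le`, `exists_W_bound`).

The Riesz term needs boundedness on L² of the surface, uniformly in d (`exists_regRiesz_bound`). The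
kernel is cut dyadically into odd bumps. A `C²` surface is flat up to a quadratic error, so an odd
bump at scale t has integral O(t) over it (`abs_setIntegral_oddBump_le`). Bumps at two different
scales are therefore almost orthogonal, and the Cotlar–Stein lemma applies
(`norm_sum_le_of_almost_orthogonal`). The bound passes to sampled values because the kernel changes
over a cell only by a Schur-bounded amount (`sum_sq_riesz_le`).

With these estimates, stability of a single oscillator shows that f varies by O(d) over the cells in
the ℓ² sense (`exists_sum_integral_sub_sq_le`). A second use of stability, now with the coupling,
gives the error between f at the centres and v (`exists_sum_integral_error_le`).

The constant must not depend on the signal, so the variation of the source is also controlled by the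
N_q: the surface equation itself expresses ∂ₜ²uⁱⁿ through the accelerations, and for a spherical
wave this temporal bound yields the spatial variation (`exists_forall_abs_source_le`,
`abs_integral_incident_sub_le`). -/

/-- On `U`, the set `S` is uniformly close to its tangent planes at scales below `r`, with
curvature bound `κ`. -/
def FlatOn (S U : Set E3) (r κ : ℝ) : Prop :=
  ∀ x ∈ S ∩ U, ∃ n : E3, ‖n‖ = 1 ∧ ∀ ρ, 0 < ρ → ρ ≤ r →
    (∀ y ∈ S, ∀ y' ∈ S, dist y x ≤ ρ → dist y' x ≤ ρ →
      |⟪n, y - y'⟫| ≤ κ * ρ * dist y y') ∧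
    (∀ p : E3, ⟪n, p⟫ = 0 → ‖p‖ ≤ ρ → ∃ τ : ℝ, |τ| ≤ κ * ρ ^ 2 ∧ x + p + τ • n ∈ S)

lemma FlatOn.mono {S U U' : Set E3} {r r' κ κ' : ℝ} (h : FlatOn S U r κ) (hU : U' ⊆ U)
    (hr : r' ≤ r) (hκ : κ ≤ κ') : FlatOn S U' r' κ' := by
  intro x hx
  obtain ⟨n, hn, H⟩ := h x ⟨hx.1, hU hx.2⟩
  refine ⟨n, hn, fun ρ h0 hρ => ⟨fun y hy y' hy' h1 h2 => ?_, fun p hp hpρ => ?_⟩⟩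
  · refine ((H ρ h0 (hρ.trans hr)).1 y hy y' hy' h1 h2).trans ?_
    gcongr
  · obtain ⟨τ, h1, h2⟩ := (H ρ h0 (hρ.trans hr)).2 p hp hpρ
    exact ⟨τ, h1.trans (by gcongr), h2⟩

/-- The normal is the normalised gradient of the defining function φ, whose gradient is Lipschitz.
Since φ vanishes on the boundary, its increments there are zero and the linear part must be as small
as the Taylor error. For the second clause, φ changes sign along a short normal segment, which
forces a boundary point on it. -/
lemma IsC2Domain.frontier_locally_flat {Ω : Set E3} (h : IsC2Domain Ω) {x₁ : E3}
    (hx₁ : x₁ ∈ frontier Ω) :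
    ∃ U ∈ 𝓝 x₁, ∃ r κ : ℝ, 0 < r ∧ 0 < κ ∧ FlatOn (frontier Ω) U r κ := by
  obtain ⟨φ, hφ, hd, hΩ⟩ := h.boundary x₁ hx₁
  have hφ1 : ContDiffAt ℝ 1 (fderiv ℝ φ) x₁ := hφ.fderiv_right (by norm_num)
  obtain ⟨L, V, hV, hLip⟩ := hφ1.exists_lipschitzOnWith
  have hdiff : ∀ᶠ y in 𝓝 x₁, ContDiffAt ℝ 2 φ y := hφ.eventually (by simp)
  set c : ℝ := ‖fderiv ℝ φ x₁‖ / 2 with hc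
  have hc0 : 0 < c := by have := norm_pos_iff.2 hd; positivity
  have hgrad : ∀ᶠ y in 𝓝 x₁, c < ‖fderiv ℝ φ y‖ := by
    have : Tendsto (fun y => ‖fderiv ℝ φ y‖) (𝓝 x₁) (𝓝 ‖fderiv ℝ φ x₁‖) :=
      hφ1.continuousAt.norm
    exact this.eventually (lt_mem_nhds (by linarith [norm_pos_iff.2 hd]))
  obtain ⟨R, hR, hball⟩ := Metric.eventually_nhds_iff.1 ((hdiff.and hgrad).and (hΩ.and hV))
  -- Chosen so that κ‖g‖ exceeds 4L: moving κρ² along the normal then beats the Taylor error 4Lρ² at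
  -- distance 2ρ.
  set κ : ℝ := (4 * L + 1) / c with hκ
  have hκ0 : 0 < κ := by positivity
  have hφ0 : ∀ y ∈ frontier Ω, dist y x₁ < R → φ y = 0 := by
    intro y hy hyR
    have hcont : ContinuousAt φ y := (hball hyR).1.1.continuousAt
    have hev : ∀ᶠ z in 𝓝 y, (z ∈ Ω ↔ φ z < 0) := by
      filter_upwards [Metric.ball_mem_nhds y (sub_pos.2 hyR)] with z hz
      refine (hball ?_).2.1
      calc dist z x₁ ≤ dist z y + dist y x₁ := dist_triangle _ _ _
        _ < R := by linarith [Metric.mem_ball.1 hz]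
    apply le_antisymm
    · have hcl : ∃ᶠ z in 𝓝 y, z ∈ Ω := mem_closure_iff_frequently.1 hy.1
      have : ∃ᶠ z in 𝓝 y, φ z ≤ 0 := (hcl.and_eventually hev).mono fun z hz => (hz.2.1 hz.1).le
      by_contra hpos
      exact this ((hcont.eventually (lt_mem_nhds (not_le.1 hpos))).mono fun z hz => not_le.2 hz)
    · have : y ∉ Ω := by
        have := hy.2
        rwa [h.isOpen.interior_eq] at this
      rw [(hball hyR).2.1] at this
      exact not_lt.1 this
  -- The bound R/8 keeps balls of radius 2ρ about x inside the good neighbourhood, and 1/κ ensures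
  -- κρ² ≤ ρ.
  refine ⟨Metric.ball x₁ (R / 4), Metric.ball_mem_nhds _ (by positivity),
    min (R / 8) (1 / κ), κ, by positivity, hκ0, ?_⟩
  rintro x ⟨hxS, hxU⟩
  rw [Metric.mem_ball] at hxU
  set A := fderiv ℝ φ x with hA
  set g : E3 := (InnerProductSpace.toDual ℝ E3).symm A with hg
  have hAg : ∀ v, A v = ⟪g, v⟫ := fun v => by
    rw [hg, InnerProductSpace.toDual_symm_apply]
  have hgn : c < ‖g‖ := by
    rw [hg, LinearIsometryEquiv.norm_map]; exact (hball (by linarith)).1.2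
  have hg0 : 0 < ‖g‖ := hc0.trans hgn
  -- On the ball of radius ρ, φ minus its linearisation at x has gradient at most Lρ.
  have key : ∀ ρ, 0 < ρ → ρ ≤ R / 4 → ∀ y y', dist y x ≤ ρ → dist y' x ≤ ρ →
      |φ y - φ y' - ⟪g, y - y'⟫| ≤ L * ρ * dist y y' := by
    intro ρ h0 hρ y y' hy hy'
    have hsub : ∀ z ∈ Metric.closedBall x ρ, dist z x₁ < R := fun z hz => by
      have := dist_triangle z x x₁
      have := Metric.mem_closedBall.1 hz
      linarith
    have := (convex_closedBall x ρ).norm_image_sub_le_of_norm_fderivWithin_le' (𝕜 := ℝ) (f := φ)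
      (φ := A) (C := L * ρ) (x := y') (y := y) ?_ ?_ hy' hy
    · rwa [Real.norm_eq_abs, hAg, ← dist_eq_norm y y'] at this
    · intro z hz
      exact ((hball (hsub z hz)).1.1.differentiableAt (by norm_num)).differentiableWithinAt
    · intro z hz
      rw [fderivWithin_eq_fderiv (uniqueDiffWithinAt_convex (convex_closedBall x ρ)
        (by rw [interior_closedBall _ h0.ne']; exact ⟨x, Metric.mem_ball_self h0⟩)
        (subset_closure hz))
        ((hball (hsub z hz)).1.1.differentiableAt (by norm_num))]
      rw [hA, ← dist_eq_norm]
      refine (hLip.dist_le_mul _ (hball (hsub z hz)).2.2 _ (hball (by linarith)).2.2).trans ?_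
      gcongr
      exact hz
  refine ⟨‖g‖⁻¹ • g, by rw [norm_smul, norm_inv, norm_norm, inv_mul_cancel₀ hg0.ne'], ?_⟩
  intro ρ h0 hρ
  have hρR : ρ ≤ R / 8 := hρ.trans (min_le_left _ _)
  have hρκ : κ * ρ ≤ 1 := by
    have := hρ.trans (min_le_right _ _)
    rwa [le_div_iff₀ hκ0, mul_comm] at this
  have hcκ : c * κ = 4 * L + 1 := by rw [hκ]; field_simp
  have hL0 : (0 : ℝ) ≤ L := L.2
  constructor
  · intro y hy y' hy' h1 h2
    have hR' : ∀ z, dist z x ≤ ρ → dist z x₁ < R := fun z hz => by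
      linarith [dist_triangle z x x₁]
    have := key ρ h0 (by linarith) y y' h1 h2
    rw [hφ0 y hy (hR' y h1), hφ0 y' hy' (hR' y' h2), sub_self, zero_sub, abs_neg] at this
    rw [real_inner_smul_left, abs_mul, abs_inv, abs_norm]
    rw [inv_mul_le_iff₀ hg0]
    refine this.trans ?_
    have : (L : ℝ) ≤ ‖g‖ * κ := by nlinarith
    calc (L : ℝ) * ρ * dist y y' ≤ (‖g‖ * κ) * ρ * dist y y' := by gcongr
      _ = _ := by ring
  · intro p hp hpρ
    have hgp : ⟪g, p⟫ = 0 := by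
      rw [real_inner_smul_left] at hp
      exact (mul_eq_zero.1 hp).resolve_left (inv_ne_zero hg0.ne')
    set n := ‖g‖⁻¹ • g with hn
    have hn1 : ‖n‖ = 1 := by rw [hn, norm_smul, norm_inv, norm_norm, inv_mul_cancel₀ hg0.ne']
    have hgn' : ⟪g, n⟫ = ‖g‖ := by
      rw [hn, real_inner_smul_right, real_inner_self_eq_norm_sq]; field_simp
    have hφx : φ x = 0 := hφ0 x hxS (by linarith)
    have hτρ : κ * ρ ^ 2 ≤ ρ := by nlinarith
    have est : ∀ τ : ℝ, |τ| ≤ κ * ρ ^ 2 → |φ (x + p + τ • n) - τ * ‖g‖| ≤ 4 * L * ρ ^ 2 ∧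
        dist (x + p + τ • n) x₁ < R := by
      intro τ hτ
      have hdist : dist (x + p + τ • n) x ≤ 2 * ρ := by
        rw [dist_eq_norm, show x + p + τ • n - x = p + τ • n by abel]
        refine (norm_add_le _ _).trans ?_
        rw [norm_smul, hn1, mul_one, Real.norm_eq_abs]
        linarith
      refine ⟨?_, by linarith [dist_triangle (x + p + τ • n) x x₁]⟩
      have := key (2 * ρ) (by linarith) (by linarith) (x + p + τ • n) x hdist (by simp; linarith)
      rw [hφx, sub_zero, show x + p + τ • n - x = p + τ • n by abel, inner_add_right, hgp,
        real_inner_smul_right, hgn', zero_add] at this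
      refine this.trans ?_
      calc L * (2 * ρ) * dist (x + p + τ • n) x ≤ L * (2 * ρ) * (2 * ρ) := by gcongr
        _ = _ := by ring
    have hτ0 : 0 < κ * ρ ^ 2 := by positivity
    have hbig : 4 * L * ρ ^ 2 < κ * ρ ^ 2 * ‖g‖ := by
      have : 4 * L + 1 ≤ κ * ‖g‖ := by nlinarith
      nlinarith [sq_pos_of_pos h0]
    let seg : Set E3 := (fun τ : ℝ => x + p + τ • n) '' Icc (-(κ * ρ ^ 2)) (κ * ρ ^ 2)
    have hseg : IsPreconnected seg :=
      isPreconnected_Icc.image _ (by fun_prop)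
    have hneg : (seg ∩ Ω).Nonempty := by
      refine ⟨_, ⟨-(κ * ρ ^ 2), ⟨le_rfl, by linarith⟩, rfl⟩, ?_⟩
      obtain ⟨h1, h2⟩ := est (-(κ * ρ ^ 2)) (by rw [abs_neg, abs_of_pos hτ0])
      rw [(hball h2).2.1]
      linarith [(abs_le.1 h1).2]
    have hpos : x + p + (κ * ρ ^ 2) • n ∉ Ω := by
      obtain ⟨h1, h2⟩ := est (κ * ρ ^ 2) (by rw [abs_of_pos hτ0])
      rw [(hball h2).2.1]
      linarith [(abs_le.1 h1).1]
    by_contra hcon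
    push Not at hcon
    have hfr : ∀ z ∈ seg, z ∉ frontier Ω := by
      rintro z ⟨τ, hτ, rfl⟩
      exact hcon τ (abs_le.2 hτ)
    -- A segment missing the frontier would be separated by Ω and the complement of its closure, yet
    -- it has points in both.
    have hcl : ∀ z ∈ seg, z ∈ closure Ω → z ∈ Ω := fun z hz hc => by
      by_contra hzΩ
      exact hfr z hz ⟨hc, fun hi => hzΩ (interior_subset hi)⟩
    obtain ⟨z, _, hz1, hz2⟩ := hseg Ω (closure Ω)ᶜ h.isOpen isClosed_closure.isOpen_compl
      (fun z hz => by
        by_cases hc : z ∈ closure Ω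
        · exact Or.inl (hcl z hz hc)
        · exact Or.inr hc) hneg
      ⟨_, ⟨κ * ρ ^ 2, ⟨by linarith, le_rfl⟩, rfl⟩, fun hc =>
        hpos (hcl _ ⟨κ * ρ ^ 2, ⟨by linarith, le_rfl⟩, rfl⟩ hc)⟩
    exact hz2 (subset_closure hz1)

lemma IsC2Domain.isCompact_frontier {Ω : Set E3} (h : IsC2Domain Ω) :
    IsCompact (frontier Ω) :=
  h.isBounded.isCompact_closure.of_isClosed_subset isClosed_frontier frontier_subset_closure

/-- Compactness of the boundary: finitely many local constants are merged by minimum and maximum. -/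
lemma IsC2Domain.frontier_flat {Ω : Set E3} (h : IsC2Domain Ω) :
    ∃ r κ : ℝ, 0 < r ∧ 0 < κ ∧ FlatOn (frontier Ω) univ r κ := by
  have : ∃ r κ : ℝ, 0 < r ∧ 0 < κ ∧ FlatOn (frontier Ω) (frontier Ω) r κ := by
    refine h.isCompact_frontier.induction_on (p := fun U => ∃ r κ : ℝ, 0 < r ∧ 0 < κ ∧
      FlatOn (frontier Ω) U r κ) ⟨1, 1, one_pos, one_pos, fun x hx => hx.2.elim⟩ ?_ ?_ ?_
    · rintro s t hst ⟨r, κ, hr, hκ, H⟩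
      exact ⟨r, κ, hr, hκ, H.mono hst le_rfl le_rfl⟩
    · rintro s t ⟨r, κ, hr, hκ, H⟩ ⟨r', κ', hr', hκ', H'⟩
      refine ⟨min r r', max κ κ', lt_min hr hr', lt_max_of_lt_left hκ, ?_⟩
      rintro x ⟨hxS, hx | hx⟩
      · exact (H.mono subset_rfl (min_le_left _ _) (le_max_left _ _)) x ⟨hxS, hx⟩
      · exact (H'.mono subset_rfl (min_le_right _ _) (le_max_right _ _)) x ⟨hxS, hx⟩
    · intro x hx
      obtain ⟨U, hU, H⟩ := h.frontier_locally_flat hx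
      exact ⟨U, mem_nhdsWithin_of_mem_nhds hU, H⟩
  obtain ⟨r, κ, hr, hκ, H⟩ := this
  exact ⟨r, κ, hr, hκ, fun x hx => H x ⟨hx.1, hx.1⟩⟩

end BubbleScreen

/-! ### Surface measure of small balls via tangential projection -/

namespace BubbleScreen

open scoped RealInnerProductSpace NNReal

lemma surf_image_le {K : ℝ≥0} {f : E3 → E3} {s : Set E3} (h : LipschitzOnWith K f s) :
    surf (f '' s) ≤ (K : ℝ≥0∞) ^ 2 * surf s := by
  have := h.hausdorffMeasure_image_le (d := ((2 : ℕ) : ℝ)) (by positivity)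
  rw [ENNReal.rpow_natCast] at this
  simp only [surf, Measure.euclideanHausdorffMeasure_def, Measure.smul_apply]
  rw [ENNReal.smul_def, ENNReal.smul_def, smul_eq_mul, smul_eq_mul, mul_left_comm]
  gcongr

/-- The plane through the origin orthogonal to `n`. -/
def plane (n : E3) : Set E3 := {p | ⟪n, p⟫ = 0}

/-- The normalised Hausdorff measure is invariant under the isometric inclusion of the orthogonal
complement of n, and on that two-dimensional space it is Lebesgue measure. -/
lemma surf_plane_inter_closedBall {n : E3} (hn : ‖n‖ = 1) {r : ℝ} (hr : 0 ≤ r) :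
    surf (plane n ∩ Metric.closedBall 0 r) = ENNReal.ofReal (Real.pi * r ^ 2) := by
  have hn0 : n ≠ 0 := by rintro rfl; simp at hn
  have : Fact (Module.finrank ℝ E3 = 2 + 1) := ⟨by simp⟩
  let W : Submodule ℝ E3 := (ℝ ∙ n)ᗮ
  have hfin : Module.finrank ℝ W = 2 := Submodule.finrank_orthogonal_span_singleton hn0
  have : Nontrivial W := Module.nontrivial_of_finrank_pos (R := ℝ) (by rw [hfin]; norm_num)
  have himg : plane n ∩ Metric.closedBall 0 r = (fun w : W => (w : E3)) '' Metric.closedBall 0 r := by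
    ext p
    simp only [plane, mem_inter_iff, mem_ofPred_eq, Metric.mem_closedBall, dist_zero_right, mem_image]
    constructor
    · rintro ⟨h1, h2⟩
      exact ⟨⟨p, Submodule.mem_orthogonal_singleton_iff_inner_right.2 h1⟩, h2, rfl⟩
    · rintro ⟨w, h1, rfl⟩
      exact ⟨Submodule.mem_orthogonal_singleton_iff_inner_right.1 w.2, h1⟩
  have hiso : Isometry (fun w : W => (w : E3)) := isometry_subtype_coe
  have hvol : (Measure.euclideanHausdorffMeasure 2 : Measure W) = volume := by
    rw [← InnerProductSpace.euclideanHausdorffMeasure_eq_volume, hfin]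
  rw [himg, surf, hiso.euclideanHausdorffMeasure_image, hvol, InnerProductSpace.volume_closedBall,
    hfin, ← ENNReal.ofReal_pow hr, ← ENNReal.ofReal_mul (by positivity)]
  congr 1
  rw [Real.sq_sqrt Real.pi_pos.le]
  norm_num [Real.Gamma_two]
  ring

/-- The orthogonal projection of `y - x` to the plane orthogonal to the unit vector `n`. -/
noncomputable def tangentProj (n x y : E3) : E3 := (y - x) - ⟪n, y - x⟫ • n

lemma continuous_tangentProj (n x : E3) : Continuous (tangentProj n x) := by
  unfold tangentProj; fun_prop

lemma tangentProj_sub (n x y y' : E3) :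
    tangentProj n x y - tangentProj n x y' = (y - y') - ⟪n, y - y'⟫ • n := by
  have : ⟪n, y - y'⟫ = ⟪n, y - x⟫ - ⟪n, y' - x⟫ := by
    rw [← inner_sub_right]; congr 1; abel
  rw [tangentProj, tangentProj, this, sub_smul]
  abel

lemma norm_sub_inner_smul_sq {n : E3} (hn : ‖n‖ = 1) (v : E3) :
    ‖v - ⟪n, v⟫ • n‖ ^ 2 = ‖v‖ ^ 2 - ⟪n, v⟫ ^ 2 := by
  rw [norm_sub_sq_real, real_inner_smul_right, norm_smul, hn, mul_one, Real.norm_eq_abs, sq_abs,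
    real_inner_comm]
  ring

lemma dist_tangentProj_sq {n : E3} (hn : ‖n‖ = 1) (x y y' : E3) :
    dist (tangentProj n x y) (tangentProj n x y') ^ 2 = dist y y' ^ 2 - ⟪n, y - y'⟫ ^ 2 := by
  rw [dist_eq_norm, tangentProj_sub, norm_sub_inner_smul_sq hn, dist_eq_norm]

lemma dist_tangentProj_le {n : E3} (hn : ‖n‖ = 1) (x y y' : E3) :
    dist (tangentProj n x y) (tangentProj n x y') ≤ dist y y' := by
  apply le_of_sq_le_sq _ dist_nonneg
  rw [dist_tangentProj_sq hn]
  nlinarith [sq_nonneg ⟪n, y - y'⟫]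

lemma tangentProj_self (n x : E3) : tangentProj n x x = 0 := by simp [tangentProj]

lemma tangentProj_mem_plane {n : E3} (hn : ‖n‖ = 1) (x y : E3) : tangentProj n x y ∈ plane n := by
  simp [plane, tangentProj, inner_sub_right, real_inner_smul_right, hn]

lemma surf_tangentProj_image_le {n : E3} (hn : ‖n‖ = 1) (x : E3) (A : Set E3) :
    surf (tangentProj n x '' A) ≤ surf A := by
  have : LipschitzOnWith 1 (tangentProj n x) A :=
    (LipschitzWith.of_dist_le_mul fun y y' => by
      simpa using dist_tangentProj_le hn x y y').lipschitzOnWith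
  simpa using surf_image_le this

/-- By Pythagoras the projection shrinks squared distances at most by the factor 1 - ε², and (1 +
2ε²)(1 - ε²) ≥ 1 for ε ≤ 1/2. The inverse of the projection is thus Lipschitz, and area scales with
the square of its constant. -/
lemma surf_le_tangentProj_image {n : E3} (hn : ‖n‖ = 1) (x : E3) {A : Set E3} {ε : ℝ}
    (hε0 : 0 ≤ ε) (hε : ε ≤ 1 / 2)
    (h : ∀ y ∈ A, ∀ y' ∈ A, |⟪n, y - y'⟫| ≤ ε * dist y y') :
    surf A ≤ ENNReal.ofReal (1 + 2 * ε ^ 2) * surf (tangentProj n x '' A) := by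
  set P := tangentProj n x
  set k : ℝ := 1 + 2 * ε ^ 2
  have hk : 0 ≤ k := by positivity
  have hexp : ∀ y ∈ A, ∀ y' ∈ A, dist y y' ≤ √k * dist (P y) (P y') := by
    intro y hy y' hy'
    apply le_of_sq_le_sq _ (by positivity)
    rw [mul_pow, Real.sq_sqrt hk, dist_tangentProj_sq hn]
    have h1 : ⟪n, y - y'⟫ ^ 2 ≤ ε ^ 2 * dist y y' ^ 2 := by
      rw [← mul_pow, ← sq_abs]
      gcongr
      exact h y hy y' hy'
    have h2 : ε ^ 2 ≤ 1 / 4 := by nlinarith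
    have : k * (dist y y' ^ 2 - ε ^ 2 * dist y y' ^ 2) ≥ dist y y' ^ 2 := by
      have : k * (1 - ε ^ 2) ≥ 1 := by simp only [k]; nlinarith [sq_nonneg ε]
      nlinarith [sq_nonneg (dist y y')]
    nlinarith
  have hinj : InjOn P A := fun y hy y' hy' he => by
    have := hexp y hy y' hy'
    rw [he, dist_self, mul_zero] at this
    exact dist_le_zero.1 this
  have hLip : LipschitzOnWith (Real.toNNReal √k) (Function.invFunOn P A) (P '' A) := by
    apply LipschitzOnWith.of_dist_le_mul
    rintro _ ⟨y, hy, rfl⟩ _ ⟨y', hy', rfl⟩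
    rw [hinj.leftInvOn_invFunOn hy, hinj.leftInvOn_invFunOn hy',
      Real.coe_toNNReal _ (Real.sqrt_nonneg _)]
    exact hexp y hy y' hy'
  have himg : Function.invFunOn P A '' (P '' A) = A := hinj.invFunOn_image subset_rfl
  have := surf_image_le hLip
  rw [himg] at this
  refine this.trans_eq ?_
  congr 1
  rw [← ENNReal.ofReal, ← ENNReal.ofReal_pow (Real.sqrt_nonneg _), Real.sq_sqrt hk]

/-- Upper quadratic growth of balls for the surface measure on `S`. -/
lemma IsC2Domain.surf_frontier_inter_closedBall_le {Ω : Set E3} (h : IsC2Domain Ω) :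
    ∃ C : ℝ, 0 < C ∧ ∀ (x : E3) (r : ℝ), 0 < r →
      surf (frontier Ω ∩ Metric.closedBall x r) ≤ ENNReal.ofReal (C * r ^ 2) := by
  obtain ⟨r₀, κ, hr₀, hκ, H⟩ := h.frontier_flat
  set S := frontier Ω
  set R := min r₀ (1 / (2 * κ)) with hR
  have hR0 : 0 < R := by positivity
  have hRκ : κ * R ≤ 1 / 2 := by
    have : R ≤ 1 / (2 * κ) := min_le_right _ _
    rw [le_div_iff₀ (by positivity)] at this
    linarith
  have small : ∀ x ∈ S, ∀ r, 0 < r → r ≤ R →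
      surf (S ∩ Metric.closedBall x r) ≤ ENNReal.ofReal (8 * r ^ 2) := by
    intro x hx r hr hrR
    obtain ⟨n, hn, Hn⟩ := H x ⟨hx, trivial⟩
    have hκr : κ * r ≤ 1 / 2 := (mul_le_mul_of_nonneg_left hrR hκ.le).trans hRκ
    refine (surf_le_tangentProj_image hn x (ε := κ * r) (by positivity) hκr ?_).trans ?_
    · intro y hy y' hy'
      exact (Hn r hr (hrR.trans (min_le_left _ _))).1 y hy.1 y' hy'.1 hy.2 hy'.2
    · have hsub : tangentProj n x '' (S ∩ Metric.closedBall x r) ⊆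
          plane n ∩ Metric.closedBall 0 r := by
        rintro _ ⟨y, hy, rfl⟩
        refine ⟨tangentProj_mem_plane hn x y, ?_⟩
        rw [Metric.mem_closedBall, ← tangentProj_self n x]
        exact (dist_tangentProj_le hn x y x).trans hy.2
      calc _ ≤ ENNReal.ofReal (1 + 2 * (κ * r) ^ 2) * ENNReal.ofReal (Real.pi * r ^ 2) := by
            rw [← surf_plane_inter_closedBall hn hr.le]
            gcongr
        _ = ENNReal.ofReal ((1 + 2 * (κ * r) ^ 2) * (Real.pi * r ^ 2)) := by
            rw [← ENNReal.ofReal_mul (by positivity)]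
        _ ≤ _ := by
            apply ENNReal.ofReal_le_ofReal
            have : (κ * r) ^ 2 ≤ 1 / 4 := by
              have : 0 ≤ κ * r := by positivity
              nlinarith
            nlinarith [Real.pi_le_four, sq_nonneg r, Real.pi_pos, mul_nonneg Real.pi_pos.le (sq_nonneg r)]
  have hfin : surf S < ∞ := by
    apply h.isCompact_frontier.measure_lt_top_of_nhdsWithin
    intro x hx
    refine ⟨S ∩ Metric.closedBall x R, ?_, (small x hx R hR0 le_rfl).trans_lt ENNReal.ofReal_lt_top⟩
    exact inter_mem_nhdsWithin _ (Metric.closedBall_mem_nhds x hR0)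
  set A := (surf S).toReal
  -- The 32 is 8 · 2², from recentring at a point of the surface with doubled radius; the second
  -- term covers radii above R/2 by the total area.
  refine ⟨32 + 4 * A / R ^ 2, by positivity, fun x r hr => ?_⟩
  rcases (S ∩ Metric.closedBall x r).eq_empty_or_nonempty with he | ⟨x', hx'⟩
  · rw [he]; simp
  by_cases hrR : 2 * r ≤ R
  · refine (measure_mono ?_).trans ((small x' hx'.1 (2 * r) (by positivity) hrR).trans ?_)
    · rintro y ⟨hy1, hy2⟩
      refine ⟨hy1, ?_⟩
      rw [Metric.mem_closedBall] at *
      have := dist_triangle_right y x' x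
      have := Metric.mem_closedBall.1 hx'.2
      linarith
    · apply ENNReal.ofReal_le_ofReal
      have : 0 ≤ 4 * A / R ^ 2 * r ^ 2 := by positivity
      nlinarith
  · refine (measure_mono inter_subset_left).trans ?_
    rw [← ENNReal.ofReal_toReal hfin.ne]
    apply ENNReal.ofReal_le_ofReal
    push Not at hrR
    have h1 : 1 ≤ 4 * r ^ 2 / R ^ 2 := by
      rw [le_div_iff₀ (by positivity)]; nlinarith
    have hA : 0 ≤ A := ENNReal.toReal_nonneg
    calc A ≤ A * (4 * r ^ 2 / R ^ 2) := le_mul_of_one_le_right hA h1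
      _ = 4 * A / R ^ 2 * r ^ 2 := by ring
      _ ≤ _ := by nlinarith [sq_nonneg r]

/-- The projection does not increase area, and its image contains a disc by the second clause of
flatness. This later makes sets of full measure dense in the surface. -/
lemma IsC2Domain.surf_frontier_inter_closedBall_pos {Ω : Set E3} (h : IsC2Domain Ω) {x : E3}
    (hx : x ∈ frontier Ω) {r : ℝ} (hr : 0 < r) :
    0 < surf (frontier Ω ∩ Metric.closedBall x r) := by
  obtain ⟨r₀, κ, hr₀, hκ, H⟩ := h.frontier_flat
  obtain ⟨n, hn, Hn⟩ := H x ⟨hx, trivial⟩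
  set ρ := min (min r₀ (1 / κ)) (r / 2) with hρ
  have hρ0 : 0 < ρ := by positivity
  have hρr : ρ ≤ r / 2 := min_le_right _ _
  have hρκ : κ * ρ ≤ 1 := by
    have : ρ ≤ 1 / κ := (min_le_left _ _).trans (min_le_right _ _)
    rwa [le_div_iff₀ hκ, mul_comm] at this
  have hsub : plane n ∩ Metric.closedBall 0 ρ ⊆
      tangentProj n x '' (frontier Ω ∩ Metric.closedBall x r) := by
    rintro p ⟨hp1, hp2⟩
    rw [Metric.mem_closedBall, dist_zero_right] at hp2
    obtain ⟨τ, hτ, hmem⟩ := (Hn ρ hρ0 ((min_le_left _ _).trans (min_le_left _ _))).2 p hp1 hp2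
    refine ⟨_, ⟨hmem, ?_⟩, ?_⟩
    · rw [Metric.mem_closedBall, dist_eq_norm, show x + p + τ • n - x = p + τ • n by abel]
      refine (norm_add_le _ _).trans ?_
      rw [norm_smul, hn, mul_one, Real.norm_eq_abs]
      nlinarith
    · have hp : ⟪n, p⟫ = 0 := hp1
      simp only [tangentProj, show x + p + τ • n - x = p + τ • n by abel, inner_add_right,
        real_inner_smul_right, real_inner_self_eq_norm_sq, hn, hp]
      simp
  calc 0 < surf (plane n ∩ Metric.closedBall 0 ρ) := by
        rw [surf_plane_inter_closedBall hn hρ0.le, ENNReal.ofReal_pos]; positivity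
    _ ≤ _ := measure_mono hsub
    _ ≤ _ := surf_tangentProj_image_le hn x _

end BubbleScreen

/-! ### Cancellation of odd kernels on the surface -/

namespace BubbleScreen

open scoped RealInnerProductSpace NNReal

/-- An odd Lipschitz bump at scale `t`, of the size of the Riesz kernel in dimension two. -/
structure IsOddBump (t : ℝ) (Q : E3 → ℝ) : Prop where
  odd : ∀ v, Q (-v) = -Q v
  bound : ∀ v, |Q v| ≤ (t ^ 2)⁻¹
  lip : ∀ v w, |Q v - Q w| ≤ 8 / t ^ 3 * dist v w
  support : ∀ v, 2 * t ≤ ‖v‖ → Q v = 0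

lemma IsOddBump.continuous {t : ℝ} {Q : E3 → ℝ} (h : IsOddBump t Q) : Continuous Q := by
  have : LipschitzWith (Real.toNNReal (8 / t ^ 3)) Q := LipschitzWith.of_dist_le_mul fun v w => by
    rw [Real.dist_eq]
    exact (h.lip v w).trans (by gcongr; exact Real.le_coe_toNNReal _)
  exact this.continuous

/-- The reflection in the origin preserves both the disc and the area. -/
lemma IsOddBump.setIntegral_plane_eq_zero {t : ℝ} {Q : E3 → ℝ} (h : IsOddBump t Q) (n : E3)
    (r : ℝ) : ∫ p in plane n ∩ Metric.closedBall 0 r, Q (-p) ∂surf = 0 := by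
  set D := plane n ∩ Metric.closedBall (0 : E3) r
  have hmp : MeasurePreserving (fun v : E3 => -v) surf surf :=
    (IsometryEquiv.neg E3).measurePreserving_euclideanHausdorffMeasure 2
  have hD : (fun v : E3 => -v) ⁻¹' D = D := by
    ext v; simp [D, plane]
  have := hmp.setIntegral_preimage_emb (Homeomorph.neg E3).measurableEmbedding Q D
  rw [hD] at this
  have h2 : ∫ p in D, Q (-p) ∂surf = -∫ p in D, Q p ∂surf := by
    rw [← integral_neg]; simp_rw [h.odd]
  linarith

/-- Two measures that nearly agree have nearly the same integrals of bounded functions. -/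
lemma abs_integral_sub_le_of_le_of_le {α : Type*} [MeasurableSpace α] {μ ν : Measure α}
    [IsFiniteMeasure μ] [IsFiniteMeasure ν] {η B : ℝ} (hη : 0 ≤ η) (h1 : ν ≤ μ)
    (h2 : μ univ ≤ ENNReal.ofReal (1 + η) * ν univ) {f : α → ℝ} (hf : Measurable f)
    (hB : ∀ x, |f x| ≤ B) :
    |∫ x, f x ∂μ - ∫ x, f x ∂ν| ≤ B * (η * (ν univ).toReal) := by
  have hsub : (μ - ν) + ν = μ := Measure.sub_add_cancel_of_le h1
  have : IsFiniteMeasure (μ - ν) := ⟨(Measure.le_iff.1 Measure.sub_le _ .univ).trans_lt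
    (measure_lt_top μ _)⟩
  have hint : ∀ ρ : Measure α, IsFiniteMeasure ρ → Integrable f ρ := fun ρ hρ =>
    (integrable_const B).mono' hf.aestronglyMeasurable (Eventually.of_forall fun x => hB x)
  have hI : ∫ x, f x ∂μ = ∫ x, f x ∂(μ - ν) + ∫ x, f x ∂ν := by
    conv_lhs => rw [← hsub]
    exact integral_add_measure (hint _ inferInstance) (hint _ inferInstance)
  rw [hI, add_sub_cancel_right]
  have hle : |∫ x, f x ∂(μ - ν)| ≤ B * ((μ - ν).real univ) := by
    rw [← Real.norm_eq_abs]
    exact norm_integral_le_of_norm_le_const (Eventually.of_forall fun x => hB x)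
  rcases isEmpty_or_nonempty α with hα | ⟨⟨x⟩⟩
  · simp [Measure.eq_zero_of_isEmpty]
  refine hle.trans (mul_le_mul_of_nonneg_left ?_ ((abs_nonneg _).trans (hB x)))
  have e : (μ univ).toReal = (μ - ν).real univ + (ν univ).toReal := by
    conv_lhs => rw [← hsub]
    rw [Measure.add_apply, ENNReal.toReal_add (measure_ne_top _ _) (measure_ne_top _ _)]
    rfl
  have := ENNReal.toReal_mono (by finiteness) h2
  rw [ENNReal.toReal_mul, ENNReal.toReal_ofReal (by positivity)] at this
  linarith

/-- Odd bumps nearly have mean value zero on a `C²` surface. -/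
lemma IsC2Domain.abs_setIntegral_oddBump_le {Ω : Set E3} (h : IsC2Domain Ω) :
    ∃ C : ℝ, 0 < C ∧ ∀ x ∈ frontier Ω, ∀ t, 0 < t → ∀ Q, IsOddBump t Q →
      |∫ y in frontier Ω, Q (x - y) ∂surf| ≤ C * t := by
  obtain ⟨r₀, κ, hr₀, hκ, H⟩ := h.frontier_flat
  obtain ⟨C₀, hC₀, hup⟩ := h.surf_frontier_inter_closedBall_le
  set S := frontier Ω
  have hScomp : IsCompact S := h.isCompact_frontier
  set R := min r₀ (1 / (2 * κ)) with hR
  have hR0 : 0 < R := by positivity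
  have hRκ : κ * R ≤ 1 / 2 := by
    have : R ≤ 1 / (2 * κ) := min_le_right _ _
    rw [le_div_iff₀ (by positivity)] at this
    linarith
  have hball : ∀ x t, 0 < t → surf (S ∩ Metric.closedBall x t) < ∞ := fun x t ht =>
    (hup x t ht).trans_lt ENNReal.ofReal_lt_top
  have hballr : ∀ x t, 0 < t → surf.real (S ∩ Metric.closedBall x t) ≤ C₀ * t ^ 2 := fun x t ht =>
    ENNReal.toReal_le_of_le_ofReal (by positivity) (hup x t ht)
  have restr : ∀ (x : E3) t Q ρ, IsOddBump t Q → 2 * t ≤ ρ →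
      ∫ y in S, Q (x - y) ∂surf = ∫ y in S ∩ Metric.closedBall x ρ, Q (x - y) ∂surf := by
    intro x t Q ρ hQ hρ
    apply setIntegral_eq_of_subset_of_forall_sdiff_eq_zero isClosed_frontier.measurableSet
      inter_subset_left
    rintro y ⟨hy1, hy2⟩
    apply hQ.support
    rw [← dist_eq_norm, dist_comm]
    by_contra hlt
    exact hy2 ⟨hy1, by rw [Metric.mem_closedBall]; linarith⟩
  refine ⟨8 * κ * 16 * C₀ * 16 + C₀ * 16 * 32 * κ * (1 / 2) * 4 + 16 * C₀ / R + 1, by positivity,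
    fun x hx t ht Q hQ => ?_⟩
  -- At scales that are not small, the trivial bound by a constant is already a bound by a multiple
  -- of t.
  by_cases htR : 4 * t ≤ R
  swap
  · rw [restr x t Q (2 * t) hQ le_rfl, ← Real.norm_eq_abs]
    refine (norm_setIntegral_le_of_norm_le_const (hball x _ (by positivity))
      (fun y _ => hQ.bound (x - y))).trans ?_
    push Not at htR
    calc (t ^ 2)⁻¹ * surf.real (S ∩ Metric.closedBall x (2 * t))
        ≤ (t ^ 2)⁻¹ * (C₀ * (2 * t) ^ 2) := by gcongr; exact hballr x _ (by positivity)
      _ = 4 * C₀ := by field_simp; ring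
      _ ≤ 16 * C₀ / R * t := by
          rw [div_mul_eq_mul_div, le_div_iff₀ hR0]; nlinarith
      _ ≤ _ := by
          have : 0 ≤ 8 * κ * 16 * C₀ * 16 + C₀ * 16 * 32 * κ * (1 / 2) * 4 + 1 := by positivity
          nlinarith
  obtain ⟨n, hn, Hn⟩ := H x ⟨hx, trivial⟩
  set ρ := 4 * t with hρ
  have hρ0 : 0 < ρ := by positivity
  have hκρ : κ * ρ ≤ 1 / 2 := (mul_le_mul_of_nonneg_left htR hκ.le).trans hRκ
  obtain ⟨Hflat, -⟩ := Hn ρ hρ0 (htR.trans (min_le_left _ _))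
  set A := S ∩ Metric.closedBall x ρ with hA
  set P := tangentProj n x
  have hPc : Continuous P := continuous_tangentProj n x
  have hAcomp : IsCompact A := hScomp.inter_right Metric.isClosed_closedBall
  set D := P '' A
  have hDcomp : IsCompact D := hAcomp.image hPc
  have hflatA : ∀ y ∈ A, ∀ y' ∈ A, |⟪n, y - y'⟫| ≤ κ * ρ * dist y y' := fun y hy y' hy' =>
    Hflat y hy.1 y' hy'.1 hy.2 hy'.2
  have hxA : x ∈ A := ⟨hx, Metric.mem_closedBall_self hρ0.le⟩
  have hμfin : IsFiniteMeasure (surf.restrict A) := ⟨by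
    rw [Measure.restrict_apply_univ]; exact hball x ρ hρ0⟩
  have hAreal : surf.real A ≤ C₀ * ρ ^ 2 := hballr x ρ hρ0
  have hDfin : surf D ≤ surf A := surf_tangentProj_image_le hn x A
  have hνfin : IsFiniteMeasure (surf.restrict D) := ⟨by
    rw [Measure.restrict_apply_univ]; exact hDfin.trans_lt (hball x ρ hρ0)⟩
  rw [restr x t Q ρ hQ (by linarith)]
  set η := 2 * (κ * ρ) ^ 2 with hη
  have hQc := hQ.continuous
  have hint : ∀ f : E3 → E3, Continuous f → Integrable (fun y => Q (f y)) (surf.restrict A) :=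
    fun f hf => (integrable_const ((t ^ 2)⁻¹)).mono' (by fun_prop)
      (Eventually.of_forall fun y => hQ.bound _)
  -- flattening the argument of the kernel
  have step1 : |∫ y in A, Q (x - y) ∂surf - ∫ y in A, Q (-P y) ∂surf| ≤
      8 / t ^ 3 * (κ * ρ * ρ) * (C₀ * ρ ^ 2) := by
    rw [← integral_sub (hint _ (by fun_prop)) (hint _ (by fun_prop)),
      ← Real.norm_eq_abs]
    refine (norm_setIntegral_le_of_norm_le_const (C := 8 / t ^ 3 * (κ * ρ * ρ))
      (hball x ρ hρ0) ?_).trans (by gcongr)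
    intro y hy
    refine (hQ.lip _ _).trans ?_
    gcongr
    rw [dist_eq_norm, show x - y - -P y = -(⟪n, y - x⟫ • n) by simp only [P, tangentProj]; abel,
      norm_neg, norm_smul, hn, mul_one, Real.norm_eq_abs]
    refine (hflatA y hy x hxA).trans ?_
    gcongr
    exact hy.2
  -- comparing the projected measure with the area of the plane
  have hmap : ∫ y in A, Q (-P y) ∂surf = ∫ p, Q (-p) ∂((surf.restrict A).map P) :=
    (integral_map (f := fun p => Q (-p)) hPc.aemeasurable
      (by fun_prop : Continuous fun p => Q (-p)).aestronglyMeasurable).symm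
  -- The projected measure dominates planar area because projection contracts; `hge` shows that its
  -- total mass exceeds the planar one only slightly. Together they compare integrals without any
  -- Jacobian.
  have hle : surf.restrict D ≤ (surf.restrict A).map P := by
    rw [Measure.le_iff]
    intro B hB
    rw [Measure.map_apply hPc.measurable hB, Measure.restrict_apply hB,
      Measure.restrict_apply (hPc.measurable hB)]
    refine le_trans (measure_mono ?_) (surf_tangentProj_image_le hn x _)
    rintro _ ⟨hb, y, hy, rfl⟩
    exact ⟨y, ⟨hb, hy⟩, rfl⟩
  have hge : (surf.restrict A).map P univ ≤ ENNReal.ofReal (1 + η) * surf.restrict D univ := by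
    rw [Measure.map_apply hPc.measurable .univ, preimage_univ, Measure.restrict_apply_univ,
      Measure.restrict_apply_univ]
    exact surf_le_tangentProj_image hn x (by positivity) hκρ hflatA
  have step2 := abs_integral_sub_le_of_le_of_le (η := η) (B := (t ^ 2)⁻¹) (by positivity) hle hge
    (f := fun p => Q (-p)) (by fun_prop) (fun p => hQ.bound _)
  -- The shadow D need not be symmetric, but it contains the planar disc of radius 2t, outside of
  -- which Q vanishes; the radius ρ = 4t leaves room for this.
  have step3 : ∫ p in D, Q (-p) ∂surf = 0 := by
    rw [← hQ.setIntegral_plane_eq_zero n (2 * t)]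
    apply setIntegral_eq_of_subset_of_forall_sdiff_eq_zero hDcomp.measurableSet
    · rintro p ⟨hp1, hp2⟩
      rw [Metric.mem_closedBall, dist_zero_right] at hp2
      obtain ⟨τ, hτ, hmem⟩ := (Hn (2 * t) (by positivity)
        (by have := htR.trans (min_le_left _ _); linarith)).2 p hp1 hp2
      refine ⟨_, ⟨hmem, ?_⟩, ?_⟩
      · rw [Metric.mem_closedBall, dist_eq_norm, show x + p + τ • n - x = p + τ • n by abel]
        refine (norm_add_le _ _).trans ?_
        rw [norm_smul, hn, mul_one, Real.norm_eq_abs]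
        nlinarith
      · have hp : ⟪n, p⟫ = 0 := hp1
        simp only [P, tangentProj, show x + p + τ • n - x = p + τ • n by abel, inner_add_right,
          real_inner_smul_right, real_inner_self_eq_norm_sq, hn, hp]
        simp
    · rintro _ ⟨⟨y, hy, rfl⟩, hp⟩
      apply hQ.support
      rw [norm_neg]
      by_contra hlt
      exact hp ⟨tangentProj_mem_plane hn x y, by
        rw [Metric.mem_closedBall, dist_zero_right]; linarith⟩
  rw [← hmap, step3, sub_zero, Measure.restrict_apply_univ] at step2
  have hDreal : (surf D).toReal ≤ C₀ * ρ ^ 2 :=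
    (ENNReal.toReal_mono (hball x ρ hρ0).ne hDfin).trans hAreal
  have h1 : 8 / t ^ 3 * (κ * ρ * ρ) * (C₀ * ρ ^ 2) = 8 * κ * 16 * C₀ * 16 * t := by
    rw [hρ]; field_simp; ring
  have h2 : (t ^ 2)⁻¹ * (η * (surf D).toReal) ≤ C₀ * 16 * 32 * κ * (1 / 2) * 4 * t := by
    have hη' : η ≤ κ * ρ := by rw [hη]; nlinarith [mul_pos hκ hρ0]
    calc (t ^ 2)⁻¹ * (η * (surf D).toReal) ≤ (t ^ 2)⁻¹ * ((κ * ρ) * (C₀ * ρ ^ 2)) := by gcongr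
      _ = 64 * C₀ * κ * t := by rw [hρ]; field_simp; ring
      _ ≤ _ := by have : 0 < C₀ * κ * t := by positivity
                  nlinarith
  have h3 : 0 ≤ (16 * C₀ / R + 1) * t := by positivity
  have := abs_sub_abs_le_abs_sub (∫ y in A, Q (x - y) ∂surf) (∫ y in A, Q (-P y) ∂surf)
  rw [h1] at step1
  nlinarith

end BubbleScreen

/-! ### The Cotlar–Stein lemma -/

namespace BubbleScreen

section AlmostOrthogonality

variable {A ι : Type*} [NormedRing A]

/-- The product of the interaction bounds along consecutive letters of a word. -/
def chainWeight (c : ι → ι → ℝ) : List ι → ℝ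
  | [] => 1
  | [_] => 1
  | i :: j :: w => c i j * chainWeight c (j :: w)

/-- The bound for a word obtained by grouping its letters in pairs from the front. -/
def pairWeight (c : ι → ι → ℝ) (B : ℝ) : List ι → ℝ
  | [] => 1
  | [_] => B
  | i :: j :: w => c i j ^ 2 * pairWeight c B w

lemma pairWeight_nonneg (c : ι → ι → ℝ) {B : ℝ} (hB : 0 ≤ B) :
    ∀ w : List ι, 0 ≤ pairWeight c B w
  | [] => zero_le_one
  | [_] => hB
  | i :: j :: w => mul_nonneg (sq_nonneg _) (pairWeight_nonneg c hB w)

lemma chainWeight_nonneg {c : ι → ι → ℝ} (hc : ∀ i j, 0 ≤ c i j) :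
    ∀ w : List ι, 0 ≤ chainWeight c w
  | [] => zero_le_one
  | [_] => zero_le_one
  | i :: j :: w => mul_nonneg (hc _ _) (chainWeight_nonneg hc (j :: w))

/-- Pairing letters from the front of w and of `i :: w` gives the two possible pairings of the word.
Between them each consecutive pair occurs exactly once, and exactly one of the two pairings leaves a
single letter, worth B. -/
lemma pairWeight_mul_pairWeight (c : ι → ι → ℝ) (B : ℝ) :
    ∀ (i : ι) (w : List ι),
      pairWeight c B w * pairWeight c B (i :: w) = B * chainWeight c (i :: w) ^ 2
  | i, [] => by simp [pairWeight, chainWeight]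
  | i, j :: w => by
    have := pairWeight_mul_pairWeight c B j w
    simp only [pairWeight, chainWeight]
    linear_combination c i j ^ 2 * this

variable {T : ι → A} {c : ι → ι → ℝ} {B : ℝ}

lemma norm_prod_le_pairWeight [NormOneClass A] (hB : ∀ i, ‖T i‖ ≤ B)
    (h : ∀ i j, ‖T i * T j‖ ≤ c i j ^ 2) :
    ∀ w : List ι, ‖(w.map T).prod‖ ≤ pairWeight c B w
  | [] => by simp [pairWeight]
  | [i] => by simpa [pairWeight] using hB i
  | i :: j :: w => by
    have h1 := norm_prod_le_pairWeight hB h w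
    simp only [List.map_cons, List.prod_cons, pairWeight, ← mul_assoc]
    exact (norm_mul_le _ _).trans (mul_le_mul (h i j) h1 (norm_nonneg _) (sq_nonneg _))

/-- The geometric mean of the bounds from the two pairings. The squares in the bounds for products
of two letters turn into first powers along the whole chain. -/
lemma norm_prod_le_chainWeight [NormOneClass A] (hB0 : 0 ≤ B) (hB : ∀ i, ‖T i‖ ≤ B)
    (hc : ∀ i j, 0 ≤ c i j)
    (h : ∀ i j, ‖T i * T j‖ ≤ c i j ^ 2) (i : ι) (w : List ι) :
    ‖((i :: w).map T).prod‖ ≤ B * chainWeight c (i :: w) := by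
  apply le_of_sq_le_sq _ (mul_nonneg hB0 (chainWeight_nonneg hc _))
  have h1 := norm_prod_le_pairWeight hB h (i :: w)
  have h2 : ‖((i :: w).map T).prod‖ ≤ B * pairWeight c B w := by
    rw [List.map_cons, List.prod_cons]
    exact (norm_mul_le _ _).trans (mul_le_mul (hB i) (norm_prod_le_pairWeight hB h w)
      (norm_nonneg _) hB0)
  calc ‖((i :: w).map T).prod‖ ^ 2 ≤ (B * pairWeight c B w) * pairWeight c B (i :: w) := by
        rw [sq]
        exact mul_le_mul h2 h1 (norm_nonneg _) (mul_nonneg hB0 (pairWeight_nonneg c hB0 _))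
    _ = (B * chainWeight c (i :: w)) ^ 2 := by
        rw [mul_assoc, pairWeight_mul_pairWeight]; ring

variable [Fintype ι]

lemma sum_pow_eq_sum_words (n : ℕ) :
    (∑ i, T i) ^ n = ∑ f : Fin n → ι, ((List.ofFn f).map T).prod := by
  induction n with
  | zero => simp
  | succ n ih =>
    rw [pow_succ', ih, Finset.sum_mul_sum,
      ← (Fin.consEquiv fun _ : Fin (n + 1) => ι).sum_comp, Fintype.sum_prod_type]
    refine Finset.sum_congr rfl fun i _ => Finset.sum_congr rfl fun g _ => ?_
    simp [Fin.consEquiv, List.ofFn_succ]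

lemma sum_chainWeight_le {b : ℝ} (hc : ∀ i j, 0 ≤ c i j) (hb : ∀ i, ∑ j, c i j ≤ b) (n : ℕ)
    (i : ι) : ∑ f : Fin n → ι, chainWeight c (i :: List.ofFn f) ≤ b ^ n := by
  induction n generalizing i with
  | zero => simp [chainWeight]
  | succ n ih =>
    have hb0 : 0 ≤ b := (Finset.sum_nonneg fun j _ => hc i j).trans (hb i)
    rw [← (Fin.consEquiv fun _ : Fin (n + 1) => ι).sum_comp, Fintype.sum_prod_type]
    calc _ = ∑ j, c i j * ∑ g : Fin n → ι, chainWeight c (j :: List.ofFn g) := by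
          refine Finset.sum_congr rfl fun j _ => ?_
          rw [Finset.mul_sum]
          refine Finset.sum_congr rfl fun g _ => ?_
          simp [Fin.consEquiv, List.ofFn_succ, chainWeight]
      _ ≤ ∑ j, c i j * b ^ n := by
          gcongr with j _
          · exact hc i j
          · exact ih j
      _ ≤ _ := by
          rw [← Finset.sum_mul, pow_succ']
          gcongr
          exact hb i

/-- The Cotlar–Stein lemma for a finite family of skew-adjoint elements. -/
lemma norm_sum_le_of_almost_orthogonal [NormOneClass A] [StarRing A] [CStarRing A] {b : ℝ}
    (hb0 : 0 < b)
    (hT : ∀ i, star (T i) = -T i) (hc : ∀ i j, 0 ≤ c i j)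
    (h : ∀ i j, ‖T i * T j‖ ≤ c i j ^ 2) (hb : ∀ i, ∑ j, c i j ≤ b) :
    ‖∑ i, T i‖ ≤ b := by
  set S := ∑ i, T i
  -- A crude bound suffices: it enters only as a fixed prefactor, which is negligible for high
  -- powers.
  set B := ∑ i, ‖T i‖
  have hB0 : 0 ≤ B := Finset.sum_nonneg fun i _ => norm_nonneg _
  have hB : ∀ i, ‖T i‖ ≤ B := fun i =>
    Finset.single_le_sum (f := fun i => ‖T i‖) (fun i _ => norm_nonneg _) (Finset.mem_univ i)
  have hpow : ∀ n, ‖S ^ (n + 1)‖ ≤ (Fintype.card ι * B) * b ^ n := by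
    intro n
    rw [sum_pow_eq_sum_words, ← (Fin.consEquiv fun _ : Fin (n + 1) => ι).sum_comp,
      Fintype.sum_prod_type]
    calc _ ≤ ∑ i, ∑ g : Fin n → ι, B * chainWeight c (i :: List.ofFn g) := by
          refine (norm_sum_le _ _).trans (Finset.sum_le_sum fun i _ =>
            (norm_sum_le _ _).trans (Finset.sum_le_sum fun g _ => ?_))
          have := norm_prod_le_chainWeight hB0 hB hc h i (List.ofFn g)
          simpa [Fin.consEquiv, List.ofFn_succ] using this
      _ ≤ ∑ i : ι, B * b ^ n := by
          refine Finset.sum_le_sum fun i _ => ?_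
          rw [← Finset.mul_sum]
          gcongr
          exact sum_chainWeight_le hc hb n i
      _ = _ := by simp [mul_assoc]
  have hS : star S = -S := by simp [S, hT]
  have hS2 : ‖S ^ 2‖ = ‖S‖ ^ 2 := by
    have := CStarRing.norm_star_mul_self (x := S)
    rw [hS, neg_mul, norm_neg] at this
    rw [sq, sq, this]
  -- S is skew-adjoint, so its square is self-adjoint and the `C*`-identity gives equality in the
  -- norm of the powers of S with exponent 2 · 2^k. If ‖S‖ > b, these would outgrow `hpow`.
  have hsa : IsSelfAdjoint (S ^ 2) := by
    rw [IsSelfAdjoint, star_pow, hS]; simp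
  by_contra hlt
  push Not at hlt
  have hq : 1 < ‖S‖ / b := (one_lt_div hb0).2 hlt
  obtain ⟨k, hk⟩ := (tendsto_pow_atTop_atTop_of_one_lt hq).eventually_gt_atTop
    (Fintype.card ι * B / b) |>.exists_forall_of_atTop
  have h1 := hsa.norm_pow_two_pow k
  rw [hS2, ← pow_mul, ← pow_mul] at h1
  obtain ⟨m, hm⟩ : ∃ m, 2 * 2 ^ k = m + 1 := ⟨2 * 2 ^ k - 1, by have := Nat.one_le_two_pow (n := k); omega⟩
  rw [hm] at h1
  have h2 := hpow m
  rw [h1] at h2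
  have h3 := hk (m + 1) (by have := (Nat.lt_two_pow_self (n := k)); omega)
  rw [div_pow, div_lt_div_iff₀ hb0 (by positivity)] at h3
  have h4 := mul_le_mul_of_nonneg_right h2 hb0.le
  rw [mul_assoc, ← pow_succ] at h4
  linarith

end AlmostOrthogonality

/-- The exponent is the distance of j and k, written without truncated subtraction. It is injective
on each side of j, and each side is bounded by the full geometric series, with sum 4. -/
lemma sum_geometric_abs_sub_le (N : ℕ) (j : Fin N) :
    ∑ k : Fin N, (3 / 4 : ℝ) ^ (max (j : ℕ) k - min (j : ℕ) k) ≤ 8 := by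
  have geom : ∀ s : Finset ℕ, ∑ i ∈ s, (3 / 4 : ℝ) ^ i ≤ 4 := fun s => by
    have := Summable.sum_le_tsum (f := fun i : ℕ => (3 / 4 : ℝ) ^ i) s (fun i _ => by positivity)
      (summable_geometric_of_lt_one (by norm_num) (by norm_num))
    rw [tsum_geometric_of_lt_one (by norm_num) (by norm_num)] at this
    linarith
  have split : ∑ k : Fin N, (3 / 4 : ℝ) ^ (max (j : ℕ) k - min (j : ℕ) k) =
      ∑ k with k ≤ j, (3 / 4 : ℝ) ^ (max (j : ℕ) k - min (j : ℕ) k) +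
      ∑ k with ¬ k ≤ j, (3 / 4 : ℝ) ^ (max (j : ℕ) k - min (j : ℕ) k) :=
    (Finset.sum_filter_add_sum_filter_not _ _ _).symm
  rw [split]
  have h1 : ∀ s : Finset (Fin N), InjOn (fun k : Fin N => max (j : ℕ) k - min (j : ℕ) k) s →
      ∑ k ∈ s, (3 / 4 : ℝ) ^ (max (j : ℕ) k - min (j : ℕ) k) ≤ 4 := fun s hs => by
    rw [← Finset.sum_image (f := fun i => (3 / 4 : ℝ) ^ i) hs]
    exact geom _
  have h2 := h1 (Finset.univ.filter fun k => k ≤ j) (by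
    intro k hk l hl he
    simp only [Finset.coe_filter, Finset.mem_univ, true_and, mem_ofPred_eq, Fin.le_def] at hk hl he
    ext; omega)
  have h3 := h1 (Finset.univ.filter fun k => ¬ k ≤ j) (by
    intro k hk l hl he
    simp only [Finset.coe_filter, Finset.mem_univ, true_and, mem_ofPred_eq, Fin.le_def] at hk hl he
    ext; omega)
  linarith

end BubbleScreen

/-! ### Schur's test and integral operators on `L²` -/

namespace BubbleScreen

/-- The Cauchy–Schwarz inequality with a weight. -/
lemma sq_integral_mul_le {α : Type*} [MeasurableSpace α] {μ : Measure α} {w f : α → ℝ}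
    (hw0 : ∀ x, 0 ≤ w x) (hw : Integrable w μ) (hwf : Integrable (fun x => w x * f x) μ)
    (hwf2 : Integrable (fun x => w x * f x ^ 2) μ) :
    (∫ x, w x * f x ∂μ) ^ 2 ≤ (∫ x, w x ∂μ) * ∫ x, w x * f x ^ 2 ∂μ := by
  -- The weighted integral of (f - s)² is a nonnegative quadratic polynomial in s, so its
  -- discriminant is not positive.
  have key : ∀ s : ℝ, 0 ≤ (∫ x, w x ∂μ) * (s * s) + (-2 * ∫ x, w x * f x ∂μ) * s +
      ∫ x, w x * f x ^ 2 ∂μ := by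
    intro s
    have h0 : 0 ≤ ∫ x, w x * (f x - s) ^ 2 ∂μ :=
      integral_nonneg fun x => mul_nonneg (hw0 x) (sq_nonneg _)
    have h1 : ∫ x, w x * (f x - s) ^ 2 ∂μ =
        ∫ x, ((s * s) * w x + (-2 * s) * (w x * f x)) + w x * f x ^ 2 ∂μ := by
      congr 1; ext x; ring
    have e1 := integral_add ((hw.const_mul (s * s)).add (hwf.const_mul (-2 * s))) hwf2
    have e2 := integral_add (hw.const_mul (s * s)) (hwf.const_mul (-2 * s))
    simp only [Pi.add_apply] at e1
    rw [h1, e1, e2, integral_const_mul, integral_const_mul] at h0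
    linarith
  have := discrim_le_zero key
  rw [discrim] at this
  linarith

section Kernels

variable {α : Type*} [MeasurableSpace α] {σ : Measure α} [IsFiniteMeasure σ]
  {κ κ' : α → α → ℝ} {B R B' R' : ℝ}

/-- Bounded measurable kernels satisfying Schur's condition with constant `R`. -/
structure SchurKernel (σ : Measure α) (κ : α → α → ℝ) (B R : ℝ) : Prop where
  meas : Measurable (Function.uncurry κ)
  bound : ∀ x y, |κ x y| ≤ B
  row : ∀ᵐ x ∂σ, ∫ y, |κ x y| ∂σ ≤ R
  col : ∀ᵐ y ∂σ, ∫ x, |κ x y| ∂σ ≤ R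

/-- The integral operator with kernel `κ`. -/
noncomputable def kernelIntegral (σ : Measure α) (κ : α → α → ℝ) (f : α → ℝ) (x : α) : ℝ :=
  ∫ y, κ x y * f y ∂σ

namespace SchurKernel

lemma integrable_row (h : SchurKernel σ κ B R) {f : α → ℝ} (hf : Integrable f σ) (x : α) :
    Integrable (fun y => κ x y * f y) σ :=
  hf.bdd_mul (c := B) (h.meas.of_uncurry_left (x := x)).aestronglyMeasurable
    (Eventually.of_forall fun y => h.bound x y)

lemma integrable_prod (h : SchurKernel σ κ B R) {f : α → ℝ} (hf : Integrable f σ) :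
    Integrable (fun p : α × α => κ p.1 p.2 * f p.2) (σ.prod σ) :=
  (hf.comp_snd σ).bdd_mul (c := B) h.meas.aestronglyMeasurable
    (Eventually.of_forall fun p => h.bound p.1 p.2)

lemma abs (h : SchurKernel σ κ B R) : SchurKernel σ (fun x y => |κ x y|) B R where
  meas := continuous_abs.measurable.comp h.meas
  bound x y := by rw [abs_abs]; exact h.bound x y
  row := by simpa using h.row
  col := by simpa using h.col

lemma aestronglyMeasurable_kernelIntegral (h : SchurKernel σ κ B R) {f : α → ℝ}
    (hf : Integrable f σ) : AEStronglyMeasurable (kernelIntegral σ κ f) σ :=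
  (h.integrable_prod hf).aestronglyMeasurable.integral_prod_right'

lemma abs_kernelIntegral_le (h : SchurKernel σ κ B R) {f : α → ℝ} (hf : Integrable f σ) (x : α) :
    |kernelIntegral σ κ f x| ≤ B * ∫ y, |f y| ∂σ := by
  rw [kernelIntegral, ← integral_const_mul, ← Real.norm_eq_abs]
  refine norm_integral_le_of_norm_le (hf.abs.const_mul B) (Eventually.of_forall fun y => ?_)
  rw [Real.norm_eq_abs, abs_mul]
  exact mul_le_mul_of_nonneg_right (h.bound x y) (abs_nonneg _)

lemma memLp_kernelIntegral (h : SchurKernel σ κ B R) {f : α → ℝ} (hf : Integrable f σ) :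
    MemLp (kernelIntegral σ κ f) 2 σ :=
  MemLp.of_bound (h.aestronglyMeasurable_kernelIntegral hf) (B * ∫ y, |f y| ∂σ)
    (Eventually.of_forall fun x => h.abs_kernelIntegral_le hf x)

/-- Schur's test. -/
lemma integral_sq_le (h : SchurKernel σ κ B R) (hR : 0 ≤ R) {f : α → ℝ} (hf : MemLp f 2 σ) :
    ∫ x, kernelIntegral σ κ f x ^ 2 ∂σ ≤ R ^ 2 * ∫ y, f y ^ 2 ∂σ := by
  have hf1 : Integrable f σ := hf.integrable one_le_two
  have hf2 : Integrable (fun y => f y ^ 2) σ := hf.integrable_sq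
  have hprod := h.abs.integrable_prod hf2
  have step1 : ∀ᵐ x ∂σ, kernelIntegral σ κ f x ^ 2 ≤ R * ∫ y, |κ x y| * f y ^ 2 ∂σ := by
    filter_upwards [h.row] with x hx
    have hCS := sq_integral_mul_le (μ := σ) (w := fun y => |κ x y|) (f := fun y => |f y|)
      (fun y => abs_nonneg _) (by simpa using h.abs.integrable_row (integrable_const 1) x)
      (h.abs.integrable_row hf1.abs x)
      (by simpa using h.abs.integrable_row hf2 x)
    simp only [sq_abs] at hCS
    have hle : |kernelIntegral σ κ f x| ≤ ∫ y, |κ x y| * |f y| ∂σ := by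
      refine (abs_integral_le_integral_abs).trans_eq ?_
      simp_rw [abs_mul]
    calc kernelIntegral σ κ f x ^ 2 = |kernelIntegral σ κ f x| ^ 2 := (sq_abs _).symm
      _ ≤ (∫ y, |κ x y| * |f y| ∂σ) ^ 2 := by gcongr
      _ ≤ _ := hCS
      _ ≤ _ := by
        gcongr
  have hsq : Integrable (fun x => kernelIntegral σ κ f x ^ 2) σ :=
    (h.memLp_kernelIntegral hf1).integrable_sq
  calc ∫ x, kernelIntegral σ κ f x ^ 2 ∂σ ≤ ∫ x, R * ∫ y, |κ x y| * f y ^ 2 ∂σ ∂σ :=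
        integral_mono_ae hsq (hprod.integral_prod_left.const_mul R) step1
    _ = R * ∫ y, ∫ x, |κ x y| * f y ^ 2 ∂σ ∂σ := by
        rw [integral_const_mul, integral_integral_swap hprod]
    _ ≤ R * ∫ y, R * f y ^ 2 ∂σ := by
        apply mul_le_mul_of_nonneg_left _ hR
        refine integral_mono_ae hprod.integral_prod_right (hf2.const_mul R) ?_
        filter_upwards [h.col] with y hy
        rw [integral_mul_const]
        gcongr
    _ = _ := by rw [integral_const_mul]; ring

lemma integrable_coe (f : Lp ℝ 2 σ) : Integrable f σ := (Lp.memLp f).integrable one_le_two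

lemma norm_sq_eq (f : Lp ℝ 2 σ) : ‖f‖ ^ 2 = ∫ x, f x ^ 2 ∂σ := by
  rw [← real_inner_self_eq_norm_sq, L2.inner_def]
  congr 1; ext x; simp [sq]

/-- The bounded operator on `L²` given by a Schur kernel. -/
noncomputable def op (h : SchurKernel σ κ B R) (hR : 0 ≤ R) : Lp ℝ 2 σ →L[ℝ] Lp ℝ 2 σ :=
  LinearMap.mkContinuous
    { toFun := fun f => (h.memLp_kernelIntegral (integrable_coe f)).toLp _
      map_add' := fun f g => by
        rw [← MemLp.toLp_add]
        apply MemLp.toLp_congr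
        refine Eventually.of_forall fun x => ?_
        simp only [kernelIntegral, Pi.add_apply]
        rw [← integral_add (h.integrable_row (integrable_coe f) x)
          (h.integrable_row (integrable_coe g) x)]
        apply integral_congr_ae
        filter_upwards [Lp.coeFn_add f g] with y hy
        rw [hy, Pi.add_apply, mul_add]
      map_smul' := fun c f => by
        rw [RingHom.id_apply, ← MemLp.toLp_const_smul]
        apply MemLp.toLp_congr
        refine Eventually.of_forall fun x => ?_
        simp only [kernelIntegral, Pi.smul_apply, smul_eq_mul]
        rw [← integral_const_mul]
        apply integral_congr_ae
        filter_upwards [Lp.coeFn_smul c f] with y hy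
        rw [hy, Pi.smul_apply, smul_eq_mul]; ring }
    R (fun f => by
      apply le_of_sq_le_sq _ (by positivity)
      rw [mul_pow, norm_sq_eq, norm_sq_eq]
      refine le_trans (le_of_eq ?_) (h.integral_sq_le hR (Lp.memLp f))
      apply integral_congr_ae
      filter_upwards [(h.memLp_kernelIntegral (integrable_coe f)).coeFn_toLp] with x hx
      simp only [LinearMap.coe_mk, AddHom.coe_mk, hx])

lemma coeFn_op (h : SchurKernel σ κ B R) (hR : 0 ≤ R) (f : Lp ℝ 2 σ) :
    h.op hR f =ᵐ[σ] kernelIntegral σ κ f :=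
  (h.memLp_kernelIntegral (integrable_coe f)).coeFn_toLp

lemma norm_op_le (h : SchurKernel σ κ B R) (hR : 0 ≤ R) : ‖h.op hR‖ ≤ R :=
  LinearMap.mkContinuous_norm_le _ hR _

lemma star_op (h : SchurKernel σ κ B R) (hR : 0 ≤ R) (hskew : ∀ x y, κ y x = -κ x y) :
    star (h.op hR) = -h.op hR := by
  rw [ContinuousLinearMap.star_eq_adjoint, eq_comm, ContinuousLinearMap.eq_adjoint_iff]
  intro f g
  rw [L2.inner_def, L2.inner_def]
  have hL : ∫ x, inner ℝ ((-h.op hR) f x) (g x) ∂σ =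
      -∫ x, ∫ y, κ x y * (f y * g x) ∂σ ∂σ := by
    rw [← integral_neg]
    apply integral_congr_ae
    filter_upwards [h.coeFn_op hR f, Lp.coeFn_neg (h.op hR f)] with x hx hx'
    rw [neg_apply, hx', Pi.neg_apply, hx]
    simp only [kernelIntegral, RCLike.inner_apply, conj_trivial, ← mul_assoc]
    rw [integral_mul_const]; ring
  have hRt : ∫ x, inner ℝ (f x) (h.op hR g x) ∂σ = ∫ x, ∫ y, κ x y * (g y * f x) ∂σ ∂σ := by
    apply integral_congr_ae
    filter_upwards [h.coeFn_op hR g] with x hx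
    rw [hx]
    simp only [kernelIntegral, RCLike.inner_apply, conj_trivial, ← mul_assoc]
    rw [integral_mul_const]
  rw [hL, hRt, integral_integral_swap]
  · rw [← integral_neg]
    congr 1; ext x
    rw [← integral_neg]
    congr 1; ext y
    rw [hskew x y]; ring
  · have := ((integrable_coe g).mul_prod (integrable_coe f)).bdd_mul (c := B)
      h.meas.aestronglyMeasurable (Eventually.of_forall fun p => h.bound p.1 p.2)
    refine this.congr (Eventually.of_forall fun p => ?_)
    simp [Function.uncurry_def]; ring_nf; simp

/-- Fubini. The composed kernel carries its own Schur constant R'', which may be much smaller than R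
R'; this is how cancellation enters the operator norm. -/
lemma op_mul_op (h : SchurKernel σ κ B R) (hR : 0 ≤ R) (h' : SchurKernel σ κ' B' R') (hR' : 0 ≤ R')
    {B'' R'' : ℝ} (h'' : SchurKernel σ (fun x y => ∫ z, κ x z * κ' z y ∂σ) B'' R'')
    (hR'' : 0 ≤ R'') : h.op hR * h'.op hR' = h''.op hR'' := by
  ext f
  rw [mul_apply_eq_comp]
  filter_upwards [h.coeFn_op hR (h'.op hR' f), h''.coeFn_op hR'' f] with x hx hx'
  rw [hx, hx']
  have h1 : kernelIntegral σ κ (h'.op hR' f) x = ∫ z, ∫ y, κ x z * (κ' z y * f y) ∂σ ∂σ := by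
    rw [kernelIntegral]
    apply integral_congr_ae
    filter_upwards [h'.coeFn_op hR' f] with z hz
    rw [hz, kernelIntegral, integral_const_mul]
  have hmeas : Measurable fun z => κ x z := h.meas.of_uncurry_left (x := x)
  rw [h1, integral_integral_swap, kernelIntegral]
  · congr 1; ext y
    rw [← integral_mul_const]
    congr 1; ext z; ring
  · exact (h'.integrable_prod (integrable_coe f)).bdd_mul (c := B)
      (hmeas.comp measurable_fst).aestronglyMeasurable
      (Eventually.of_forall fun p => h.bound x p.1)

end SchurKernel

end Kernels

end BubbleScreen

/-! ### Almost orthogonality of odd bumps at dyadic scales -/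

namespace BubbleScreen

/-- At most quadratic growth of the measures of balls. -/
def QuadraticGrowth (σ : Measure E3) (C : ℝ) : Prop :=
  ∀ (x : E3) (r : ℝ), 0 < r → σ (Metric.closedBall x r) ≤ ENNReal.ofReal (C * r ^ 2)

lemma QuadraticGrowth.real_le {σ : Measure E3} {C : ℝ} (h : QuadraticGrowth σ C) (hC : 0 ≤ C)
    (x : E3) {r : ℝ} (hr : 0 < r) : σ.real (Metric.closedBall x r) ≤ C * r ^ 2 :=
  ENNReal.toReal_le_of_le_ofReal (by positivity) (h x r hr)

/-- Odd bumps nearly have mean value zero, almost everywhere. -/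
def OddCancellation (σ : Measure E3) (C : ℝ) : Prop :=
  ∀ᵐ x ∂σ, ∀ t, 0 < t → ∀ Q, IsOddBump t Q → |∫ y, Q (x - y) ∂σ| ≤ C * t

section Bumps

variable {σ : Measure E3} [IsFiniteMeasure σ] {C₀ C₁ t t' : ℝ} {Q Q' : E3 → ℝ}

/-- Integrating a function supported in a ball. -/
lemma integral_abs_le_of_support {f : E3 → ℝ} {x : E3} {r B : ℝ} (hσ : QuadraticGrowth σ C₀)
    (hC₀ : 0 ≤ C₀) (hr : 0 < r) (hB : 0 ≤ B) (hf : ∀ᵐ y ∂σ, |f y| ≤ B)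
    (hs : ∀ᵐ y ∂σ, r ≤ dist y x → f y = 0) : ∫ y, |f y| ∂σ ≤ B * (C₀ * r ^ 2) := by
  have hmb : MeasurableSet (Metric.closedBall x r) := Metric.isClosed_closedBall.measurableSet
  calc ∫ y, |f y| ∂σ ≤ ∫ y, (Metric.closedBall x r).indicator (fun _ => B) y ∂σ := by
        refine integral_mono_of_nonneg (Eventually.of_forall fun y => abs_nonneg _)
          ((integrable_const B).indicator hmb) ?_
        filter_upwards [hf, hs] with y h1 h2
        by_cases hy : y ∈ Metric.closedBall x r
        · rw [indicator_of_mem hy]; exact h1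
        · rw [indicator_of_notMem hy, h2 (by rw [Metric.mem_closedBall] at hy; linarith), abs_zero]
    _ = B * σ.real (Metric.closedBall x r) := by
        rw [integral_indicator hmb, setIntegral_const, smul_eq_mul, mul_comm]
    _ ≤ _ := by gcongr; exact hσ.real_le hC₀ x hr

lemma IsOddBump.schurKernel (hQ : IsOddBump t Q) (ht : 0 < t) (hσ : QuadraticGrowth σ C₀)
    (hC₀ : 0 ≤ C₀) : SchurKernel σ (fun x y => Q (x - y)) (t ^ 2)⁻¹ (4 * C₀) := by
  have hval : (t ^ 2)⁻¹ * (C₀ * (2 * t) ^ 2) = 4 * C₀ := by field_simp; ring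
  refine ⟨?_, fun x y => hQ.bound _, ?_, ?_⟩
  · have : Continuous (Function.uncurry fun x y => Q (x - y)) :=
      hQ.continuous.comp (continuous_fst.sub continuous_snd)
    exact this.measurable
  · refine Eventually.of_forall fun x => ?_
    rw [← hval]
    refine integral_abs_le_of_support (x := x) hσ hC₀ (by positivity) (by positivity)
      (Eventually.of_forall fun y => hQ.bound _) (Eventually.of_forall fun y hy => ?_)
    exact hQ.support _ (by rwa [← dist_eq_norm, dist_comm])
  · refine Eventually.of_forall fun y => ?_
    rw [← hval]
    refine integral_abs_le_of_support (x := y) hσ hC₀ (by positivity) (by positivity)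
      (Eventually.of_forall fun x => hQ.bound _) (Eventually.of_forall fun x hx => ?_)
    exact hQ.support _ (by rwa [← dist_eq_norm])

lemma IsOddBump.integrable (hQ : IsOddBump t Q) {f : E3 → E3} (hf : Continuous f) :
    Integrable (fun y => Q (f y)) σ :=
  (integrable_const ((t ^ 2)⁻¹)).mono' (hQ.continuous.comp hf).aestronglyMeasurable
    (Eventually.of_forall fun _ => hQ.bound _)

lemma IsOddBump.integrable_mul (hQ : IsOddBump t Q) (hQ' : IsOddBump t' Q') {f g : E3 → E3}
    (hf : Continuous f) (hg : Continuous g) : Integrable (fun y => Q (f y) * Q' (g y)) σ :=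
  (hQ'.integrable hg).bdd_mul (hQ.continuous.comp hf).aestronglyMeasurable
    (Eventually.of_forall fun _ => hQ.bound _)

/-- The coarse bump Q is nearly constant on the support of the fine bump Q', whose radius is 2t'.
Freezing Q at z = y costs its Lipschitz constant times 2t', and the frozen part contains the nearly
vanishing mean of Q'. Both terms gain the ratio t'/t of the scales, the second one because t ≤ 1. -/
lemma IsOddBump.abs_comp_le (hQ : IsOddBump t Q) (hQ' : IsOddBump t' Q') (ht' : 0 < t')
    (htt : t' ≤ t) (ht1 : t ≤ 1) (hσ : QuadraticGrowth σ C₀) (hC₀ : 0 ≤ C₀) (hC₁ : 0 ≤ C₁)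
    {y : E3} (hy : |∫ z, Q' (y - z) ∂σ| ≤ C₁ * t') (x : E3) :
    |∫ z, Q (x - z) * Q' (z - y) ∂σ| ≤ (64 * C₀ + C₁) * (t' / t) * (t ^ 2)⁻¹ := by
  have ht : 0 < t := ht'.trans_le htt
  have hodd : ∫ z, Q' (z - y) ∂σ = -∫ z, Q' (y - z) ∂σ := by
    rw [← integral_neg]
    congr 1; ext z
    rw [← hQ'.odd, neg_sub]
  have hsplit : ∫ z, Q (x - z) * Q' (z - y) ∂σ =
      ∫ z, (Q (x - z) - Q (x - y)) * Q' (z - y) ∂σ + Q (x - y) * ∫ z, Q' (z - y) ∂σ := by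
    rw [← integral_const_mul, ← integral_add]
    · congr 1; ext z; ring
    · have := (hQ.integrable_mul (σ := σ) hQ' (f := fun z => x - z) (g := fun z => z - y)
        (by fun_prop) (by fun_prop)).sub ((hQ'.integrable (f := fun z => z - y) (by fun_prop)).const_mul (Q (x - y)))
      refine this.congr (Eventually.of_forall fun z => ?_)
      simp only [Pi.sub_apply]; ring
    · exact (hQ'.integrable (by fun_prop)).const_mul _
  have h1 : |∫ z, (Q (x - z) - Q (x - y)) * Q' (z - y) ∂σ| ≤ 64 * C₀ * (t' / t) * (t ^ 2)⁻¹ := by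
    refine abs_integral_le_integral_abs.trans ?_
    have hval : (8 / t ^ 3 * (2 * t') * (t' ^ 2)⁻¹) * (C₀ * (2 * t') ^ 2) =
        64 * C₀ * (t' / t) * (t ^ 2)⁻¹ := by field_simp; ring
    rw [← hval]
    refine integral_abs_le_of_support (x := y) hσ hC₀ (by positivity) (by positivity)
      (Eventually.of_forall fun z => ?_) (Eventually.of_forall fun z hz => ?_)
    · by_cases hz : 2 * t' ≤ ‖z - y‖
      · rw [hQ'.support _ hz, mul_zero, abs_zero]; positivity
      · push Not at hz
        rw [abs_mul]
        refine mul_le_mul ((hQ.lip _ _).trans ?_) (hQ'.bound _) (abs_nonneg _) (by positivity)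
        gcongr
        rw [dist_sub_left, dist_eq_norm]
        exact hz.le
    · rw [hQ'.support _ (by rwa [← dist_eq_norm]), mul_zero]
  have h2 : |Q (x - y) * ∫ z, Q' (z - y) ∂σ| ≤ C₁ * (t' / t) * (t ^ 2)⁻¹ := by
    rw [hodd, mul_neg, abs_neg, abs_mul]
    calc _ ≤ (t ^ 2)⁻¹ * (C₁ * t') := mul_le_mul (hQ.bound _) hy (abs_nonneg _) (by positivity)
      _ ≤ (t ^ 2)⁻¹ * (C₁ * (t' / t)) := by
          gcongr
          exact le_div_self ht'.le ht ht1
      _ = _ := by ring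
  rw [hsplit]
  refine (abs_add_le _ _).trans ((add_le_add h1 h2).trans_eq ?_)
  ring

lemma IsOddBump.comp_eq_zero (hQ : IsOddBump t Q) (hQ' : IsOddBump t' Q') (htt : t' ≤ t)
    {x y : E3} (hxy : 4 * t ≤ dist x y) : ∫ z, Q (x - z) * Q' (z - y) ∂σ = 0 := by
  rw [← integral_zero E3 ℝ (μ := σ)]
  congr 1; ext z
  by_cases h1 : 2 * t ≤ ‖x - z‖
  · rw [hQ.support _ h1, zero_mul]
  · rw [hQ'.support, mul_zero]
    push Not at h1
    rw [← dist_eq_norm] at *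
    linarith [dist_triangle x z y]

/-- The composed kernel lives on distances below 4t, so its pointwise bound is multiplied by an area
of order t², which leaves the factor t'/t. The rows and columns hold only almost everywhere because
the cancellation is required of the fine bump at y. -/
lemma IsOddBump.schurKernel_comp (hQ : IsOddBump t Q) (hQ' : IsOddBump t' Q') (ht' : 0 < t')
    (htt : t' ≤ t) (ht1 : t ≤ 1) (hσ : QuadraticGrowth σ C₀) (hC₀ : 0 ≤ C₀) (hC₁ : 0 ≤ C₁)
    (hc : OddCancellation σ C₁) :
    SchurKernel σ (fun x y => ∫ z, Q (x - z) * Q' (z - y) ∂σ)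
      ((t ^ 2)⁻¹ * (t' ^ 2)⁻¹ * σ.real univ) (16 * C₀ * (64 * C₀ + C₁) * (t' / t)) := by
  have ht : 0 < t := ht'.trans_le htt
  have hval : ((64 * C₀ + C₁) * (t' / t) * (t ^ 2)⁻¹) * (C₀ * (4 * t) ^ 2) =
      16 * C₀ * (64 * C₀ + C₁) * (t' / t) := by field_simp; ring
  refine ⟨?_, fun x y => ?_, ?_, ?_⟩
  · have : Continuous (Function.uncurry fun (p : E3 × E3) (z : E3) =>
        Q (p.1 - z) * Q' (z - p.2)) := by
      have := hQ.continuous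
      have := hQ'.continuous
      simp only [Function.uncurry_def]
      fun_prop
    exact this.stronglyMeasurable.integral_prod_right.measurable
  · rw [← Real.norm_eq_abs]
    refine norm_integral_le_of_norm_le_const (Eventually.of_forall fun z => ?_)
    rw [Real.norm_eq_abs, abs_mul]
    exact mul_le_mul (hQ.bound _) (hQ'.bound _) (abs_nonneg _) (by positivity)
  · refine Eventually.of_forall fun x => ?_
    rw [← hval]
    refine integral_abs_le_of_support (x := x) hσ hC₀ (by positivity) (by positivity) ?_
      (Eventually.of_forall fun y hy => hQ.comp_eq_zero hQ' htt (by rwa [dist_comm]))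
    filter_upwards [hc] with y hy
    exact hQ.abs_comp_le hQ' ht' htt ht1 hσ hC₀ hC₁ (hy t' ht' Q' hQ') x
  · filter_upwards [hc] with y hy
    rw [← hval]
    exact integral_abs_le_of_support (x := y) hσ hC₀ (by positivity) (by positivity)
      (Eventually.of_forall fun x =>
        hQ.abs_comp_le hQ' ht' htt ht1 hσ hC₀ hC₁ (hy t' ht' Q' hQ') x)
      (Eventually.of_forall fun x hx => hQ.comp_eq_zero hQ' htt hx)

/-- Sums of odd bumps at dyadic scales give uniformly bounded operators on `L²`. -/
lemma exists_dyadic_sum_bound (hσ : QuadraticGrowth σ C₀) (hC₀ : 0 ≤ C₀) (hC₁ : 0 ≤ C₁)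
    (hc : OddCancellation σ C₁) :
    ∃ C : ℝ, 0 ≤ C ∧ ∀ (d : ℝ), 0 < d → ∀ (N : ℕ), (∀ k < N, 2 ^ k * d ≤ 1) →
      ∀ Q : ℕ → E3 → ℝ, (∀ k, IsOddBump (2 ^ k * d) (Q k)) →
      ∀ h : E3 → ℝ, MemLp h 2 σ →
        ∫ x, (∫ y, (∑ k ∈ Finset.range N, Q k (x - y)) * h y ∂σ) ^ 2 ∂σ ≤ C * ∫ y, h y ^ 2 ∂σ := by
  set D := 16 * C₀ * (64 * C₀ + C₁) + 1
  have hD : 1 ≤ D := by simp only [D]; linarith [show 0 ≤ 16 * C₀ * (64 * C₀ + C₁) by positivity]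
  refine ⟨(8 * √D) ^ 2, by positivity, fun d hd N hN Q hQ h hh => ?_⟩
  have hker : ∀ k : Fin N, SchurKernel σ (fun x y => Q k (x - y)) ((2 ^ (k : ℕ) * d) ^ 2)⁻¹ (4 * C₀) :=
    fun k => (hQ k).schurKernel (by positivity) hσ hC₀
  set T : Fin N → (Lp ℝ 2 σ →L[ℝ] Lp ℝ 2 σ) := fun k => (hker k).op (by positivity)
  have hstar : ∀ k, star (T k) = -T k := fun k =>
    (hker k).star_op _ fun x y => by rw [← (hQ k).odd, neg_sub]
  -- Almost orthogonality is needed in squared form; 3/4 is a rational number whose square exceeds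
  -- the actual ratio 1/2.
  have horth0 : ∀ j k : Fin N, (k : ℕ) ≤ j → ‖T j * T k‖ ≤ (√D * (3 / 4) ^ ((j : ℕ) - k)) ^ 2 := by
    intro j k hkj
    have hle : (2 : ℝ) ^ (k : ℕ) * d ≤ 2 ^ (j : ℕ) * d := by gcongr; norm_num
    have hcomp := (hQ j).schurKernel_comp (σ := σ) (hQ k) (by positivity) hle (hN j j.2) hσ hC₀ hC₁ hc
    have hnn : 0 ≤ 16 * C₀ * (64 * C₀ + C₁) * (2 ^ (k : ℕ) * d / (2 ^ (j : ℕ) * d)) := by positivity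
    simp only [T]
    rw [(hker j).op_mul_op _ (hker k) _ hcomp hnn]
    refine (hcomp.norm_op_le hnn).trans ?_
    rw [mul_pow, Real.sq_sqrt (by linarith), ← pow_mul, mul_comm ((j : ℕ) - k) 2, pow_mul]
    have e : (2 : ℝ) ^ (k : ℕ) * d / (2 ^ (j : ℕ) * d) = (1 / 2) ^ ((j : ℕ) - k) := by
      obtain ⟨m, hm⟩ := Nat.exists_eq_add_of_le hkj
      rw [hm, Nat.add_sub_cancel_left, pow_add]
      field_simp
      rw [← mul_pow]; norm_num
    rw [e]
    have h1 : (1 / 2 : ℝ) ^ ((j : ℕ) - k) ≤ ((3 / 4) ^ 2) ^ ((j : ℕ) - k) := by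
      gcongr; norm_num
    exact mul_le_mul (by simp only [D]; linarith) h1 (by positivity) (by linarith)
  have horth : ∀ j k : Fin N,
      ‖T j * T k‖ ≤ (√D * (3 / 4) ^ (max (j : ℕ) k - min (j : ℕ) k)) ^ 2 := by
    intro j k
    rcases le_total (k : ℕ) j with hkj | hjk
    · rw [max_eq_left hkj, min_eq_right hkj]; exact horth0 j k hkj
    · rw [max_eq_right hjk, min_eq_left hjk]
      -- The composition estimate has the coarse bump on the left; skew-adjointness gives the other
      -- order.
      have : star (T k * T j) = T j * T k := by rw [star_mul, hstar, hstar, neg_mul_neg]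
      rw [← this]
      exact (norm_star (T k * T j)).le.trans (horth0 k j hjk)
  have hsum : ∀ j : Fin N, ∑ k : Fin N, √D * (3 / 4 : ℝ) ^ (max (j : ℕ) k - min (j : ℕ) k) ≤ 8 * √D := by
    intro j
    rw [← Finset.mul_sum, mul_comm]
    gcongr
    exact sum_geometric_abs_sub_le N j
  have hnorm : ‖∑ k, T k‖ ≤ 8 * √D := by
    -- The identity operator has norm one only on a nontrivial space.
    rcases subsingleton_or_nontrivial (Lp ℝ 2 σ) with hs | hn
    · rw [Subsingleton.elim (∑ k, T k) 0, norm_zero]; positivity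
    · exact norm_sum_le_of_almost_orthogonal
        (by have := Real.sqrt_pos.2 (lt_of_lt_of_le one_pos hD); positivity)
        hstar (fun _ _ => by positivity) horth hsum
  have hh1 : Integrable h σ := hh.integrable one_le_two
  have happ : ∀ᵐ x ∂σ, (∑ k, T k) (hh.toLp h) x =
      ∫ y, (∑ k ∈ Finset.range N, Q k (x - y)) * h y ∂σ := by
    rw [sum_apply]
    have hk : ∀ k : Fin N, ∀ᵐ x ∂σ, T k (hh.toLp h) x = ∫ y, Q k (x - y) * h y ∂σ := by
      intro k
      filter_upwards [(hker k).coeFn_op (by positivity) (hh.toLp h)] with x hx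
      rw [hx, kernelIntegral]
      apply integral_congr_ae
      filter_upwards [hh.coeFn_toLp] with y hy
      rw [hy]
    have hcoe : ∀ᵐ x ∂σ, (∑ k, T k (hh.toLp h) : Lp ℝ 2 σ) x = ∑ k, T k (hh.toLp h) x := by
      have := Lp.coeFn_finsetSum Finset.univ (fun k => T k (hh.toLp h))
      filter_upwards [this] with x hx
      rw [hx, Finset.sum_apply]
    filter_upwards [hcoe, ae_all_iff.2 hk] with x hx hkx
    have hr : ∀ y, ∑ k ∈ Finset.range N, Q k (x - y) = ∑ k : Fin N, Q k (x - y) := fun y =>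
      Finset.sum_range _
    rw [hx]
    simp_rw [hr, Finset.sum_mul]
    rw [integral_finsetSum _ fun k _ => (hker k).integrable_row hh1 x]
    exact Finset.sum_congr rfl fun k _ => hkx k
  calc _ = ∫ x, ((∑ k, T k) (hh.toLp h) x) ^ 2 ∂σ := by
        apply integral_congr_ae
        filter_upwards [happ] with x hx
        rw [hx]
    _ = ‖(∑ k, T k) (hh.toLp h)‖ ^ 2 := (SchurKernel.norm_sq_eq _).symm
    _ ≤ (8 * √D * ‖hh.toLp h‖) ^ 2 := by
        gcongr
        exact ContinuousLinearMap.le_of_opNorm_le _ hnorm _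
    _ = (8 * √D) ^ 2 * ∫ y, h y ^ 2 ∂σ := by
        rw [mul_pow, SchurKernel.norm_sq_eq]
        congr 1
        apply integral_congr_ae
        filter_upwards [hh.coeFn_toLp] with y hy
        rw [hy]

end Bumps

end BubbleScreen

/-! ### Uniform `L²` bounds for regularised Riesz transforms -/

namespace BubbleScreen

section Growth

variable {σ : Measure E3} {C₀ : ℝ}

lemma tsum_ofReal_geometric_two {c : ℝ} (hc : 0 ≤ c) :
    ∑' n : ℕ, ENNReal.ofReal (c * (1 / 2) ^ n) = ENNReal.ofReal (2 * c) := by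
  rw [← ENNReal.ofReal_tsum_of_nonneg (fun n => by positivity)
    (summable_geometric_two.mul_left c), tsum_mul_left, tsum_geometric_two, mul_comm]

/-- Bounding an integral by a dyadic decomposition into balls. -/
lemma lintegral_le_of_dyadic (hσ : QuadraticGrowth σ C₀) {f : E3 → ℝ≥0∞} {x : E3}
    {c : ℝ} (hc : 0 ≤ c) {a r : ℕ → ℝ} (ha : ∀ n, 0 ≤ a n) (hr : ∀ n, 0 < r n)
    (hsum : ∀ n, a n * (C₀ * r n ^ 2) ≤ c * (1 / 2) ^ n)
    (hf : ∀ y, f y = 0 ∨ ∃ n, dist y x ≤ r n ∧ f y ≤ ENNReal.ofReal (a n)) :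
    ∫⁻ y, f y ∂σ ≤ ENNReal.ofReal (2 * c) := by
  have hmb : ∀ n, MeasurableSet (Metric.closedBall x (r n)) := fun n =>
    Metric.isClosed_closedBall.measurableSet
  calc ∫⁻ y, f y ∂σ
      ≤ ∫⁻ y, ∑' n, (Metric.closedBall x (r n)).indicator (fun _ => ENNReal.ofReal (a n)) y ∂σ := by
        refine lintegral_mono fun y => ?_
        rcases hf y with h0 | ⟨n, hn, hle⟩
        · rw [h0]; exact zero_le
        · refine le_trans ?_ (ENNReal.le_tsum n)
          rw [indicator_of_mem (Metric.mem_closedBall.2 hn)]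
          exact hle
    _ = ∑' n, ENNReal.ofReal (a n) * σ (Metric.closedBall x (r n)) := by
        rw [lintegral_tsum fun n => (measurable_const.indicator (hmb n)).aemeasurable]
        congr 1; ext n
        rw [lintegral_indicator (hmb n), setLIntegral_const]
    _ ≤ ∑' n, ENNReal.ofReal (c * (1 / 2) ^ n) := by
        refine ENNReal.tsum_le_tsum fun n => ?_
        calc _ ≤ ENNReal.ofReal (a n) * ENNReal.ofReal (C₀ * r n ^ 2) := by
              gcongr; exact hσ x (r n) (hr n)
          _ = ENNReal.ofReal (a n * (C₀ * r n ^ 2)) := (ENNReal.ofReal_mul (ha n)).symm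
          _ ≤ _ := ENNReal.ofReal_le_ofReal (hsum n)
    _ = _ := tsum_ofReal_geometric_two hc

/-- On the ball of radius R/2ⁿ the kernel is assigned the value 2ⁿ⁺¹/R, so the contributions are
2C₀R/2ⁿ. At y = x the inverse distance is 0 by convention. -/
lemma lintegral_inv_dist_le (hσ : QuadraticGrowth σ C₀) (hC₀ : 0 ≤ C₀) (x : E3) {R : ℝ}
    (hR : 0 < R) :
    ∫⁻ y in Metric.closedBall x R, ENNReal.ofReal (dist x y)⁻¹ ∂σ ≤ ENNReal.ofReal (4 * C₀ * R) := by
  rw [← lintegral_indicator Metric.isClosed_closedBall.measurableSet,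
    show 4 * C₀ * R = 2 * (2 * C₀ * R) by ring]
  refine lintegral_le_of_dyadic hσ (x := x) (by positivity) (a := fun n => 2 ^ (n + 1) / R)
    (r := fun n => R / 2 ^ n) (fun n => by positivity) (fun n => by positivity) (fun n => ?_)
    (fun y => ?_)
  · apply le_of_eq
    rw [div_pow, pow_succ, one_div, inv_pow]
    field_simp
  · by_cases hy : y ∈ Metric.closedBall x R
    swap
    · left; rw [indicator_of_notMem hy]
    rw [indicator_of_mem hy]
    rcases eq_or_ne y x with rfl | hne
    · left; simp
    right
    have hpos : 0 < dist y x := dist_pos.2 hne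
    obtain ⟨n, h1, h2⟩ := exists_nat_pow_near_of_lt_one (x := dist y x / R) (y := 1 / 2)
      (by positivity) (by rw [div_le_one hR]; exact hy) (by norm_num) (by norm_num)
    rw [one_div, inv_pow] at h1 h2
    rw [lt_div_iff₀ hR] at h1
    rw [div_le_iff₀ hR] at h2
    refine ⟨n, by rw [div_eq_inv_mul]; exact h2, ENNReal.ofReal_le_ofReal ?_⟩
    rw [dist_comm, ← inv_div]
    apply inv_anti₀ (by positivity)
    rw [div_eq_inv_mul]
    exact h1.le

/-- Cubic decay beats the quadratic growth of area: shells at distance about 2ⁿd contribute O(2⁻ⁿ),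
independently of d. -/
lemma lintegral_div_cube_le (hσ : QuadraticGrowth σ C₀) (hC₀ : 0 ≤ C₀) (x : E3) {d : ℝ}
    (hd : 0 < d) :
    ∫⁻ y, ENNReal.ofReal (d / (dist x y + d) ^ 3) ∂σ ≤ ENNReal.ofReal (8 * C₀) := by
  rw [show 8 * C₀ = 2 * (4 * C₀) by ring]
  refine lintegral_le_of_dyadic hσ (x := x) (by positivity) (a := fun n => d / (2 ^ n * d) ^ 3)
    (r := fun n => 2 ^ (n + 1) * d) (fun n => by positivity) (fun n => by positivity) (fun n => ?_)
    (fun y => Or.inr ?_)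
  · apply le_of_eq
    rw [pow_succ, one_div, inv_pow]
    field_simp
    ring
  · obtain ⟨n, h1, h2⟩ := exists_nat_pow_near (x := (dist y x + d) / d) (y := 2)
      (by rw [le_div_iff₀ hd]; linarith [dist_nonneg (x := y) (y := x)]) (by norm_num)
    rw [le_div_iff₀ hd] at h1
    rw [div_lt_iff₀ hd] at h2
    refine ⟨n, by linarith, ENNReal.ofReal_le_ofReal ?_⟩
    rw [dist_comm]
    gcongr

lemma integral_div_cube_le (hσ : QuadraticGrowth σ C₀) (hC₀ : 0 ≤ C₀) (x : E3) {d : ℝ}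
    (hd : 0 < d) : ∫ y, d / (dist x y + d) ^ 3 ∂σ ≤ 8 * C₀ := by
  rw [integral_eq_lintegral_of_nonneg_ae (Eventually.of_forall fun y => by positivity)]
  · exact ENNReal.toReal_le_of_le_ofReal (by positivity) (lintegral_div_cube_le hσ hC₀ x hd)
  · have : Continuous fun y => d / (dist x y + d) ^ 3 :=
      continuous_const.div (by fun_prop) fun y => by positivity
    exact this.aestronglyMeasurable

lemma integrableOn_inv_dist (hσ : QuadraticGrowth σ C₀) (hC₀ : 0 ≤ C₀) (x : E3) {R : ℝ}
    (hR : 0 < R) : IntegrableOn (fun y => (dist x y)⁻¹) (Metric.closedBall x R) σ := by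
  refine ⟨(by fun_prop : Measurable fun y => (dist x y)⁻¹).aestronglyMeasurable, ?_⟩
  rw [hasFiniteIntegral_iff_ofReal (Eventually.of_forall fun y => by positivity)]
  exact (lintegral_inv_dist_le hσ hC₀ x hR).trans_lt ENNReal.ofReal_lt_top

lemma setIntegral_inv_dist_le (hσ : QuadraticGrowth σ C₀) (hC₀ : 0 ≤ C₀) (x : E3) {R : ℝ}
    (hR : 0 < R) : ∫ y in Metric.closedBall x R, (dist x y)⁻¹ ∂σ ≤ 4 * C₀ * R := by
  rw [integral_eq_lintegral_of_nonneg_ae (Eventually.of_forall fun y => by positivity)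
    (by fun_prop : Measurable fun y => (dist x y)⁻¹).aestronglyMeasurable]
  exact ENNReal.toReal_le_of_le_ofReal (by positivity) (lintegral_inv_dist_le hσ hC₀ x hR)

end Growth

/-- A coordinate of the Riesz kernel, truncated at distance `t`. -/
noncomputable def truncRiesz (t : ℝ) (c : Fin 3) (v : E3) : ℝ := v c / max ‖v‖ t ^ 3

/-- A coordinate of the smoothly regularised Riesz kernel. -/
noncomputable def regRiesz (d : ℝ) (c : Fin 3) (v : E3) : ℝ := v c / √(‖v‖ ^ 2 + d ^ 2) ^ 3

lemma abs_coord_le (v : E3) (c : Fin 3) : |v c| ≤ ‖v‖ := by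
  rw [← Real.norm_eq_abs]; exact PiLp.norm_apply_le v c

lemma continuous_truncRiesz {t : ℝ} (ht : 0 < t) (c : Fin 3) : Continuous (truncRiesz t c) :=
  Continuous.div (by fun_prop) (by fun_prop) fun v =>
    (pow_pos (lt_max_of_lt_right ht) 3).ne'

lemma continuous_regRiesz {d : ℝ} (hd : 0 < d) (c : Fin 3) : Continuous (regRiesz d c) :=
  Continuous.div (by fun_prop) (by fun_prop) fun v => by positivity

lemma abs_truncRiesz_le {t : ℝ} (ht : 0 < t) (c : Fin 3) (v : E3) :
    |truncRiesz t c v| ≤ (t ^ 2)⁻¹ := by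
  have hm : 0 < max ‖v‖ t := lt_max_of_lt_right ht
  rw [truncRiesz, abs_div, abs_of_pos (pow_pos hm 3)]
  calc |v c| / max ‖v‖ t ^ 3 ≤ max ‖v‖ t / max ‖v‖ t ^ 3 := by
        gcongr; exact (abs_coord_le v c).trans (le_max_left _ _)
    _ = (max ‖v‖ t ^ 2)⁻¹ := by field_simp
    _ ≤ _ := by gcongr; exact le_max_right _ _

/-- One unit of the constant comes from the numerator and three from the cubed denominator; the
truncated norm is 1-Lipschitz and at least t. -/
lemma abs_truncRiesz_sub_le {t : ℝ} (ht : 0 < t) (c : Fin 3) (v w : E3) :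
    |truncRiesz t c v - truncRiesz t c w| ≤ 4 / t ^ 3 * dist v w := by
  wlog hvw : ‖w‖ ≤ ‖v‖ generalizing v w
  · rw [abs_sub_comm, dist_comm]; exact this w v (le_of_not_ge hvw)
  set p := max ‖v‖ t
  set q := max ‖w‖ t
  have hq : 0 < q := lt_max_of_lt_right ht
  have hqp : q ≤ p := max_le_max_right t hvw
  have hp : 0 < p := hq.trans_le hqp
  have htq : t ≤ q := le_max_right _ _
  have hpq : p - q ≤ dist v w := by
    have h1 : |p - q| ≤ |‖v‖ - ‖w‖| := by
      simpa using abs_max_sub_max_le_max ‖v‖ t ‖w‖ t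
    rw [dist_eq_norm]
    exact (le_abs_self _).trans (h1.trans (abs_norm_sub_norm_le v w))
  have hcoord : |v c - w c| ≤ dist v w := by
    rw [dist_eq_norm]; simpa using abs_coord_le (v - w) c
  have hvc : |v c| ≤ p := (abs_coord_le v c).trans (le_max_left _ _)
  have e : truncRiesz t c v - truncRiesz t c w =
      (v c - w c) / q ^ 3 - v c * ((p - q) * (p ^ 2 + p * q + q ^ 2)) / (p ^ 3 * q ^ 3) := by
    simp only [truncRiesz]
    field_simp
    ring
  have h1 : |(v c - w c) / q ^ 3| ≤ 1 / t ^ 3 * dist v w := by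
    rw [abs_div, abs_of_pos (pow_pos hq 3), one_div_mul_eq_div]
    gcongr
  have h2 : |v c * ((p - q) * (p ^ 2 + p * q + q ^ 2)) / (p ^ 3 * q ^ 3)| ≤
      3 / t ^ 3 * dist v w := by
    have hpq0 : 0 ≤ p - q := by linarith
    rw [abs_div, abs_mul, abs_of_nonneg (by positivity : 0 ≤ (p - q) * (p ^ 2 + p * q + q ^ 2)),
      abs_of_pos (by positivity : 0 < p ^ 3 * q ^ 3)]
    calc |v c| * ((p - q) * (p ^ 2 + p * q + q ^ 2)) / (p ^ 3 * q ^ 3)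
        ≤ p * (dist v w * (p ^ 2 + p * p + p ^ 2)) / (p ^ 3 * q ^ 3) := by gcongr
      _ = 3 / q ^ 3 * dist v w := by field_simp; ring
      _ ≤ _ := by gcongr
  rw [e]
  refine (abs_sub _ _).trans ((add_le_add h1 h2).trans_eq ?_)
  ring

/-- Beyond 2t neither truncation acts, so the difference is compactly supported. These differences
telescope over dyadic t, which writes the kernel as a sum of odd bumps. -/
lemma isOddBump_truncRiesz_sub {t : ℝ} (ht : 0 < t) (c : Fin 3) :
    IsOddBump t (fun v => truncRiesz t c v - truncRiesz (2 * t) c v) where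
  odd v := by simp [truncRiesz]; ring
  bound v := by
    have hm : 0 < max ‖v‖ t := lt_max_of_lt_right ht
    have hm2 : 0 < max ‖v‖ (2 * t) := lt_max_of_lt_right (by linarith)
    have hle : max ‖v‖ t ≤ max ‖v‖ (2 * t) := max_le_max_left _ (by linarith)
    refine le_trans ?_ (abs_truncRiesz_le ht c v)
    simp only [truncRiesz]
    rw [div_sub_div _ _ (by positivity) (by positivity), mul_comm (max ‖v‖ t ^ 3) (v c),
      ← mul_sub, abs_div, abs_div, abs_mul, abs_of_pos (pow_pos hm 3),
      abs_of_pos (mul_pos (pow_pos hm 3) (pow_pos hm2 3)),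
      abs_of_nonneg (sub_nonneg.2 (pow_le_pow_left₀ hm.le hle 3)),
      div_le_div_iff₀ (mul_pos (pow_pos hm 3) (pow_pos hm2 3)) (pow_pos hm 3)]
    have := abs_nonneg (v c)
    have h3 : 0 < max ‖v‖ t ^ 3 := pow_pos hm 3
    nlinarith [mul_nonneg this h3.le, mul_nonneg (mul_nonneg this h3.le) h3.le]
  lip v w := by
    have h1 := abs_truncRiesz_sub_le ht c v w
    have h2 := abs_truncRiesz_sub_le (t := 2 * t) (by linarith) c v w
    have h3 : 4 / (2 * t) ^ 3 * dist v w ≤ 4 / t ^ 3 * dist v w := by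
      gcongr; linarith
    rw [show truncRiesz t c v - truncRiesz (2 * t) c v - (truncRiesz t c w - truncRiesz (2 * t) c w)
      = (truncRiesz t c v - truncRiesz t c w) - (truncRiesz (2 * t) c v - truncRiesz (2 * t) c w)
      by ring]
    refine (abs_sub _ _).trans ((add_le_add h1 (h2.trans h3)).trans_eq ?_)
    ring
  support v hv := by
    simp only [truncRiesz]
    rw [max_eq_left hv, max_eq_left (by linarith), sub_self]

/-- The two regularised norms differ by at most d, and the Riesz kernel loses one power of distance.
The resulting cubic bound has row sums bounded uniformly in d, so Schur's test disposes of the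
change from the sharp to the smooth regularisation. -/
lemma abs_regRiesz_sub_truncRiesz_le {d : ℝ} (hd : 0 < d) (c : Fin 3) (v : E3) :
    |regRiesz d c v - truncRiesz d c v| ≤ 24 * (d / (‖v‖ + d) ^ 3) := by
  set m := max ‖v‖ d
  set s := √(‖v‖ ^ 2 + d ^ 2)
  have hm : 0 < m := lt_max_of_lt_right hd
  have hvm : ‖v‖ ≤ m := le_max_left _ _
  have hdm : d ≤ m := le_max_right _ _
  have hs2 : s ^ 2 = ‖v‖ ^ 2 + d ^ 2 := Real.sq_sqrt (by positivity)
  have hs : 0 < s := Real.sqrt_pos.2 (by positivity)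
  have hn := norm_nonneg v
  have hms : m ≤ s := max_le (le_of_sq_le_sq (by nlinarith) hs.le)
    (le_of_sq_le_sq (by nlinarith) hs.le)
  have hsm : s - m ≤ d := by
    have : s ≤ m + d := le_of_sq_le_sq (by nlinarith) (by positivity)
    linarith
  have e : regRiesz d c v - truncRiesz d c v =
      -(v c * ((s - m) * (s ^ 2 + s * m + m ^ 2)) / (s ^ 3 * m ^ 3)) := by
    simp only [regRiesz, truncRiesz]
    field_simp
    ring
  have hsm0 : 0 ≤ s - m := by linarith
  rw [e, abs_neg, abs_div, abs_mul,
    abs_of_nonneg (by positivity : 0 ≤ (s - m) * (s ^ 2 + s * m + m ^ 2)),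
    abs_of_pos (by positivity : 0 < s ^ 3 * m ^ 3)]
  calc |v c| * ((s - m) * (s ^ 2 + s * m + m ^ 2)) / (s ^ 3 * m ^ 3)
      ≤ s * (d * (s ^ 2 + s * s + s ^ 2)) / (s ^ 3 * m ^ 3) := by
        gcongr
        exact (abs_coord_le v c).trans (hvm.trans hms)
    _ = 24 * (d / (2 * m) ^ 3) := by field_simp; ring
    _ ≤ _ := by gcongr; linarith

lemma add_sq_le_three (a b c : ℝ) : (a + b + c) ^ 2 ≤ 3 * (a ^ 2 + b ^ 2 + c ^ 2) := by
  nlinarith [sq_nonneg (a - b), sq_nonneg (b - c), sq_nonneg (a - c)]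

/-- The regularised Riesz transforms are bounded on `L²`, uniformly in the regularisation. -/
lemma exists_regRiesz_bound {σ : Measure E3} [IsFiniteMeasure σ] {C₀ C₁ : ℝ}
    (hσ : QuadraticGrowth σ C₀) (hC₀ : 0 ≤ C₀) (hC₁ : 0 ≤ C₁)
    (hc : OddCancellation σ C₁) :
    ∃ C : ℝ, 0 ≤ C ∧ ∀ (d : ℝ), 0 < d → d ≤ 1 → ∀ (c : Fin 3) (h : E3 → ℝ), MemLp h 2 σ →
      ∫ x, (∫ y, regRiesz d c (x - y) * h y ∂σ) ^ 2 ∂σ ≤ C * ∫ y, h y ^ 2 ∂σ := by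
  obtain ⟨C, hC, H⟩ := exists_dyadic_sum_bound hσ hC₀ hC₁ hc
  refine ⟨3 * ((24 * (8 * C₀)) ^ 2 + C + (σ.real univ) ^ 2), by positivity,
    fun d hd hd1 c h hh => ?_⟩
  -- The largest dyadic scale 2ⁿd not exceeding 1: all bumps used satisfy t ≤ 1, while the last
  -- truncation, at scale 2ⁿ⁺¹d > 1, is bounded by 1.
  obtain ⟨n, hn1, hn2⟩ := exists_nat_pow_near (x := 1 / d) (y := 2)
    (by rw [le_div_iff₀ hd]; linarith) (by norm_num)
  rw [le_div_iff₀ hd] at hn1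
  rw [div_lt_iff₀ hd] at hn2
  set N := n + 1
  set Q : ℕ → E3 → ℝ := fun k v => truncRiesz (2 ^ k * d) c v - truncRiesz (2 ^ (k + 1) * d) c v
  have hQ : ∀ k, IsOddBump (2 ^ k * d) (Q k) := fun k => by
    have := isOddBump_truncRiesz_sub (t := 2 ^ k * d) (by positivity) c
    simp only [Q]
    rwa [show (2 : ℝ) ^ (k + 1) * d = 2 * (2 ^ k * d) by ring]
  have hsum := H d hd N (fun k hk => by
    refine le_trans ?_ hn1
    gcongr
    · norm_num
    · omega) Q hQ h hh
  have htel : ∀ v, ∑ k ∈ Finset.range N, Q k v = truncRiesz d c v - truncRiesz (2 ^ N * d) c v := by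
    intro v
    simp only [Q]
    rw [Finset.sum_range_sub' (fun k => truncRiesz (2 ^ k * d) c v)]
    simp
  simp_rw [htel] at hsum
  have hN0 : 0 < 2 ^ N * d := by positivity
  have hnear : SchurKernel σ (fun x y => regRiesz d c (x - y) - truncRiesz d c (x - y))
      (24 * (d / d ^ 3)) (24 * (8 * C₀)) := by
    have hrow : ∀ x : E3, ∫ y, |regRiesz d c (x - y) - truncRiesz d c (x - y)| ∂σ ≤
        24 * (8 * C₀) := by
      intro x
      have hint : Integrable (fun y => d / (dist x y + d) ^ 3) σ := by
        refine (integrable_const (d / d ^ 3)).mono' ?_ (Eventually.of_forall fun y => ?_)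
        · have : Continuous fun y => d / (dist x y + d) ^ 3 :=
            continuous_const.div (by fun_prop) fun y => by positivity
          exact this.aestronglyMeasurable
        · rw [Real.norm_eq_abs, abs_of_nonneg (by positivity)]
          gcongr
          linarith [dist_nonneg (x := x) (y := y)]
      calc _ ≤ ∫ y, 24 * (d / (dist x y + d) ^ 3) ∂σ := by
            refine integral_mono_of_nonneg (Eventually.of_forall fun y => abs_nonneg _)
              (hint.const_mul _) (Eventually.of_forall fun y => ?_)
            simp only [dist_eq_norm]
            exact abs_regRiesz_sub_truncRiesz_le hd c (x - y)
        _ ≤ _ := by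
            rw [integral_const_mul]
            gcongr
            exact integral_div_cube_le hσ hC₀ x hd
    refine ⟨?_, fun x y => ?_, Eventually.of_forall hrow, Eventually.of_forall fun y => ?_⟩
    · have := continuous_regRiesz hd c
      have := continuous_truncRiesz hd c
      have : Continuous (Function.uncurry fun x y : E3 =>
          regRiesz d c (x - y) - truncRiesz d c (x - y)) := by
        simp only [Function.uncurry_def]; fun_prop
      exact this.measurable
    · refine (abs_regRiesz_sub_truncRiesz_le hd c (x - y)).trans ?_
      gcongr
      linarith [norm_nonneg (x - y)]
    · refine le_trans (le_of_eq ?_) (hrow y)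
      congr 1; ext x
      rw [show y - x = -(x - y) by abel]
      simp only [regRiesz, truncRiesz, norm_neg, PiLp.neg_apply, neg_div]
      rw [abs_sub_comm, sub_neg_eq_add, neg_add_eq_sub]
  have hfar : SchurKernel σ (fun x y => truncRiesz (2 ^ N * d) c (x - y)) 1 (σ.real univ) := by
    have hb : ∀ v, |truncRiesz (2 ^ N * d) c v| ≤ 1 := fun v =>
      (abs_truncRiesz_le hN0 c v).trans (inv_le_one_of_one_le₀ (by nlinarith))
    have hI : ∀ f : E3 → E3, ∫ y, |truncRiesz (2 ^ N * d) c (f y)| ∂σ ≤ σ.real univ := by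
      intro f
      have := integral_mono_of_nonneg (μ := σ)
        (Eventually.of_forall fun y => abs_nonneg (truncRiesz (2 ^ N * d) c (f y)))
        (integrable_const (1 : ℝ)) (Eventually.of_forall fun y => hb (f y))
      simpa using this
    refine ⟨?_, fun x y => hb _, Eventually.of_forall fun x => hI _,
      Eventually.of_forall fun y => hI _⟩
    have : Continuous (Function.uncurry fun x y : E3 => truncRiesz (2 ^ N * d) c (x - y)) :=
      (continuous_truncRiesz hN0 c).comp (continuous_fst.sub continuous_snd)
    exact this.measurable
  -- The constants here blow up with d and serve only for integrability; the quantitative bound for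
  -- the middle part is `hsum`.
  have hmid : SchurKernel σ (fun x y => truncRiesz d c (x - y) -
      truncRiesz (2 ^ N * d) c (x - y)) ((d ^ 2)⁻¹ + 1) (((d ^ 2)⁻¹ + 1) * σ.real univ) := by
    have hb : ∀ v, |truncRiesz d c v - truncRiesz (2 ^ N * d) c v| ≤ (d ^ 2)⁻¹ + 1 := fun v =>
      (abs_sub _ _).trans (add_le_add (abs_truncRiesz_le hd c v)
        ((abs_truncRiesz_le hN0 c v).trans (inv_le_one_of_one_le₀ (by nlinarith))))
    have hI : ∀ f : E3 → E3, ∫ y, |truncRiesz d c (f y) - truncRiesz (2 ^ N * d) c (f y)| ∂σ ≤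
        ((d ^ 2)⁻¹ + 1) * σ.real univ := by
      intro f
      have := integral_mono_of_nonneg (μ := σ)
        (Eventually.of_forall fun y => abs_nonneg (truncRiesz d c (f y) - truncRiesz (2 ^ N * d) c (f y)))
        (integrable_const ((d ^ 2)⁻¹ + 1)) (Eventually.of_forall fun y => hb (f y))
      simpa [mul_comm] using this
    refine ⟨?_, fun x y => hb _, Eventually.of_forall fun x => hI _,
      Eventually.of_forall fun y => hI _⟩
    have := continuous_truncRiesz hd c
    have := continuous_truncRiesz hN0 c
    have : Continuous (Function.uncurry fun x y : E3 => truncRiesz d c (x - y) -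
      truncRiesz (2 ^ N * d) c (x - y)) := by simp only [Function.uncurry_def]; fun_prop
    exact this.measurable
  have hh1 : Integrable h σ := hh.integrable one_le_two
  have hsplit : ∀ x, ∫ y, regRiesz d c (x - y) * h y ∂σ =
      kernelIntegral σ (fun x y => regRiesz d c (x - y) - truncRiesz d c (x - y)) h x +
      kernelIntegral σ (fun x y => truncRiesz d c (x - y) - truncRiesz (2 ^ N * d) c (x - y)) h x +
      kernelIntegral σ (fun x y => truncRiesz (2 ^ N * d) c (x - y)) h x := by
    intro x
    simp only [kernelIntegral]
    have e := integral_add ((hnear.integrable_row hh1 x).add (hmid.integrable_row hh1 x))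
      (hfar.integrable_row hh1 x)
    simp only [Pi.add_apply] at e
    rw [← integral_add (hnear.integrable_row hh1 x) (hmid.integrable_row hh1 x), ← e]
    congr 1; ext y; ring
  have i1 := (hnear.memLp_kernelIntegral hh1).integrable_sq
  have i2 := (hmid.memLp_kernelIntegral hh1).integrable_sq
  have i3 := (hfar.memLp_kernelIntegral hh1).integrable_sq
  have b1 := hnear.integral_sq_le (by positivity) hh
  have b3 := hfar.integral_sq_le measureReal_nonneg hh
  simp_rw [hsplit]
  refine (integral_mono_of_nonneg (Eventually.of_forall fun x => sq_nonneg _)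
    (((i1.add i2).add i3).const_mul 3) (Eventually.of_forall fun x => ?_)).trans ?_
  · simp only [Pi.add_apply]
    exact add_sq_le_three _ _ _
  · have e1 := integral_add (i1.add i2) i3
    have e2 := integral_add i1 i2
    simp only [Pi.add_apply] at e1 e2 ⊢
    rw [integral_const_mul, e1, e2]
    simp only [kernelIntegral] at b1 b3 ⊢
    linarith

end BubbleScreen

/-! ### Clouds of cells and summable weights -/

namespace BubbleScreen

/-- Schur's test for finite matrices. -/
lemma sum_sq_sum_mul_le {Q : Type*} [Fintype Q] {W : Q → Q → ℝ} {R : ℝ}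
    (hW : ∀ p q, 0 ≤ W p q) (hR : 0 ≤ R) (hrow : ∀ p, ∑ q, W p q ≤ R) (hcol : ∀ q, ∑ p, W p q ≤ R)
    (A : Q → ℝ) : ∑ p, (∑ q, W p q * A q) ^ 2 ≤ R ^ 2 * ∑ q, A q ^ 2 := by
  calc ∑ p, (∑ q, W p q * A q) ^ 2 ≤ ∑ p, R * ∑ q, W p q * A q ^ 2 := by
        refine Finset.sum_le_sum fun p _ => ?_
        refine (Finset.sum_sq_le_sum_mul_sum_of_sq_le_mul Finset.univ (fun q _ => hW p q)
          (fun q _ => mul_nonneg (hW p q) (sq_nonneg (A q))) (fun q _ => (by ring : (W p q * A q) ^ 2 = W p q * (W p q * A q ^ 2)).le)).trans ?_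
        gcongr
        · exact Finset.sum_nonneg fun q _ => mul_nonneg (hW p q) (sq_nonneg (A q))
        · exact hrow p
    _ = R * ∑ q, (∑ p, W p q) * A q ^ 2 := by
        rw [← Finset.mul_sum, Finset.sum_comm]
        simp_rw [Finset.sum_mul]
    _ ≤ R * ∑ q, R * A q ^ 2 := by
        gcongr with q _
        exact hcol q
    _ = _ := by rw [← Finset.mul_sum]; ring

/-- A finite family of cells of diameter at most `b * d` and measure `d ^ 2`, overlapping at most
`n₀` times, with marked points; cells of different blocks have marked points at distance at least
`a * d`. -/
structure Cloud (μ : Measure E3) (a b D : ℝ) (n₀ : ℕ) (Q : Type) [Fintype Q] where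
  d : ℝ
  d_pos : 0 < d
  d_le_one : d ≤ 1
  cell : Q → Set E3
  measurable_cell : ∀ q, MeasurableSet (cell q)
  area : ∀ q, μ.real (cell q) = d ^ 2
  diam : ∀ q, ∀ x ∈ cell q, ∀ y ∈ cell q, dist x y ≤ b * d
  z : Q → E3
  z_mem : ∀ q, z q ∈ cell q
  dist_le : ∀ p q, dist (z p) (z q) ≤ D
  block : Q → ℕ
  label : Q → ℕ
  label_lt : ∀ q, label q < n₀
  separated : ∀ p q, block p ≠ block q → a * d ≤ dist (z p) (z q)
  cell_eq : ∀ p q, block p = block q → cell p = cell q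
  overlap : ∀ᵐ x ∂μ, {q | x ∈ cell q}.ncard ≤ n₀

namespace Cloud

variable {μ : Measure E3} [IsFiniteMeasure μ] {a b D C₀ : ℝ} {n₀ : ℕ} {Q : Type} [Fintype Q]
  (P : Cloud μ a b D n₀ Q)

/-- The distance of two marked points, regularised at scale `d`. -/
noncomputable def H (p q : Q) : ℝ := dist (P.z p) (P.z q) + P.d

lemma H_comm (p q : Q) : P.H p q = P.H q p := by simp [H, dist_comm]

lemma d_le_H (p q : Q) : P.d ≤ P.H p q := by simp [H]

lemma H_pos (p q : Q) : 0 < P.H p q := P.d_pos.trans_le (P.d_le_H p q)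

lemma H_le (p q : Q) : P.H p q ≤ D + 1 := add_le_add (P.dist_le p q) P.d_le_one

include P in
lemma dist_bound_nonneg (p : Q) : 0 ≤ D := by simpa using P.dist_le p p

lemma dist_add_le (hb : 0 ≤ b) {p q : Q} {x y : E3} (hx : x ∈ P.cell p) (hy : y ∈ P.cell q) :
    dist x y + P.d ≤ (1 + 2 * b) * P.H p q := by
  have h1 := P.diam p x hx _ (P.z_mem p)
  have h2 := P.diam q _ (P.z_mem q) y hy
  have h3 := dist_triangle4 x (P.z p) (P.z q) y
  have h4 := P.d_le_H p q
  have h5 : dist (P.z p) (P.z q) + P.d = P.H p q := rfl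
  nlinarith

lemma H_le_dist_add (hb : 0 ≤ b) {p q : Q} {x y : E3} (hx : x ∈ P.cell p) (hy : y ∈ P.cell q) :
    P.H p q ≤ (1 + 2 * b) * (dist x y + P.d) := by
  have h1 := P.diam p _ (P.z_mem p) x hx
  have h2 := P.diam q y hy _ (P.z_mem q)
  have h3 := dist_triangle4 (P.z p) x y (P.z q)
  have h5 : dist (P.z p) (P.z q) + P.d = P.H p q := rfl
  have := dist_nonneg (x := x) (y := y)
  have := P.d_pos
  nlinarith [mul_nonneg hb (dist_nonneg (x := x) (y := y)), mul_nonneg hb P.d_pos.le]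

lemma sum_indicator_le {g : E3 → ℝ} {x : E3} (hx : {q | x ∈ P.cell q}.ncard ≤ n₀) (hg : 0 ≤ g x) :
    ∑ q, (P.cell q).indicator g x ≤ n₀ * g x := by
  classical
  have e : ∑ q, (P.cell q).indicator g x = ({q | x ∈ P.cell q}.ncard : ℝ) * g x := by
    simp_rw [indicator_apply]
    rw [← Finset.sum_filter, Finset.sum_const, nsmul_eq_mul, ncard_eq_toFinset_card']
    congr 3
    ext q; simp
  rw [e]
  gcongr

/-- Sums of integrals over the cells are controlled by the total integral. -/
lemma sum_setIntegral_le {g : E3 → ℝ} (hg : Integrable g μ) (hg0 : ∀ x, 0 ≤ g x) :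
    ∑ q, ∫ x in P.cell q, g x ∂μ ≤ n₀ * ∫ x, g x ∂μ := by
  simp_rw [← integral_indicator (P.measurable_cell _)]
  rw [← integral_finsetSum _ fun q _ => hg.indicator (P.measurable_cell q), ← integral_const_mul]
  refine integral_mono_ae (integrable_finsetSum _ fun q _ => hg.indicator (P.measurable_cell q))
    (hg.const_mul _) ?_
  filter_upwards [P.overlap] with x hx
  exact P.sum_indicator_le hx (hg0 x)

lemma setIntegral_const_cell (q : Q) (c : ℝ) : ∫ _ in P.cell q, c ∂μ = P.d ^ 2 * c := by
  rw [setIntegral_const, P.area, smul_eq_mul]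

/-- A Riemann sum: on the cell q the quantity H is comparable to the regularised distance from z p,
the cell has area d², and the overlaps cost n₀. -/
lemma sum_cube_le (hσ : QuadraticGrowth μ C₀) (hC₀ : 0 ≤ C₀) (hb : 0 ≤ b) (p : Q) :
    ∑ q, P.d ^ 3 / P.H p q ^ 3 ≤ n₀ * ((1 + 2 * b) ^ 3 * (8 * C₀)) := by
  have hd := P.d_pos
  set g : E3 → ℝ := fun y => (1 + 2 * b) ^ 3 * (P.d / (dist (P.z p) y + P.d) ^ 3) with hg
  have hcont : Continuous fun y => P.d / (dist (P.z p) y + P.d) ^ 3 :=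
    continuous_const.div (by fun_prop) fun y => by positivity
  have hint : Integrable g μ := by
    refine Integrable.const_mul ((integrable_const (P.d / P.d ^ 3)).mono'
      hcont.aestronglyMeasurable (Eventually.of_forall fun y => ?_)) _
    rw [Real.norm_eq_abs, abs_of_nonneg (by positivity)]
    gcongr
    linarith [dist_nonneg (x := P.z p) (y := y)]
  calc ∑ q, P.d ^ 3 / P.H p q ^ 3 ≤ ∑ q, ∫ y in P.cell q, g y ∂μ := by
        refine Finset.sum_le_sum fun q _ => ?_
        have hH := P.H_pos p q
        have e : P.d ^ 3 / P.H p q ^ 3 = ∫ _ in P.cell q, P.d / P.H p q ^ 3 ∂μ := by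
          rw [P.setIntegral_const_cell]; ring
        rw [e]
        refine setIntegral_mono_on (integrable_const _).integrableOn hint.integrableOn
          (P.measurable_cell q) fun y hy => ?_
        have := P.dist_add_le hb (P.z_mem p) hy
        have h0 : 0 < dist (P.z p) y + P.d := by positivity
        simp only [hg]
        rw [← mul_div_assoc, div_le_div_iff₀ (by positivity) (by positivity)]
        calc P.d * (dist (P.z p) y + P.d) ^ 3 ≤ P.d * ((1 + 2 * b) * P.H p q) ^ 3 := by gcongr
          _ = _ := by ring
    _ ≤ n₀ * ∫ y, g y ∂μ := P.sum_setIntegral_le hint fun y => by positivity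
    _ ≤ _ := by
        rw [integral_const_mul]
        gcongr
        exact integral_div_cube_le hσ hC₀ _ hd

end Cloud

/-- The absence of atoms makes the singular point of the Newtonian kernel negligible. -/
lemma QuadraticGrowth.measure_singleton {μ : Measure E3} {C₀ : ℝ} (hσ : QuadraticGrowth μ C₀)
    (x : E3) : μ {x} = 0 := by
  have hlim : Tendsto (fun r : ℝ => ENNReal.ofReal (C₀ * r ^ 2)) (𝓝[>] 0) (𝓝 0) := by
    have : Tendsto (fun r : ℝ => ENNReal.ofReal (C₀ * r ^ 2)) (𝓝 0)
        (𝓝 (ENNReal.ofReal (C₀ * 0 ^ 2))) :=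
      (ENNReal.continuous_ofReal.comp (by fun_prop)).tendsto 0
    simp only [ne_eq, OfNat.ofNat_ne_zero, not_false_eq_true, zero_pow, mul_zero,
      ENNReal.ofReal_zero] at this
    exact this.mono_left nhdsWithin_le_nhds
  refine le_antisymm (ge_of_tendsto hlim ?_) zero_le
  filter_upwards [self_mem_nhdsWithin] with r hr
  exact (measure_mono (singleton_subset_iff.2 (Metric.mem_closedBall_self (le_of_lt hr)))).trans
    (hσ x r hr)

lemma QuadraticGrowth.ae_dist_pos {μ : Measure E3} {C₀ : ℝ} (hσ : QuadraticGrowth μ C₀)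
    (x : E3) : ∀ᵐ y ∂μ, 0 < dist x y := by
  have : ∀ᵐ y ∂μ, y ∉ ({x} : Set E3) := measure_eq_zero_iff_ae_notMem.1 (hσ.measure_singleton x)
  filter_upwards [this] with y hy
  exact dist_pos.2 fun h => hy h.symm

namespace Cloud

variable {μ : Measure E3} [IsFiniteMeasure μ] {a b D C₀ : ℝ} {n₀ : ℕ} {Q : Type} [Fintype Q]
  (P : Cloud μ a b D n₀ Q)

/-- Comparison with the integral of the Newtonian kernel over a ball. The bound is proportional to
R, so close cells interact weakly in total; `exists_decay_rate` relies on this. -/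
lemma sum_near_le (hσ : QuadraticGrowth μ C₀) (hC₀ : 0 ≤ C₀) (hb : 0 ≤ b) (p : Q) {R : ℝ}
    (hR : 0 < R) :
    ∑ q with P.H p q ≤ R, P.d ^ 2 / P.H p q ≤ n₀ * (4 * C₀ * (1 + 2 * b) ^ 2) * R := by
  have hd := P.d_pos
  set B := Metric.closedBall (P.z p) ((1 + 2 * b) * R)
  have hB : MeasurableSet B := Metric.isClosed_closedBall.measurableSet
  have hBpos : 0 < (1 + 2 * b) * R := by positivity
  set g : E3 → ℝ := fun y => (1 + 2 * b) * B.indicator (fun y => (dist (P.z p) y)⁻¹) y with hg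
  have hint : Integrable g μ :=
    ((integrableOn_inv_dist hσ hC₀ (P.z p) hBpos).integrable_indicator hB).const_mul _
  have hg0 : ∀ y, 0 ≤ g y := fun y =>
    mul_nonneg (by positivity) (indicator_nonneg (fun y _ => inv_nonneg.2 dist_nonneg) y)
  calc ∑ q with P.H p q ≤ R, P.d ^ 2 / P.H p q
      ≤ ∑ q with P.H p q ≤ R, ∫ y in P.cell q, g y ∂μ := by
        refine Finset.sum_le_sum fun q hq => ?_
        have hqR : P.H p q ≤ R := (Finset.mem_filter.1 hq).2
        have hH := P.H_pos p q
        have e : P.d ^ 2 / P.H p q = ∫ _ in P.cell q, (P.H p q)⁻¹ ∂μ := by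
          rw [P.setIntegral_const_cell]; rfl
        rw [e]
        refine setIntegral_mono_on_ae (integrable_const _).integrableOn hint.integrableOn
          (P.measurable_cell q) ?_
        filter_upwards [hσ.ae_dist_pos (P.z p)] with y hy0 hy
        have h1 := P.dist_add_le hb (P.z_mem p) hy
        have h2 : dist (P.z p) y ≤ (1 + 2 * b) * P.H p q := by linarith
        have hyB : y ∈ B := by
          rw [Metric.mem_closedBall, dist_comm]
          exact h2.trans (by gcongr)
        simp only [hg]
        rw [indicator_of_mem hyB, ← div_eq_mul_inv, inv_eq_one_div,
          div_le_div_iff₀ hH hy0]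
        linarith
    _ ≤ ∑ q, ∫ y in P.cell q, g y ∂μ :=
        Finset.sum_le_sum_of_subset_of_nonneg (Finset.filter_subset _ _)
          fun q _ _ => setIntegral_nonneg (P.measurable_cell q) fun y _ => hg0 y
    _ ≤ n₀ * ∫ y, g y ∂μ := P.sum_setIntegral_le hint hg0
    _ ≤ n₀ * ((1 + 2 * b) * (4 * C₀ * ((1 + 2 * b) * R))) := by
        rw [integral_const_mul, integral_indicator hB]
        gcongr
        exact setIntegral_inv_dist_le hσ hC₀ _ hBpos
    _ = _ := by ring

lemma sum_div_le (hσ : QuadraticGrowth μ C₀) (hC₀ : 0 ≤ C₀) (hb : 0 ≤ b) (p : Q) :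
    ∑ q, P.d ^ 2 / P.H p q ≤ n₀ * (4 * C₀ * (1 + 2 * b) ^ 2) * (D + 1) := by
  have := P.sum_near_le hσ hC₀ hb p (R := D + 1) (by linarith [P.dist_bound_nonneg p])
  rwa [Finset.filter_true_of_mem fun q _ => P.H_le p q] at this

/-- The weights of the error terms. -/
noncomputable def W (p q : Q) : ℝ := P.d ^ 2 / P.H p q + P.d ^ 3 / P.H p q ^ 3

lemma W_nonneg (p q : Q) : 0 ≤ P.W p q := by
  have := P.d_pos
  have := P.H_pos p q
  unfold W; positivity

lemma sum_W_le (hσ : QuadraticGrowth μ C₀) (hC₀ : 0 ≤ C₀) (hb : 0 ≤ b) (p : Q) :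
    ∑ q, P.W p q ≤ n₀ * (4 * C₀ * (1 + 2 * b) ^ 2) * (D + 1) + n₀ * ((1 + 2 * b) ^ 3 * (8 * C₀)) := by
  unfold W
  rw [Finset.sum_add_distrib]
  exact add_le_add (P.sum_div_le hσ hC₀ hb p) (P.sum_cube_le hσ hC₀ hb p)

/-- Schur's test; W is symmetric, so column sums are row sums. -/
lemma exists_W_bound (hσ : QuadraticGrowth μ C₀) (hC₀ : 0 ≤ C₀) (hb : 0 ≤ b) (hD : 0 ≤ D) :
    ∃ C : ℝ, 0 ≤ C ∧ ∀ (Q : Type) [Fintype Q] (P : Cloud μ a b D n₀ Q) (A : Q → ℝ),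
      ∑ p, (∑ q, P.W p q * A q) ^ 2 ≤ C * ∑ q, A q ^ 2 := by
  set R := n₀ * (4 * C₀ * (1 + 2 * b) ^ 2) * (D + 1) + n₀ * ((1 + 2 * b) ^ 3 * (8 * C₀))
  refine ⟨R ^ 2, sq_nonneg _, fun Q _ P A => ?_⟩
  refine sum_sq_sum_mul_le P.W_nonneg (by positivity) (P.sum_W_le hσ hC₀ hb) (fun q => ?_) A
  refine le_trans (le_of_eq ?_) (P.sum_W_le hσ hC₀ hb q)
  simp_rw [W, P.H_comm _ q]

/-- Integrals of the Newtonian kernel over a cell. -/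
lemma setIntegral_inv_dist_cell_le (hσ : QuadraticGrowth μ C₀) (hC₀ : 0 ≤ C₀) (hb : 0 ≤ b)
    {p q : Q} {x : E3} (hx : x ∈ P.cell p) :
    IntegrableOn (fun y => (dist x y)⁻¹) (P.cell q) μ ∧
    ∫ y in P.cell q, (dist x y)⁻¹ ∂μ ≤
      (2 * (1 + 2 * b) + 16 * C₀ * (1 + 2 * b) ^ 3) * (P.d ^ 2 / P.H p q) := by
  have hd := P.d_pos
  have hH := P.H_pos p q
  have hsub : P.cell q ⊆ Metric.closedBall x ((1 + 2 * b) * P.H p q) := fun y hy => by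
    rw [Metric.mem_closedBall, dist_comm]
    linarith [P.dist_add_le hb hx hy]
  have hR : 0 < (1 + 2 * b) * P.H p q := by positivity
  have hint := (integrableOn_inv_dist hσ hC₀ x hR).mono_set hsub
  refine ⟨hint, ?_⟩
  have hnn : 0 ≤ P.d ^ 2 / P.H p q := by positivity
  -- If H is large compared with d, the kernel is comparable to 1/H on the whole cell. Otherwise H
  -- is of order d, and the integral over the enclosing ball, of order H, is at most of order d²/H.
  by_cases hfar : 2 * (1 + 2 * b) * P.d ≤ P.H p q
  · have hle : ∫ y in P.cell q, (dist x y)⁻¹ ∂μ ≤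
        ∫ _ in P.cell q, 2 * (1 + 2 * b) * (P.H p q)⁻¹ ∂μ := by
      refine setIntegral_mono_on hint (integrable_const _).integrableOn (P.measurable_cell q)
        fun y hy => ?_
      have h1 := P.H_le_dist_add hb hx hy
      have h2 : P.H p q ≤ 2 * (1 + 2 * b) * dist x y := by nlinarith
      have h3 : 0 < dist x y := by
        by_contra hcon
        have : dist x y = 0 := le_antisymm (not_lt.1 hcon) dist_nonneg
        rw [this] at h2; linarith
      rw [inv_eq_one_div, ← div_eq_mul_inv, div_le_div_iff₀ h3 hH]
      linarith
    rw [P.setIntegral_const_cell] at hle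
    refine hle.trans ?_
    have e : P.d ^ 2 * (2 * (1 + 2 * b) * (P.H p q)⁻¹) = 2 * (1 + 2 * b) * (P.d ^ 2 / P.H p q) := by
      field_simp
    rw [e]
    gcongr
    have : 0 ≤ 16 * C₀ * (1 + 2 * b) ^ 3 := by positivity
    linarith
  · push Not at hfar
    have hle : ∫ y in P.cell q, (dist x y)⁻¹ ∂μ ≤ 4 * C₀ * ((1 + 2 * b) * P.H p q) := by
      refine (setIntegral_mono_set (integrableOn_inv_dist hσ hC₀ x hR)
        (Eventually.of_forall fun y => inv_nonneg.2 dist_nonneg) hsub.eventuallyLE).trans ?_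
      exact setIntegral_inv_dist_le hσ hC₀ x hR
    refine hle.trans ?_
    have h1 : P.H p q ^ 2 ≤ (2 * (1 + 2 * b) * P.d) ^ 2 := by gcongr
    have h2 : 4 * C₀ * ((1 + 2 * b) * P.H p q) ≤
        16 * C₀ * (1 + 2 * b) ^ 3 * (P.d ^ 2 / P.H p q) := by
      rw [← mul_div_assoc, le_div_iff₀ hH]
      calc 4 * C₀ * ((1 + 2 * b) * P.H p q) * P.H p q
          = 4 * C₀ * (1 + 2 * b) * P.H p q ^ 2 := by ring
        _ ≤ 4 * C₀ * (1 + 2 * b) * (2 * (1 + 2 * b) * P.d) ^ 2 := by gcongr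
        _ = _ := by ring
    refine h2.trans ?_
    gcongr
    linarith [show 0 ≤ 2 * (1 + 2 * b) by positivity]

end Cloud

end BubbleScreen

/-! ### Taylor expansion of the regularised Newtonian kernel -/

namespace BubbleScreen

open scoped RealInnerProductSpace

/-- The norm regularised at scale `d`. -/
noncomputable def regNorm (d : ℝ) (v : E3) : ℝ := √(‖v‖ ^ 2 + d ^ 2)

lemma regNorm_sq (d : ℝ) (v : E3) : regNorm d v ^ 2 = ‖v‖ ^ 2 + d ^ 2 :=
  Real.sq_sqrt (by positivity)

lemma regNorm_pos {d : ℝ} (hd : 0 < d) (v : E3) : 0 < regNorm d v :=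
  Real.sqrt_pos.2 (by positivity)

lemma continuous_regNorm (d : ℝ) : Continuous (regNorm d) := by
  unfold regNorm; fun_prop

lemma norm_le_regNorm (d : ℝ) (v : E3) : ‖v‖ ≤ regNorm d v :=
  Real.le_sqrt_of_sq_le (by nlinarith [sq_nonneg d])

lemma le_regNorm (d : ℝ) (v : E3) : d ≤ regNorm d v :=
  Real.le_sqrt_of_sq_le (by nlinarith [sq_nonneg ‖v‖])

lemma abs_regNorm_sub_le {d : ℝ} (hd : 0 < d) (v w : E3) :
    |regNorm d v - regNorm d w| ≤ ‖v - w‖ := by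
  have hv := regNorm_pos hd v
  have hw := regNorm_pos hd w
  have h1 : (regNorm d v - regNorm d w) * (regNorm d v + regNorm d w) =
      (‖v‖ - ‖w‖) * (‖v‖ + ‖w‖) := by
    linear_combination regNorm_sq d v - regNorm_sq d w
  have h2 : |regNorm d v - regNorm d w| * (regNorm d v + regNorm d w) ≤
      ‖v - w‖ * (regNorm d v + regNorm d w) := by
    rw [← abs_of_pos (add_pos hv hw), ← abs_mul, h1, abs_mul, abs_of_pos (add_pos hv hw),
      abs_of_nonneg (by positivity : 0 ≤ ‖v‖ + ‖w‖)]
    gcongr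
    · exact abs_norm_sub_norm_le v w
    · exact norm_le_regNorm d v
    · exact norm_le_regNorm d w
  exact le_of_mul_le_mul_right h2 (add_pos hv hw)

/-- The squares of the two norms differ by exactly d². The relative error d²/`regNorm`² becomes
d⁴/H³ after integration over a cell, which is one of the admissible weights. -/
lemma abs_inv_norm_sub_le {d : ℝ} (hd : 0 < d) {v : E3} (hv : 0 < ‖v‖) :
    |‖v‖⁻¹ - (regNorm d v)⁻¹| ≤ d ^ 2 / regNorm d v ^ 2 * ‖v‖⁻¹ := by
  have hs := regNorm_pos hd v
  have h1 := regNorm_sq d v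
  have h2 := norm_le_regNorm d v
  rw [abs_of_nonneg (sub_nonneg.2 (inv_anti₀ hv h2)), inv_sub_inv hv.ne' hs.ne',
    ← div_eq_mul_inv, div_div, div_le_div_iff₀ (by positivity) (by positivity)]
  have h3 : (regNorm d v - ‖v‖) * (regNorm d v + ‖v‖) = d ^ 2 := by linear_combination h1
  have h4 : (regNorm d v - ‖v‖) * regNorm d v ≤ d ^ 2 := by nlinarith
  calc (regNorm d v - ‖v‖) * (regNorm d v ^ 2 * ‖v‖) =
      ((regNorm d v - ‖v‖) * regNorm d v) * (‖v‖ * regNorm d v) := by ring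
    _ ≤ _ := by gcongr

lemma regRiesz_eq (d : ℝ) (c : Fin 3) (v : E3) : regRiesz d c v = v c / regNorm d v ^ 3 := rfl

lemma abs_regRiesz_le {d : ℝ} (hd : 0 < d) (c : Fin 3) (v : E3) :
    |regRiesz d c v| ≤ (regNorm d v ^ 2)⁻¹ := by
  have hs := regNorm_pos hd v
  rw [regRiesz_eq, abs_div, abs_of_pos (pow_pos hs 3)]
  calc |v c| / regNorm d v ^ 3 ≤ regNorm d v / regNorm d v ^ 3 := by
        gcongr; exact (abs_coord_le v c).trans (norm_le_regNorm d v)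
    _ = _ := by field_simp

/-- Separate lower bounds at both points suffice; no bound along the segment between them is used,
since the difference is computed algebraically. -/
lemma abs_regRiesz_sub_le {d h : ℝ} (hd : 0 < d) (hh : 0 < h) (c : Fin 3) {v w : E3}
    (hv : h ≤ regNorm d v) (hw : h ≤ regNorm d w) :
    |regRiesz d c v - regRiesz d c w| ≤ 4 * ‖v - w‖ / h ^ 3 := by
  set s := regNorm d v
  set r := regNorm d w
  have hs : 0 < s := regNorm_pos hd v
  have hr : 0 < r := regNorm_pos hd w
  have e : regRiesz d c v - regRiesz d c w =
      (v c - w c) / s ^ 3 + w c * ((r - s) * (r ^ 2 + r * s + s ^ 2)) / (s ^ 3 * r ^ 3) := by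
    simp only [regRiesz_eq]
    change v c / s ^ 3 - w c / r ^ 3 = _
    field_simp
    ring
  have hcoord : |v c - w c| ≤ ‖v - w‖ := by simpa using abs_coord_le (v - w) c
  have hrs : |r - s| ≤ ‖v - w‖ := by
    rw [abs_sub_comm]; exact abs_regNorm_sub_le hd v w
  have hwc : |w c| ≤ r := (abs_coord_le w c).trans (norm_le_regNorm d w)
  have h1 : |(v c - w c) / s ^ 3| ≤ ‖v - w‖ / h ^ 3 := by
    rw [abs_div, abs_of_pos (pow_pos hs 3)]
    gcongr
  have h2 : |w c * ((r - s) * (r ^ 2 + r * s + s ^ 2)) / (s ^ 3 * r ^ 3)| ≤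
      3 * ‖v - w‖ / h ^ 3 := by
    rw [abs_div, abs_mul, abs_mul, abs_of_pos (by positivity : 0 < r ^ 2 + r * s + s ^ 2),
      abs_of_pos (by positivity : 0 < s ^ 3 * r ^ 3)]
    calc |w c| * (|r - s| * (r ^ 2 + r * s + s ^ 2)) / (s ^ 3 * r ^ 3)
        ≤ r * (‖v - w‖ * (r ^ 2 + r * s + s ^ 2)) / (s ^ 3 * r ^ 3) := by gcongr
      _ = ‖v - w‖ * (1 / s ^ 3 + 1 / (s ^ 2 * r) + 1 / (s * r ^ 2)) := by
          field_simp
      _ ≤ ‖v - w‖ * (1 / h ^ 3 + 1 / (h ^ 2 * h) + 1 / (h * h ^ 2)) := by gcongr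
      _ = _ := by field_simp; ring
  rw [e]
  refine (abs_add_le _ _).trans ((add_le_add h1 h2).trans_eq ?_)
  ring

/-- The first order expansion of the regularised Newtonian kernel. -/
noncomputable def rieszSlope (d : ℝ) (v e : E3) : ℝ := ∑ c, regRiesz d c v * e c

lemma rieszSlope_eq (d : ℝ) (v e : E3) : rieszSlope d v e = ⟪v, e⟫ / regNorm d v ^ 3 := by
  simp only [rieszSlope, regRiesz_eq, PiLp.inner_apply, Finset.sum_div]
  refine Finset.sum_congr rfl fun c _ => ?_
  simp only [RCLike.inner_apply, conj_trivial]
  ring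

/-- An exact computation with difference of squares: for the regularised norms s of v and r of w, r²
- s² is 2⟪w, w - v⟫ minus ‖w - v‖². The remainder is then visibly quadratic in the displacement. -/
lemma abs_inv_regNorm_sub_sub_le {d : ℝ} (hd : 0 < d) (v w : E3) :
    |(regNorm d v)⁻¹ - (regNorm d w)⁻¹ - rieszSlope d w (w - v)| ≤
      3 * ‖w - v‖ ^ 2 / (regNorm d v * regNorm d w ^ 2) := by
  set s := regNorm d v
  set r := regNorm d w
  have hs : 0 < s := regNorm_pos hd v
  have hr : 0 < r := regNorm_pos hd w
  have hsq : r ^ 2 - s ^ 2 = 2 * ⟪w, w - v⟫ - ‖w - v‖ ^ 2 := by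
    have h1 : s ^ 2 = ‖v‖ ^ 2 + d ^ 2 := regNorm_sq d v
    have h2 : r ^ 2 = ‖w‖ ^ 2 + d ^ 2 := regNorm_sq d w
    have h3 := norm_sub_sq_real w (w - v)
    rw [show w - (w - v) = v by abel] at h3
    linarith
  have e : s⁻¹ - r⁻¹ - ⟪w, w - v⟫ / r ^ 3 =
      ⟪w, w - v⟫ * ((r - s) * (2 * r + s)) / (s * r ^ 3 * (r + s)) -
        ‖w - v‖ ^ 2 / (s * r * (r + s)) := by
    have h4 : s⁻¹ - r⁻¹ = (2 * ⟪w, w - v⟫ - ‖w - v‖ ^ 2) / (s * r * (r + s)) := by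
      rw [← hsq]; field_simp; ring
    rw [h4]
    field_simp
    ring
  have hin : |⟪w, w - v⟫| ≤ r * ‖w - v‖ := (abs_real_inner_le_norm _ _).trans (by
    gcongr; exact norm_le_regNorm d w)
  have hrs : |r - s| ≤ ‖w - v‖ := abs_regNorm_sub_le hd w v
  have h1 : |⟪w, w - v⟫ * ((r - s) * (2 * r + s)) / (s * r ^ 3 * (r + s))| ≤
      2 * ‖w - v‖ ^ 2 / (s * r ^ 2) := by
    rw [abs_div, abs_mul, abs_mul, abs_of_pos (by positivity : 0 < 2 * r + s),
      abs_of_pos (by positivity : 0 < s * r ^ 3 * (r + s))]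
    calc |⟪w, w - v⟫| * (|r - s| * (2 * r + s)) / (s * r ^ 3 * (r + s))
        ≤ (r * ‖w - v‖) * (‖w - v‖ * (2 * (r + s))) / (s * r ^ 3 * (r + s)) := by
          gcongr; linarith
      _ = _ := by field_simp
  have h2 : |‖w - v‖ ^ 2 / (s * r * (r + s))| ≤ ‖w - v‖ ^ 2 / (s * r ^ 2) := by
    rw [abs_of_nonneg (by positivity)]
    exact div_le_div_of_nonneg_left (by positivity) (by positivity)
      (by nlinarith [mul_pos (mul_pos hs hr) hs])
  rw [rieszSlope_eq]
  change |s⁻¹ - r⁻¹ - ⟪w, w - v⟫ / r ^ 3| ≤ _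
  rw [e]
  refine (abs_sub _ _).trans ((add_le_add h1 h2).trans_eq ?_)
  ring

/-- Comparison of retarded regularised potentials at two nearby arguments. -/
lemma abs_retarded_sub_le {d c₀ N T δ t : ℝ} (hd : 0 < d) (hc₀ : 0 < c₀) (hN : 0 ≤ N)
    (hT : 0 ≤ T) {g : ℝ → ℝ} (hg : |g t| ≤ T * N) (hlip : ∀ s s', |g s - g s'| ≤ N * |s - s'|)
    {v w : E3} (hvw : ‖w - v‖ ≤ δ) :
    |g (t - ‖v‖ / c₀) * (regNorm d v)⁻¹ - g (t - ‖w‖ / c₀) * (regNorm d w)⁻¹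
        - g t * rieszSlope d w (w - v)| ≤
      N * (2 * δ / c₀ * (regNorm d w)⁻¹ + 3 * T * δ ^ 2 / (regNorm d v * regNorm d w ^ 2)) := by
  set s := regNorm d v
  set r := regNorm d w
  have hs : 0 < s := regNorm_pos hd v
  have hr : 0 < r := regNorm_pos hd w
  have hδ : 0 ≤ δ := (norm_nonneg _).trans hvw
  have h1 : |(g (t - ‖v‖ / c₀) - g (t - ‖w‖ / c₀)) * r⁻¹| ≤ N * (δ / c₀ * r⁻¹) := by
    rw [abs_mul, abs_of_pos (inv_pos.2 hr), ← mul_assoc]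
    gcongr
    refine (hlip _ _).trans ?_
    gcongr
    rw [show t - ‖v‖ / c₀ - (t - ‖w‖ / c₀) = (‖w‖ - ‖v‖) / c₀ by ring, abs_div, abs_of_pos hc₀]
    gcongr
    exact (abs_norm_sub_norm_le w v).trans hvw
  -- Undoing the delay costs N s/c₀, which cancels one power of the singularity. Hence the singular
  -- first order term may be kept with the density at the common time t, where it is a pure Riesz
  -- transform in space.
  have h2 : |(g (t - ‖v‖ / c₀) - g t) * (s⁻¹ - r⁻¹)| ≤ N * (δ / c₀ * r⁻¹) := by
    have a1 : |g (t - ‖v‖ / c₀) - g t| ≤ N * (s / c₀) := by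
      refine (hlip _ _).trans ?_
      gcongr
      rw [show t - ‖v‖ / c₀ - t = -(‖v‖ / c₀) by ring, abs_neg, abs_of_nonneg (by positivity)]
      gcongr
      exact norm_le_regNorm d v
    have a2 : |s⁻¹ - r⁻¹| ≤ δ / (s * r) := by
      rw [inv_sub_inv hs.ne' hr.ne', abs_div, abs_of_pos (mul_pos hs hr)]
      gcongr
      exact (abs_regNorm_sub_le hd w v).trans hvw
    rw [abs_mul]
    calc _ ≤ N * (s / c₀) * (δ / (s * r)) := mul_le_mul a1 a2 (abs_nonneg _) (by positivity)
      _ = _ := by field_simp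
  have h3 : |g t * (s⁻¹ - r⁻¹ - rieszSlope d w (w - v))| ≤ N * (3 * T * δ ^ 2 / (s * r ^ 2)) := by
    rw [abs_mul]
    calc _ ≤ T * N * (3 * ‖w - v‖ ^ 2 / (s * r ^ 2)) :=
          mul_le_mul hg (abs_inv_regNorm_sub_sub_le hd v w) (abs_nonneg _) (by positivity)
      _ ≤ T * N * (3 * δ ^ 2 / (s * r ^ 2)) := by gcongr
      _ = _ := by ring
  have e : g (t - ‖v‖ / c₀) * s⁻¹ - g (t - ‖w‖ / c₀) * r⁻¹ - g t * rieszSlope d w (w - v) =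
      (g (t - ‖v‖ / c₀) - g (t - ‖w‖ / c₀)) * r⁻¹ + (g (t - ‖v‖ / c₀) - g t) * (s⁻¹ - r⁻¹)
        + g t * (s⁻¹ - r⁻¹ - rieszSlope d w (w - v)) := by ring
  rw [e]
  refine (abs_add_three _ _ _).trans ((add_le_add (add_le_add h1 h2) h3).trans_eq ?_)
  ring

namespace Cloud

variable {μ : Measure E3} [IsFiniteMeasure μ] {a b D C₀ : ℝ} {n₀ : ℕ} {Q : Type} [Fintype Q]
  (P : Cloud μ a b D n₀ Q)

lemma H_le_regNorm (hb : 0 ≤ b) {p q : Q} {x y : E3} (hx : x ∈ P.cell p) (hy : y ∈ P.cell q) :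
    P.H p q / (2 * (1 + 2 * b)) ≤ regNorm P.d (x - y) := by
  have h1 := P.H_le_dist_add hb hx hy
  have h2 := norm_le_regNorm P.d (x - y)
  have h3 := le_regNorm P.d (x - y)
  rw [dist_eq_norm] at h1
  rw [div_le_iff₀ (by positivity)]
  nlinarith

lemma setIntegral_abs_inv_dist_sub_le (hσ : QuadraticGrowth μ C₀) (hC₀ : 0 ≤ C₀) (hb : 0 ≤ b)
    {p q : Q} {x : E3} (hx : x ∈ P.cell p) :
    ∫ y in P.cell q, |(dist x y)⁻¹ - (regNorm P.d (x - y))⁻¹| ∂μ ≤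
      4 * (1 + 2 * b) ^ 2 * (2 * (1 + 2 * b) + 16 * C₀ * (1 + 2 * b) ^ 3) *
        (P.d ^ 4 / P.H p q ^ 3) := by
  have hd := P.d_pos
  have hH := P.H_pos p q
  obtain ⟨hint, hle⟩ := P.setIntegral_inv_dist_cell_le hσ hC₀ hb (q := q) hx
  calc _ ≤ ∫ y in P.cell q, (4 * (1 + 2 * b) ^ 2 * (P.d ^ 2 / P.H p q ^ 2)) * (dist x y)⁻¹ ∂μ := by
        refine integral_mono_of_nonneg (Eventually.of_forall fun y => abs_nonneg _)
          (hint.const_mul _) ?_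
        filter_upwards [ae_restrict_mem (P.measurable_cell q),
          ae_restrict_of_ae (hσ.ae_dist_pos x)] with y hy hpos
        have h1 := P.H_le_regNorm hb hx hy
        have h0 : 0 < P.H p q / (2 * (1 + 2 * b)) := by positivity
        rw [dist_eq_norm] at hpos ⊢
        refine (abs_inv_norm_sub_le hd hpos).trans ?_
        gcongr
        calc P.d ^ 2 / regNorm P.d (x - y) ^ 2 ≤ P.d ^ 2 / (P.H p q / (2 * (1 + 2 * b))) ^ 2 := by
              gcongr
          _ = _ := by field_simp; ring
    _ ≤ (4 * (1 + 2 * b) ^ 2 * (P.d ^ 2 / P.H p q ^ 2)) *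
        ((2 * (1 + 2 * b) + 16 * C₀ * (1 + 2 * b) ^ 3) * (P.d ^ 2 / P.H p q)) := by
        rw [integral_const_mul]
        gcongr
    _ = _ := by field_simp

end Cloud

end BubbleScreen

/-! ### Riesz transforms sampled at points of the cells -/

namespace BubbleScreen

/-- Uniform boundedness of the regularised Riesz transforms on `L²(σ)`. -/
def RieszBound (σ : Measure E3) (C : ℝ) : Prop :=
  ∀ (d : ℝ), 0 < d → d ≤ 1 → ∀ (c : Fin 3) (h : E3 → ℝ), MemLp h 2 σ →
    ∫ x, (∫ y, regRiesz d c (x - y) * h y ∂σ) ^ 2 ∂σ ≤ C * ∫ y, h y ^ 2 ∂σ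

lemma schurKernel_regRiesz {σ : Measure E3} [IsFiniteMeasure σ] {d : ℝ} (hd : 0 < d) (c : Fin 3) :
    SchurKernel σ (fun x y => regRiesz d c (x - y)) (d ^ 2)⁻¹ ((d ^ 2)⁻¹ * σ.real univ) := by
  have hb : ∀ v, |regRiesz d c v| ≤ (d ^ 2)⁻¹ := fun v =>
    (abs_regRiesz_le hd c v).trans (by gcongr; exact le_regNorm d v)
  have hI : ∀ f : E3 → E3, ∫ y, |regRiesz d c (f y)| ∂σ ≤ (d ^ 2)⁻¹ * σ.real univ := fun f => by
    have := integral_mono_of_nonneg (μ := σ)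
      (Eventually.of_forall fun y => abs_nonneg (regRiesz d c (f y)))
      (integrable_const (d ^ 2)⁻¹) (Eventually.of_forall fun y => hb (f y))
    simpa [mul_comm] using this
  refine ⟨?_, fun x y => hb _, Eventually.of_forall fun x => hI _,
    Eventually.of_forall fun y => hI _⟩
  have : Continuous (Function.uncurry fun x y : E3 => regRiesz d c (x - y)) :=
    (continuous_regRiesz hd c).comp (continuous_fst.sub continuous_snd)
  exact this.measurable

namespace Cloud

variable {μ : Measure E3} [IsFiniteMeasure μ] {a b D C₀ C₂ : ℝ} {n₀ : ℕ} {Q : Type} [Fintype Q]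
  (P : Cloud μ a b D n₀ Q)

lemma integrableOn_cell {f : E3 → ℝ} (hf : AEStronglyMeasurable f (μ.restrict (P.cell q)))
    {B : ℝ} (hB : ∀ y ∈ P.cell q, |f y| ≤ B) : IntegrableOn f (P.cell q) μ :=
  (integrable_const B).mono' hf (by
    filter_upwards [ae_restrict_mem (P.measurable_cell q)] with y hy using hB y hy)

lemma abs_setIntegral_cell_le {q : Q} {f : E3 → ℝ} {B : ℝ} (hB : ∀ y ∈ P.cell q, |f y| ≤ B) :
    |∫ y in P.cell q, f y ∂μ| ≤ P.d ^ 2 * B := by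
  have := norm_setIntegral_le_of_norm_le_const (μ := μ) (f := f) (measure_lt_top μ (P.cell q)) hB
  rwa [P.area, mul_comm, Real.norm_eq_abs] at this

/-- Riesz transforms of functions living on some of the cells, sampled at points of the cells. -/
lemma sum_sq_riesz_le (hb : 0 ≤ b) (hC₂ : 0 ≤ C₂) (hR : RieszBound μ C₂) {CW : ℝ}
    (hW : ∀ A : Q → ℝ, ∑ p, (∑ q, P.W p q * A q) ^ 2 ≤ CW * ∑ q, A q ^ 2)
    (c : Fin 3) {h : Q → E3 → ℝ} (hm : ∀ q, Measurable (h q)) {A : Q → ℝ}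
    (hA : ∀ q, 0 ≤ A q) (hh : ∀ q, ∀ y ∈ P.cell q, |h q y| ≤ A q) {x : Q → E3}
    (hx : ∀ p, x p ∈ P.cell p) (F : Finset Q) :
    ∑ p, (∑ q ∈ F, ∫ y in P.cell q, regRiesz P.d c (x p - y) * h q y ∂μ) ^ 2 ≤
      (2 * n₀ ^ 2 * C₂ + 2 * (32 * b * (1 + 2 * b) ^ 3) ^ 2 * CW) * ∑ q ∈ F, A q ^ 2 := by
  classical
  have hd := P.d_pos
  have hker := schurKernel_regRiesz (σ := μ) hd c
  have hkc := continuous_regRiesz hd c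
  set G : E3 → ℝ := fun u => ∑ q ∈ F, ∫ y in P.cell q, regRiesz P.d c (u - y) * h q y ∂μ with hG
  set hF : E3 → ℝ := fun y => ∑ q ∈ F, (P.cell q).indicator (h q) y with hhF
  have hFm : Measurable hF :=
    Finset.measurable_sum _ fun q _ => (hm q).indicator (P.measurable_cell q)
  have hFb : ∀ y, |hF y| ≤ ∑ q ∈ F, A q := fun y => by
    refine (Finset.abs_sum_le_sum_abs _ _).trans (Finset.sum_le_sum fun q _ => ?_)
    by_cases hy : y ∈ P.cell q
    · rw [indicator_of_mem hy]; exact hh q y hy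
    · rw [indicator_of_notMem hy, abs_zero]; exact hA q
  have hFL : MemLp hF 2 μ := MemLp.of_bound hFm.aestronglyMeasurable _ (Eventually.of_forall hFb)
  have hint : ∀ u q, IntegrableOn (fun y => regRiesz P.d c (u - y) * h q y) (P.cell q) μ := by
    intro u q
    refine P.integrableOn_cell (B := (P.d ^ 2)⁻¹ * A q) ?_ fun y hy => ?_
    · exact ((by fun_prop : Measurable fun y => regRiesz P.d c (u - y)).mul (hm q)).aestronglyMeasurable
    · rw [abs_mul]
      exact mul_le_mul (hker.bound u y) (hh q y hy) (abs_nonneg _) (by positivity)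
  have hGeq : ∀ u, G u = ∫ y, regRiesz P.d c (u - y) * hF y ∂μ := by
    intro u
    have e : ∀ y, regRiesz P.d c (u - y) * hF y =
        ∑ q ∈ F, (P.cell q).indicator (fun y => regRiesz P.d c (u - y) * h q y) y := by
      intro y
      simp only [hhF, Finset.mul_sum]
      refine Finset.sum_congr rfl fun q _ => ?_
      by_cases hy : y ∈ P.cell q
      · rw [indicator_of_mem hy, indicator_of_mem hy]
      · rw [indicator_of_notMem hy, indicator_of_notMem hy, mul_zero]
    simp_rw [e]
    rw [integral_finsetSum _ fun q _ => (hint u q).integrable_indicator (P.measurable_cell q)]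
    simp_rw [integral_indicator (P.measurable_cell _)]
    rfl
  have hGsq : Integrable (fun u => G u ^ 2) μ := by
    have := (hker.memLp_kernelIntegral (hFL.integrable one_le_two)).integrable_sq
    refine this.congr (Eventually.of_forall fun u => ?_)
    simp only [kernelIntegral, hGeq]
  -- The L² bound is applied to the superposition of the densities; at almost every point at most n₀
  -- of them are active.
  have hGint : ∫ u, G u ^ 2 ∂μ ≤ C₂ * (n₀ * (P.d ^ 2 * ∑ q ∈ F, A q ^ 2)) := by
    simp_rw [hGeq]
    refine (hR P.d hd P.d_le_one c hF hFL).trans ?_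
    gcongr
    have hi : ∀ q ∈ F, Integrable ((P.cell q).indicator fun _ => A q ^ 2) μ := fun q _ =>
      (integrable_const _).indicator (P.measurable_cell q)
    calc ∫ y, hF y ^ 2 ∂μ
        ≤ ∫ y, n₀ * ∑ q ∈ F, (P.cell q).indicator (fun _ => A q ^ 2) y ∂μ := by
          refine integral_mono_ae hFL.integrable_sq ((integrable_finsetSum _ hi).const_mul _) ?_
          filter_upwards [P.overlap] with y hy
          set F' := F.filter fun q => y ∈ P.cell q
          have hcard : (F'.card : ℝ) ≤ n₀ := by
            have : F'.card ≤ {q | y ∈ P.cell q}.ncard := by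
              rw [← ncard_coe_finset]
              exact ncard_le_ncard (fun q hq => (Finset.mem_filter.1 hq).2) (toFinite _)
            exact_mod_cast this.trans hy
          have e1 : hF y = ∑ q ∈ F', h q y := by
            simp only [hhF, F', Finset.sum_filter, indicator_apply]
          have e2 : ∑ q ∈ F, (P.cell q).indicator (fun _ => A q ^ 2) y = ∑ q ∈ F', A q ^ 2 := by
            simp only [F', Finset.sum_filter, indicator_apply]
          simp only [e1, e2]
          calc (∑ q ∈ F', h q y) ^ 2 ≤ F'.card * ∑ q ∈ F', h q y ^ 2 := sq_sum_le_card_mul_sum_sq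
            _ ≤ n₀ * ∑ q ∈ F', A q ^ 2 := by
                refine mul_le_mul hcard (Finset.sum_le_sum fun q hq => ?_)
                  (Finset.sum_nonneg fun q _ => sq_nonneg _) (Nat.cast_nonneg _)
                rw [← sq_abs]
                gcongr
                exact hh q y (Finset.mem_filter.1 hq).2
      _ = _ := by
          rw [integral_const_mul, integral_finsetSum _ hi]
          simp_rw [integral_indicator (P.measurable_cell _), P.setIntegral_const_cell]
          rw [← Finset.mul_sum]
  set K := 32 * b * (1 + 2 * b) ^ 3 with hK
  have hK0 : 0 ≤ K := by positivity
  set A' : Q → ℝ := fun q => if q ∈ F then A q else 0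
  set E : Q → ℝ := fun p => K * ∑ q, P.W p q * A' q
  -- Moving the sample point inside its cell changes the kernel by O(d/H³), and integration over a
  -- cell gives d³/H³, part of W. The sampled value can thus be traded for a cell average.
  have hdiff : ∀ p, ∀ u ∈ P.cell p, |G (x p) - G u| ≤ E p := by
    intro p u hu
    simp only [hG, E]
    rw [← Finset.sum_sub_distrib]
    have e : K * ∑ q, P.W p q * A' q = ∑ q ∈ F, K * (P.W p q * A q) := by
      rw [Finset.mul_sum]
      simp only [A', mul_ite, mul_zero, Finset.sum_ite_mem, Finset.univ_inter]
    rw [e]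
    refine (Finset.abs_sum_le_sum_abs _ _).trans (Finset.sum_le_sum fun q _ => ?_)
    rw [← integral_sub (hint _ q) (hint _ q)]
    have hH := P.H_pos p q
    refine (P.abs_setIntegral_cell_le (B := K * (P.d / P.H p q ^ 3) * A q) fun y hy => ?_).trans ?_
    · rw [← sub_mul, abs_mul]
      refine mul_le_mul ?_ (hh q y hy) (abs_nonneg _) (by positivity)
      refine (abs_regRiesz_sub_le hd (by positivity) c (P.H_le_regNorm hb (hx p) hy)
        (P.H_le_regNorm hb hu hy)).trans ?_
      have h1 : ‖x p - y - (u - y)‖ ≤ b * P.d := by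
        rw [sub_sub_sub_cancel_right, ← dist_eq_norm]; exact P.diam p _ (hx p) _ hu
      calc 4 * ‖x p - y - (u - y)‖ / (P.H p q / (2 * (1 + 2 * b))) ^ 3
          ≤ 4 * (b * P.d) / (P.H p q / (2 * (1 + 2 * b))) ^ 3 := by gcongr
        _ = _ := by rw [hK]; field_simp; ring
    · have : P.d ^ 3 / P.H p q ^ 3 ≤ P.W p q := by
        have : 0 ≤ P.d ^ 2 / P.H p q := by positivity
        simp only [W]; linarith
      calc P.d ^ 2 * (K * (P.d / P.H p q ^ 3) * A q) = K * (P.d ^ 3 / P.H p q ^ 3 * A q) := by ring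
        _ ≤ _ := by gcongr; exact hA q
  have hE : ∑ p, E p ^ 2 ≤ K ^ 2 * (CW * ∑ q ∈ F, A q ^ 2) := by
    simp only [E, mul_pow]
    rw [← Finset.mul_sum]
    gcongr
    refine (hW A').trans (le_of_eq ?_)
    congr 1
    simp only [A', ite_pow, ne_eq, OfNat.ofNat_ne_zero, not_false_eq_true, zero_pow,
      Finset.sum_ite_mem, Finset.univ_inter]
  -- The pointwise comparison is integrated over the cell, whose area is d².
  have hpoint : ∀ p, P.d ^ 2 * G (x p) ^ 2 ≤ 2 * ∫ u in P.cell p, G u ^ 2 ∂μ + P.d ^ 2 * (2 * E p ^ 2) := by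
    intro p
    rw [← P.setIntegral_const_cell p (G (x p) ^ 2), ← P.setIntegral_const_cell p (2 * E p ^ 2),
      ← integral_const_mul, ← integral_add (hGsq.integrableOn.const_mul 2) (integrable_const _)]
    refine setIntegral_mono_on (integrable_const _).integrableOn
      ((hGsq.integrableOn.const_mul 2).add (integrable_const _)) (P.measurable_cell p) fun u hu => ?_
    have h1 := hdiff p u hu
    have h2 : (G (x p) - G u) ^ 2 ≤ E p ^ 2 := by rw [← sq_abs]; gcongr
    nlinarith [sq_nonneg (G (x p) - 2 * G u)]
  have hsum : P.d ^ 2 * ∑ p, G (x p) ^ 2 ≤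
      2 * (n₀ * ∫ u, G u ^ 2 ∂μ) + P.d ^ 2 * (2 * ∑ p, E p ^ 2) := by
    rw [Finset.mul_sum, Finset.mul_sum, Finset.mul_sum]
    refine (Finset.sum_le_sum fun p _ => hpoint p).trans ?_
    rw [Finset.sum_add_distrib, ← Finset.mul_sum]
    gcongr
    exact P.sum_setIntegral_le hGsq fun u => sq_nonneg _
  have hd2 : 0 < P.d ^ 2 := by positivity
  refine le_of_mul_le_mul_left (hsum.trans ?_) hd2
  calc _ ≤ 2 * (n₀ * (C₂ * (n₀ * (P.d ^ 2 * ∑ q ∈ F, A q ^ 2)))) +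
        P.d ^ 2 * (2 * (K ^ 2 * (CW * ∑ q ∈ F, A q ^ 2))) := by gcongr
    _ = _ := by ring

/-- The sampled Riesz transforms with the interaction pattern of the bubbles. -/
lemma exists_sampled_riesz_bound (hσ : QuadraticGrowth μ C₀) (hC₀ : 0 ≤ C₀) (hb : 0 ≤ b)
    (hD : 0 ≤ D) (hC₂ : 0 ≤ C₂) (hR : RieszBound μ C₂) (θ : ℝ) :
    ∃ C : ℝ, 0 ≤ C ∧ ∀ (Q : Type) [Fintype Q] (P : Cloud μ a b D n₀ Q) (c : Fin 3)
      (h : Q → E3 → ℝ), (∀ q, Measurable (h q)) → ∀ A : Q → ℝ, (∀ q, 0 ≤ A q) →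
      (∀ q, ∀ y ∈ P.cell q, |h q y| ≤ A q) → ∀ x : Q → E3, (∀ p, x p ∈ P.cell p) →
      ∑ p, (∑ q, pattern θ (P.label p) (P.label q) *
        ∫ y in P.cell q, regRiesz P.d c (x p - y) * h q y ∂μ) ^ 2 ≤ C * ∑ q, A q ^ 2 := by
  classical
  obtain ⟨CW, hCW, hW⟩ := exists_W_bound (a := a) (n₀ := n₀) hσ hC₀ hb hD
  set C := 2 * n₀ ^ 2 * C₂ + 2 * (32 * b * (1 + 2 * b) ^ 3) ^ 2 * CW
  have hC : 0 ≤ C := by positivity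
  refine ⟨2 * C + 2 * (θ - 1) ^ 2 * C, by positivity, fun Q _ P c h hm A hA hh x hx => ?_⟩
  have key := P.sum_sq_riesz_le hb hC₂ hR (hW Q P) c hm hA hh hx
  set g : Q → E3 → ℝ := fun q u => ∫ y in P.cell q, regRiesz P.d c (u - y) * h q y ∂μ
  set F : ℕ → Finset Q := fun l => Finset.univ.filter fun q => P.label q = l
  -- The pattern is constantly 1 plus θ - 1 times the indicator of equal labels.
  have hsplit : ∀ p, ∑ q, pattern θ (P.label p) (P.label q) * g q (x p) =
      ∑ q, g q (x p) + (θ - 1) * ∑ q ∈ F (P.label p), g q (x p) := by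
    intro p
    simp only [F, Finset.sum_filter, Finset.mul_sum]
    rw [← Finset.sum_add_distrib]
    refine Finset.sum_congr rfl fun q _ => ?_
    by_cases hpq : P.label p = P.label q
    · simp [pattern, hpq]; ring
    · simp [pattern, hpq, Ne.symm hpq]
  -- Grouped by label, both the targets and the sources lie in the same class, so the bounds with
  -- source sets F l add up without loss.
  have hlab : ∑ p, (∑ q ∈ F (P.label p), g q (x p)) ^ 2 ≤ C * ∑ q, A q ^ 2 := by
    have hmaps : ∀ p ∈ (Finset.univ : Finset Q), P.label p ∈ Finset.range n₀ := fun p _ =>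
      Finset.mem_range.2 (P.label_lt p)
    rw [← Finset.sum_fiberwise_of_maps_to hmaps, ← Finset.sum_fiberwise_of_maps_to hmaps
      (fun q => A q ^ 2), Finset.mul_sum]
    refine Finset.sum_le_sum fun l _ => ?_
    refine le_trans ?_ (key (F l))
    refine le_trans (le_of_eq (Finset.sum_congr rfl fun p hp => ?_))
      (Finset.sum_le_sum_of_subset_of_nonneg (Finset.filter_subset _ _) fun p _ _ => sq_nonneg _)
    rw [(Finset.mem_filter.1 hp).2]
  change ∑ p, (∑ q, pattern θ (P.label p) (P.label q) * g q (x p)) ^ 2 ≤ _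
  simp_rw [hsplit]
  calc _ ≤ ∑ p, (2 * (∑ q, g q (x p)) ^ 2 +
        2 * (θ - 1) ^ 2 * (∑ q ∈ F (P.label p), g q (x p)) ^ 2) := by
        refine Finset.sum_le_sum fun p _ => ?_
        nlinarith [sq_nonneg (∑ q, g q (x p) - (θ - 1) * ∑ q ∈ F (P.label p), g q (x p))]
    _ ≤ 2 * (C * ∑ q, A q ^ 2) + 2 * (θ - 1) ^ 2 * (C * ∑ q, A q ^ 2) := by
        rw [Finset.sum_add_distrib, ← Finset.mul_sum, ← Finset.mul_sum]
        gcongr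
        exact key Finset.univ
    _ = _ := by ring

end Cloud

end BubbleScreen

/-! ### Pointwise comparison of cell potentials and point sources -/

namespace BubbleScreen

/-- Densities that are jointly measurable, bounded and Lipschitz in time on each cell. -/
structure IsDensity {Q : Type} (T : ℝ) (N : Q → ℝ) (ft : Q → E3 → ℝ → ℝ) : Prop where
  nonneg : ∀ q, 0 ≤ N q
  meas : ∀ q, Measurable (Function.uncurry (ft q))
  bound : ∀ q y s, |ft q y s| ≤ T * N q
  lip : ∀ q y s s', |ft q y s - ft q y s'| ≤ N q * |s - s'|

lemma IsDensity.measurable_comp {Q : Type} {T : ℝ} {N : Q → ℝ} {ft : Q → E3 → ℝ → ℝ}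
    (h : IsDensity T N ft) (q : Q) {τ : E3 → ℝ} (hτ : Measurable τ) :
    Measurable fun y => ft q y (τ y) :=
  (h.meas q).comp (measurable_id.prodMk hτ)

lemma abs_pattern_le (θ : ℝ) (l i : ℕ) : |pattern θ l i| ≤ 1 + |θ| := by
  unfold pattern
  split_ifs
  · linarith
  · rw [abs_one]; linarith [abs_nonneg θ]

lemma measurable_rieszSlope {d : ℝ} (hd : 0 < d) {f g : E3 → E3} (hf : Measurable f)
    (hg : Measurable g) : Measurable fun y => rieszSlope d (f y) (g y) := by
  unfold rieszSlope
  refine Finset.measurable_sum _ fun c _ => ?_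
  exact ((continuous_regRiesz hd c).measurable.comp hf).mul
    ((by fun_prop : Measurable fun v : E3 => v c).comp hg)

open scoped RealInnerProductSpace in
lemma abs_rieszSlope_le {d : ℝ} (hd : 0 < d) (v e : E3) :
    |rieszSlope d v e| ≤ ‖e‖ / d ^ 2 := by
  have hs := regNorm_pos hd v
  rw [rieszSlope_eq, abs_div, abs_of_pos (pow_pos hs 3)]
  calc |⟪v, e⟫| / regNorm d v ^ 3 ≤ (regNorm d v * ‖e‖) / regNorm d v ^ 3 := by
        gcongr
        exact (abs_real_inner_le_norm _ _).trans (by gcongr; exact norm_le_regNorm d v)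
    _ = ‖e‖ / regNorm d v ^ 2 := by field_simp
    _ ≤ _ := by gcongr; exact le_regNorm d v

namespace Cloud

variable {μ : Measure E3} [IsFiniteMeasure μ] {a b D C₀ C₂ c₀ T θ : ℝ} {n₀ : ℕ} {Q : Type}
  [Fintype Q] (P : Cloud μ a b D n₀ Q) {N : Q → ℝ} {ft : Q → E3 → ℝ → ℝ}

/-- The potential generated at `x` by the cell `q`. -/
noncomputable def potential (c₀ : ℝ) (ft : Q → E3 → ℝ → ℝ) (q : Q) (x : E3) (t : ℝ) : ℝ :=
  ∫ y in P.cell q, (dist x y)⁻¹ * ft q y (t - dist x y / c₀) ∂μ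

lemma W_mul_d_ge (p q : Q) : P.d ^ 4 / P.H p q ^ 3 ≤ P.d * P.W p q ∧
    P.d ^ 3 / P.H p q ≤ P.d * P.W p q := by
  have hd := P.d_pos
  have hH := P.H_pos p q
  have h1 : P.d * P.W p q = P.d ^ 3 / P.H p q + P.d ^ 4 / P.H p q ^ 3 := by
    unfold W; ring
  have h2 : 0 ≤ P.d ^ 3 / P.H p q := by positivity
  have h3 : 0 ≤ P.d ^ 4 / P.H p q ^ 3 := by positivity
  constructor <;> linarith

lemma integrableOn_inv_dist_mul (hσ : QuadraticGrowth μ C₀) (hC₀ : 0 ≤ C₀) (hb : 0 ≤ b)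
    {p : Q} (q : Q) {x : E3} (hx : x ∈ P.cell p) {g : E3 → ℝ} (hg : Measurable g) {B : ℝ}
    (hB : ∀ y, |g y| ≤ B) : IntegrableOn (fun y => (dist x y)⁻¹ * g y) (P.cell q) μ :=
  Integrable.mul_bdd (c := B) (P.setIntegral_inv_dist_cell_le hσ hC₀ hb (q := q) hx).1
    hg.aestronglyMeasurable (Eventually.of_forall hB)

lemma integrableOn_inv_regNorm_mul {q : Q} {x : E3} {g : E3 → ℝ} (hg : Measurable g) {B : ℝ}
    (hB : ∀ y, |g y| ≤ B) : IntegrableOn (fun y => (regNorm P.d (x - y))⁻¹ * g y) (P.cell q) μ := by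
  have hd := P.d_pos
  have hc : Continuous fun y => (regNorm P.d (x - y))⁻¹ :=
    ((continuous_regNorm P.d).comp (continuous_const.sub continuous_id)).inv₀
      fun y => (regNorm_pos hd _).ne'
  refine P.integrableOn_cell (B := P.d⁻¹ * B) (hc.measurable.mul hg).aestronglyMeasurable
    fun y _ => ?_
  rw [abs_mul, abs_of_pos (inv_pos.2 (regNorm_pos hd _))]
  exact mul_le_mul (inv_anti₀ hd (le_regNorm _ _)) (hB y) (abs_nonneg _) (by positivity)

lemma abs_setIntegral_inv_sub_mul_le (hσ : QuadraticGrowth μ C₀) (hC₀ : 0 ≤ C₀) (hb : 0 ≤ b)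
    {p q : Q} {x : E3} (hx : x ∈ P.cell p) {g : E3 → ℝ} {B : ℝ} (hB0 : 0 ≤ B)
    (hB : ∀ y, |g y| ≤ B) :
    |∫ y in P.cell q, ((dist x y)⁻¹ * g y - (regNorm P.d (x - y))⁻¹ * g y) ∂μ| ≤
      B * (4 * (1 + 2 * b) ^ 2 * (2 * (1 + 2 * b) + 16 * C₀ * (1 + 2 * b) ^ 3) *
        (P.d ^ 4 / P.H p q ^ 3)) := by
  have hd := P.d_pos
  have h1 := P.setIntegral_abs_inv_dist_sub_le hσ hC₀ hb (q := q) hx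
  have hi : IntegrableOn (fun y => |(dist x y)⁻¹ - (regNorm P.d (x - y))⁻¹|) (P.cell q) μ := by
    have a1 := P.integrableOn_inv_dist_mul hσ hC₀ hb q hx (g := fun _ => 1) measurable_const
      (B := 1) (by simp)
    have a2 := P.integrableOn_inv_regNorm_mul (q := q) (x := x) (g := fun _ => 1) measurable_const
      (B := 1) (by simp)
    have := (a1.sub a2).abs
    simpa only [mul_one, IntegrableOn, Pi.sub_apply] using this
  calc _ ≤ ∫ y in P.cell q, B * |(dist x y)⁻¹ - (regNorm P.d (x - y))⁻¹| ∂μ := by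
        rw [← Real.norm_eq_abs]
        refine norm_integral_le_of_norm_le (hi.const_mul B) (Eventually.of_forall fun y => ?_)
        rw [Real.norm_eq_abs, ← sub_mul, abs_mul, mul_comm]
        gcongr
        exact hB y
    _ ≤ _ := by
        rw [integral_const_mul]
        gcongr

lemma integrableOn_density_slope (hf : IsDensity T N ft) (hT : 0 ≤ T) (q : Q) (t : ℝ) (x : E3)
    {e : E3 → E3} (he : Measurable e) {B : ℝ} (hB : ∀ y ∈ P.cell q, ‖e y‖ ≤ B) :
    IntegrableOn (fun y => ft q y t * rieszSlope P.d (x - y) (e y)) (P.cell q) μ := by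
  have hd := P.d_pos
  have hTN : 0 ≤ T * N q := mul_nonneg hT (hf.nonneg q)
  refine P.integrableOn_cell (B := T * N q * (B / P.d ^ 2)) ?_ fun y hy => ?_
  · exact ((hf.measurable_comp q measurable_const).mul
      (measurable_rieszSlope hd (by fun_prop) he)).aestronglyMeasurable
  · rw [abs_mul]
    refine mul_le_mul (hf.bound q y t) ((abs_rieszSlope_le hd _ _).trans ?_) (abs_nonneg _) hTN
    gcongr
    exact hB y hy

/-- The far part of the comparison: regularised retarded potentials. -/
lemma abs_setIntegral_retarded_sub_le (hb : 0 ≤ b) (hc₀ : 0 < c₀) (hT : 0 ≤ T)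
    (hf : IsDensity T N ft) {p q : Q} (t : ℝ) {v w : E3 → E3}
    (hv : ∀ y ∈ P.cell q, P.H p q / (2 * (1 + 2 * b)) ≤ regNorm P.d (v y))
    (hw : ∀ y ∈ P.cell q, P.H p q / (2 * (1 + 2 * b)) ≤ regNorm P.d (w y))
    (hvw : ∀ y ∈ P.cell q, ‖w y - v y‖ ≤ b * P.d) :
    |∫ y in P.cell q, (ft q y (t - ‖v y‖ / c₀) * (regNorm P.d (v y))⁻¹
        - ft q y (t - ‖w y‖ / c₀) * (regNorm P.d (w y))⁻¹
        - ft q y t * rieszSlope P.d (w y) (w y - v y)) ∂μ| ≤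
      (4 * b * (1 + 2 * b) / c₀ + 24 * T * b ^ 2 * (1 + 2 * b) ^ 3) * (P.d * P.W p q) * N q := by
  have hd := P.d_pos
  have hH := P.H_pos p q
  have hN := hf.nonneg q
  have hβ : 0 < P.H p q / (2 * (1 + 2 * b)) := by positivity
  refine (P.abs_setIntegral_cell_le (B := N q * (2 * (b * P.d) / c₀ * (2 * (1 + 2 * b) / P.H p q) +
    3 * T * (b * P.d) ^ 2 * ((2 * (1 + 2 * b)) ^ 3 / P.H p q ^ 3))) fun y hy => ?_).trans ?_
  · refine (abs_retarded_sub_le hd hc₀ hN hT (hf.bound q y t) (fun s s' => hf.lip q y s s')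
      (hvw y hy)).trans ?_
    have h1 := hv y hy
    have h2 := hw y hy
    have hp1 := regNorm_pos hd (v y)
    have hp2 := regNorm_pos hd (w y)
    have e1 : (regNorm P.d (w y))⁻¹ ≤ 2 * (1 + 2 * b) / P.H p q := by
      rw [← inv_div]; exact inv_anti₀ hβ h2
    have e2 : 3 * T * (b * P.d) ^ 2 / (regNorm P.d (v y) * regNorm P.d (w y) ^ 2) ≤
        3 * T * (b * P.d) ^ 2 * ((2 * (1 + 2 * b)) ^ 3 / P.H p q ^ 3) := by
      rw [div_eq_mul_inv]
      gcongr
      calc (regNorm P.d (v y) * regNorm P.d (w y) ^ 2)⁻¹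
          ≤ (P.H p q / (2 * (1 + 2 * b)) * (P.H p q / (2 * (1 + 2 * b))) ^ 2)⁻¹ := by gcongr
        _ = _ := by rw [← pow_succ', ← inv_pow, inv_div, div_pow]
    gcongr
  · obtain ⟨h1, h2⟩ := P.W_mul_d_ge p q
    calc _ = (4 * b * (1 + 2 * b) / c₀ * (P.d ^ 3 / P.H p q) +
          24 * T * b ^ 2 * (1 + 2 * b) ^ 3 * (P.d ^ 4 / P.H p q ^ 3)) * N q := by
          field_simp; ring
      _ ≤ (4 * b * (1 + 2 * b) / c₀ * (P.d * P.W p q) +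
          24 * T * b ^ 2 * (1 + 2 * b) ^ 3 * (P.d * P.W p q)) * N q := by gcongr
      _ = _ := by ring

/-- The potential of a cell at two points of one cell. -/
lemma exists_abs_potential_sub_le (hσ : QuadraticGrowth μ C₀) (hC₀ : 0 ≤ C₀) (hb : 0 ≤ b)
    (hc₀ : 0 < c₀) (hT : 0 ≤ T) :
    ∃ K : ℝ, 0 ≤ K ∧ ∀ (Q : Type) [Fintype Q] (P : Cloud μ a b D n₀ Q) (N : Q → ℝ)
      (ft : Q → E3 → ℝ → ℝ), IsDensity T N ft → ∀ (p q : Q) (t : ℝ), ∀ x ∈ P.cell p,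
      |P.potential c₀ ft q (P.z p) t - P.potential c₀ ft q x t
        - ∫ y in P.cell q, ft q y t * rieszSlope P.d (x - y) (x - P.z p) ∂μ| ≤
      K * (P.d * P.W p q) * N q := by
  set KN := 4 * (1 + 2 * b) ^ 2 * (2 * (1 + 2 * b) + 16 * C₀ * (1 + 2 * b) ^ 3)
  set K₁ := 4 * b * (1 + 2 * b) / c₀ + 24 * T * b ^ 2 * (1 + 2 * b) ^ 3
  refine ⟨2 * (T * KN) + K₁, by positivity, fun Q _ P N ft hf p q t x hx => ?_⟩
  have hd := P.d_pos
  have hN := hf.nonneg q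
  have hz := P.z_mem p
  have hTN : 0 ≤ T * N q := by positivity
  have hm : ∀ u : E3, Measurable fun y => ft q y (t - dist u y / c₀) := fun u =>
    hf.measurable_comp q (by fun_prop)
  have hbd : ∀ u : E3, ∀ y, |ft q y (t - dist u y / c₀)| ≤ T * N q := fun u y => hf.bound q y _
  have i1 : ∀ u ∈ P.cell p, IntegrableOn (fun y => (dist u y)⁻¹ * ft q y (t - dist u y / c₀))
      (P.cell q) μ := fun u hu => P.integrableOn_inv_dist_mul hσ hC₀ hb q hu (hm u) (hbd u)
  have i2 : ∀ u : E3, IntegrableOn (fun y => (regNorm P.d (u - y))⁻¹ * ft q y (t - dist u y / c₀))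
      (P.cell q) μ := fun u => P.integrableOn_inv_regNorm_mul (hm u) (hbd u)
  have i3 := P.integrableOn_density_slope hf hT q t x (e := fun _ => x - P.z p) measurable_const
    (B := ‖x - P.z p‖) fun _ _ => le_rfl
  have b1 := P.abs_setIntegral_inv_sub_mul_le hσ hC₀ hb (q := q) hz hTN (hbd (P.z p))
  have b2 := P.abs_setIntegral_inv_sub_mul_le hσ hC₀ hb (q := q) hx hTN (hbd x)
  have b3 := P.abs_setIntegral_retarded_sub_le hb hc₀ hT hf t (p := p) (q := q)
    (v := fun y => P.z p - y) (w := fun y => x - y)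
    (fun y hy => P.H_le_regNorm hb hz hy) (fun y hy => P.H_le_regNorm hb hx hy)
    (fun y _ => by rw [sub_sub_sub_cancel_right, ← dist_eq_norm]; exact P.diam p _ hx _ hz)
  simp only [← dist_eq_norm, sub_sub_sub_cancel_right] at b3
  obtain ⟨w1, -⟩ := P.W_mul_d_ge p q
  have b0 : T * N q * (KN * (P.d ^ 4 / P.H p q ^ 3)) ≤ T * N q * (KN * (P.d * P.W p q)) := by
    gcongr
  have e3 : ∫ y in P.cell q, (ft q y (t - dist (P.z p) y / c₀) * (regNorm P.d (P.z p - y))⁻¹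
        - ft q y (t - dist x y / c₀) * (regNorm P.d (x - y))⁻¹
        - ft q y t * rieszSlope P.d (x - y) (x - P.z p)) ∂μ =
      ∫ y in P.cell q, (regNorm P.d (P.z p - y))⁻¹ * ft q y (t - dist (P.z p) y / c₀) ∂μ -
      ∫ y in P.cell q, (regNorm P.d (x - y))⁻¹ * ft q y (t - dist x y / c₀) ∂μ -
      ∫ y in P.cell q, ft q y t * rieszSlope P.d (x - y) (x - P.z p) ∂μ := by
    have e := integral_sub ((i2 (P.z p)).sub (i2 x)) i3
    simp only [Pi.sub_apply] at e
    rw [← integral_sub (i2 _) (i2 _), ← e]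
    congr 1; ext y; ring
  rw [e3] at b3
  rw [integral_sub (i1 _ hz) (i2 _)] at b1
  rw [integral_sub (i1 _ hx) (i2 _)] at b2
  simp only [potential]
  rw [abs_le] at *
  constructor <;> linarith [b1.1, b1.2, b2.1, b2.2, b3.1, b3.2]

/-- The potential of a cell compared with the potential of a point source. -/
lemma exists_abs_point_sub_potential_le (hσ : QuadraticGrowth μ C₀) (hC₀ : 0 ≤ C₀) (ha : 0 < a)
    (hb : 0 ≤ b) (hc₀ : 0 < c₀) (hT : 0 ≤ T) :
    ∃ K : ℝ, 0 ≤ K ∧ ∀ (Q : Type) [Fintype Q] (P : Cloud μ a b D n₀ Q) (N : Q → ℝ)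
      (ft : Q → E3 → ℝ → ℝ), IsDensity T N ft → ∀ (p q : Q) (t : ℝ),
      |(if P.block p = P.block q then 0 else
          ∫ y in P.cell q, (dist (P.z p) (P.z q))⁻¹ * ft q y (t - dist (P.z p) (P.z q) / c₀) ∂μ)
        - P.potential c₀ ft q (P.z p) t
        - ∫ y in P.cell q, ft q y t * rieszSlope P.d (P.z p - y) (P.z q - y) ∂μ| ≤
      K * (P.d * P.W p q) * N q := by
  set KP := 2 * (1 + 2 * b) + 16 * C₀ * (1 + 2 * b) ^ 3
  set KN := 4 * (1 + 2 * b) ^ 2 * KP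
  set K₁ := 4 * b * (1 + 2 * b) / c₀ + 24 * T * b ^ 2 * (1 + 2 * b) ^ 3
  refine ⟨(T * KN + K₁ + T * (4 * (1 + 2 * b) ^ 2 * (1 + 1 / a))) + T * (KP + b) * (1 + b) ^ 3,
    by positivity, fun Q _ P N ft hf p q t => ?_⟩
  have hd := P.d_pos
  have hH := P.H_pos p q
  have hN := hf.nonneg q
  have hz := P.z_mem p
  have hzq := P.z_mem q
  have hTN : 0 ≤ T * N q := by positivity
  have hm : ∀ u : E3, Measurable fun y => ft q y (t - dist u y / c₀) := fun u =>
    hf.measurable_comp q (by fun_prop)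
  have hbd : ∀ u : E3, ∀ y, |ft q y (t - dist u y / c₀)| ≤ T * N q := fun u y => hf.bound q y _
  have i1 := P.integrableOn_inv_dist_mul hσ hC₀ hb q hz (hm (P.z p)) (hbd (P.z p))
  have i2 := P.integrableOn_inv_regNorm_mul (q := q) (x := P.z p) (hm (P.z p)) (hbd (P.z p))
  have hslope : ∀ y ∈ P.cell q, ‖P.z q - y‖ ≤ b * P.d := fun y hy => by
    rw [← dist_eq_norm]; exact P.diam q _ hzq _ hy
  have i3 := P.integrableOn_density_slope hf hT q t (P.z p) (e := fun y => P.z q - y)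
    (by fun_prop) hslope
  obtain ⟨w1, w2⟩ := P.W_mul_d_ge p q
  have hW := P.W_nonneg p q
  have hdW : 0 ≤ P.d * P.W p q := mul_nonneg hd.le hW
  -- In the same block the delay system has no term, so the potential and the slope term must be
  -- small by themselves. Both are O(d), and H ≤ (1 + b)d bounds W from below.
  split_ifs with hpq
  · have hHd : P.H p q ≤ (1 + b) * P.d := by
      have := P.diam q (P.z p) (by rw [← P.cell_eq p q hpq]; exact hz) (P.z q) hzq
      have h5 : dist (P.z p) (P.z q) + P.d = P.H p q := rfl
      linarith
    have hdle : P.d ≤ (1 + b) ^ 3 * (P.d * P.W p q) := by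
      have : P.d ≤ (1 + b) ^ 3 * (P.d ^ 4 / P.H p q ^ 3) := by
        rw [← mul_div_assoc, le_div_iff₀ (by positivity)]
        calc P.d * P.H p q ^ 3 ≤ P.d * ((1 + b) * P.d) ^ 3 := by gcongr
          _ = _ := by ring
      exact this.trans (by gcongr)
    have b1 : |P.potential c₀ ft q (P.z p) t| ≤ T * N q * (KP * P.d) := by
      obtain ⟨j1, j2⟩ := P.setIntegral_inv_dist_cell_le hσ hC₀ hb (q := q) hz
      calc _ ≤ ∫ y in P.cell q, T * N q * (dist (P.z p) y)⁻¹ ∂μ := by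
            rw [potential, ← Real.norm_eq_abs]
            refine norm_integral_le_of_norm_le (j1.const_mul _) (Eventually.of_forall fun y => ?_)
            rw [Real.norm_eq_abs, abs_mul, abs_of_nonneg (inv_nonneg.2 dist_nonneg), mul_comm]
            gcongr
            exact hbd _ y
        _ ≤ T * N q * (KP * (P.d ^ 2 / P.H p q)) := by
            rw [integral_const_mul]; gcongr
        _ ≤ _ := by
            gcongr
            rw [div_le_iff₀ hH, sq]
            gcongr
            exact P.d_le_H p q
    have b2 : |∫ y in P.cell q, ft q y t * rieszSlope P.d (P.z p - y) (P.z q - y) ∂μ| ≤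
        P.d ^ 2 * (T * N q * (b * P.d / P.d ^ 2)) := by
      refine P.abs_setIntegral_cell_le fun y hy => ?_
      rw [abs_mul]
      refine mul_le_mul (hf.bound q y t) ((abs_rieszSlope_le hd _ _).trans ?_) (abs_nonneg _) hTN
      gcongr
      exact hslope y hy
    have e2 : P.d ^ 2 * (T * N q * (b * P.d / P.d ^ 2)) = T * N q * (b * P.d) := by field_simp
    rw [e2] at b2
    have hfin : T * N q * (KP * P.d) + T * N q * (b * P.d) ≤
        T * (KP + b) * (1 + b) ^ 3 * (P.d * P.W p q) * N q := by
      calc _ = T * (KP + b) * N q * P.d := by ring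
        _ ≤ T * (KP + b) * N q * ((1 + b) ^ 3 * (P.d * P.W p q)) := by gcongr
        _ = _ := by ring
    have hnn : 0 ≤ (T * KN + K₁ + T * (4 * (1 + 2 * b) ^ 2 * (1 + 1 / a))) * (P.d * P.W p q) * N q := by
      positivity
    rw [abs_le] at *
    constructor <;> linarith [b1.1, b1.2, b2.1, b2.2]
  · have hsep := P.separated p q hpq
    set v := P.z p - P.z q with hv
    have hvn : dist (P.z p) (P.z q) = ‖v‖ := dist_eq_norm _ _
    have hvpos : 0 < ‖v‖ := by rw [← hvn]; exact (by positivity : 0 < a * P.d).trans_le hsep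
    -- Regularising the point source is possible only because the centres are at distance at least a
    -- d: the inverse distance is then at most (1 + 1/a)/H.
    have b0 : |∫ y in P.cell q, ((dist (P.z p) (P.z q))⁻¹ * ft q y (t - dist (P.z p) (P.z q) / c₀) -
        (regNorm P.d v)⁻¹ * ft q y (t - dist (P.z p) (P.z q) / c₀)) ∂μ| ≤
        T * (4 * (1 + 2 * b) ^ 2 * (1 + 1 / a)) * (P.d * P.W p q) * N q := by
      refine (P.abs_setIntegral_cell_le
        (B := 4 * (1 + 2 * b) ^ 2 * (1 + 1 / a) * (P.d ^ 2 / P.H p q ^ 3) * (T * N q))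
        fun y _ => ?_).trans ?_
      · rw [← sub_mul, abs_mul, hvn]
        refine mul_le_mul ((abs_inv_norm_sub_le hd hvpos).trans ?_) (hf.bound q y _) (abs_nonneg _)
          (by positivity)
        have h1 : P.H p q / (2 * (1 + 2 * b)) ≤ regNorm P.d v := P.H_le_regNorm hb hz hzq
        have h2 : ‖v‖⁻¹ ≤ (1 + 1 / a) / P.H p q := by
          rw [inv_eq_one_div, div_le_div_iff₀ hvpos hH, one_mul]
          have h5 : ‖v‖ + P.d = P.H p q := by rw [← hvn]; rfl
          rw [← h5, add_mul, one_mul, one_div_mul_eq_div]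
          gcongr
          rw [le_div_iff₀ ha, ← hvn]; linarith
        calc P.d ^ 2 / regNorm P.d v ^ 2 * ‖v‖⁻¹
            ≤ P.d ^ 2 / (P.H p q / (2 * (1 + 2 * b))) ^ 2 * ((1 + 1 / a) / P.H p q) := by
              gcongr
          _ = _ := by field_simp; ring
      · calc _ = T * (4 * (1 + 2 * b) ^ 2 * (1 + 1 / a)) * (P.d ^ 4 / P.H p q ^ 3) * N q := by ring
          _ ≤ _ := by gcongr
    have hmv : Measurable fun y => ft q y (t - dist (P.z p) (P.z q) / c₀) :=
      hf.measurable_comp q measurable_const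
    have j1 : ∀ k : ℝ, IntegrableOn (fun y => k * ft q y (t - dist (P.z p) (P.z q) / c₀))
        (P.cell q) μ := fun k =>
      (P.integrableOn_cell hmv.aestronglyMeasurable fun y _ => hf.bound q y _).const_mul k
    have b1 := P.abs_setIntegral_inv_sub_mul_le hσ hC₀ hb (q := q) hz hTN (hbd (P.z p))
    have b3 := P.abs_setIntegral_retarded_sub_le hb hc₀ hT hf t (p := p) (q := q)
      (v := fun _ => v) (w := fun y => P.z p - y)
      (fun y hy => P.H_le_regNorm hb hz hzq) (fun y hy => P.H_le_regNorm hb hz hy)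
      (fun y hy => by rw [hv, sub_sub_sub_cancel_left]; exact hslope y hy)
    simp only [hv, sub_sub_sub_cancel_left] at b3
    simp only [← dist_eq_norm] at b3
    have e3 : ∫ y in P.cell q, (ft q y (t - dist (P.z p) (P.z q) / c₀) *
          (regNorm P.d (P.z p - P.z q))⁻¹
          - ft q y (t - dist (P.z p) y / c₀) * (regNorm P.d (P.z p - y))⁻¹
          - ft q y t * rieszSlope P.d (P.z p - y) (P.z q - y)) ∂μ =
        ∫ y in P.cell q, (regNorm P.d v)⁻¹ * ft q y (t - dist (P.z p) (P.z q) / c₀) ∂μ -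
        ∫ y in P.cell q, (regNorm P.d (P.z p - y))⁻¹ * ft q y (t - dist (P.z p) y / c₀) ∂μ -
        ∫ y in P.cell q, ft q y t * rieszSlope P.d (P.z p - y) (P.z q - y) ∂μ := by
      have e := integral_sub ((j1 (regNorm P.d v)⁻¹).sub i2) i3
      simp only [Pi.sub_apply] at e
      rw [← integral_sub (j1 _) i2, ← e]
      congr 1; ext y; simp only [hv]; ring
    rw [e3] at b3
    rw [integral_sub (j1 _) (j1 _)] at b0
    rw [integral_sub i1 i2] at b1
    have b10 : T * N q * (KN * (P.d ^ 4 / P.H p q ^ 3)) ≤ T * N q * (KN * (P.d * P.W p q)) := by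
      gcongr
    have hnn : 0 ≤ T * (KP + b) * (1 + b) ^ 3 * (P.d * P.W p q) * N q := by positivity
    simp only [potential]
    rw [abs_le] at *
    constructor <;> linarith [b0.1, b0.2, b1.1, b1.2, b3.1, b3.2]

end Cloud

end BubbleScreen

/-! ### Total quadrature errors in `ℓ²` -/

namespace BubbleScreen

namespace Cloud

variable {μ : Measure E3} {a b D C₀ C₂ c₀ T θ : ℝ} {n₀ : ℕ} {Q : Type} [Fintype Q]
  (P : Cloud μ a b D n₀ Q) {N : Q → ℝ} {ft : Q → E3 → ℝ → ℝ}

/-- X is the quantity to be summed and Z its first order part. The difference may be bounded in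
absolute value and summed by Schur's test; only Z needs the cancellation provided by the hypothesis
`hZ`. -/
lemma sum_sq_pattern_sum_le {CW : ℝ}
    (hW : ∀ A : Q → ℝ, ∑ p, (∑ q, P.W p q * A q) ^ 2 ≤ CW * ∑ q, A q ^ 2)
    {K : ℝ} (hK : 0 ≤ K) {X Z : Q → Q → ℝ}
    (hXZ : ∀ p q, |X p q - Z p q| ≤ K * (P.d * P.W p q) * N q) {M : ℝ}
    (hZ : ∑ p, (∑ q, pattern θ (P.label p) (P.label q) * Z p q) ^ 2 ≤ M) :
    ∑ p, (∑ q, pattern θ (P.label p) (P.label q) * X p q) ^ 2 ≤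
      2 * ((1 + |θ|) * K) ^ 2 * CW * (P.d ^ 2 * ∑ q, N q ^ 2) + 2 * M := by
  have hd := P.d_pos
  set E : Q → ℝ := fun p => (1 + |θ|) * K * P.d * ∑ q, P.W p q * N q
  have hE : ∀ p, |∑ q, pattern θ (P.label p) (P.label q) * (X p q - Z p q)| ≤ E p := by
    intro p
    simp only [E, Finset.mul_sum]
    refine (Finset.abs_sum_le_sum_abs _ _).trans (Finset.sum_le_sum fun q _ => ?_)
    rw [abs_mul]
    calc _ ≤ (1 + |θ|) * (K * (P.d * P.W p q) * N q) :=
          mul_le_mul (abs_pattern_le _ _ _) (hXZ p q) (abs_nonneg _) (by positivity)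
      _ = _ := by ring
  have hEs : ∑ p, E p ^ 2 ≤ ((1 + |θ|) * K * P.d) ^ 2 * (CW * ∑ q, N q ^ 2) := by
    simp only [E, mul_pow _ (∑ q, _)]
    rw [← Finset.mul_sum]
    gcongr
    exact hW N
  calc _ ≤ ∑ p, (2 * E p ^ 2 + 2 * (∑ q, pattern θ (P.label p) (P.label q) * Z p q) ^ 2) := by
        refine Finset.sum_le_sum fun p _ => ?_
        have e : ∑ q, pattern θ (P.label p) (P.label q) * X p q =
            ∑ q, pattern θ (P.label p) (P.label q) * (X p q - Z p q) +
              ∑ q, pattern θ (P.label p) (P.label q) * Z p q := by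
          rw [← Finset.sum_add_distrib]
          exact Finset.sum_congr rfl fun q _ => by ring
        rw [e]
        have h1 : (∑ q, pattern θ (P.label p) (P.label q) * (X p q - Z p q)) ^ 2 ≤ E p ^ 2 := by
          rw [← sq_abs]
          gcongr
          exact hE p
        linarith [add_sq_le (a := ∑ q, pattern θ (P.label p) (P.label q) * (X p q - Z p q))
          (b := ∑ q, pattern θ (P.label p) (P.label q) * Z p q)]
    _ ≤ 2 * (((1 + |θ|) * K * P.d) ^ 2 * (CW * ∑ q, N q ^ 2)) + 2 * M := by
        rw [Finset.sum_add_distrib, ← Finset.mul_sum, ← Finset.mul_sum]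
        gcongr
    _ = _ := by ring

variable [IsFiniteMeasure μ]

lemma sum_fin_three_sq_le (g : Fin 3 → ℝ) : (∑ c, g c) ^ 2 ≤ 3 * ∑ c, g c ^ 2 := by
  simpa using sq_sum_le_card_mul_sum_sq (s := Finset.univ) (f := g)

lemma setIntegral_density_slope (hf : IsDensity T N ft) (hT : 0 ≤ T) (q : Q) (t : ℝ) (x : E3)
    {e : E3 → E3} (he : Measurable e) {B : ℝ} (hB : ∀ y ∈ P.cell q, ‖e y‖ ≤ B) :
    ∫ y in P.cell q, ft q y t * rieszSlope P.d (x - y) (e y) ∂μ =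
      ∑ c, ∫ y in P.cell q, regRiesz P.d c (x - y) * (ft q y t * e y c) ∂μ := by
  have hd := P.d_pos
  have hTN : 0 ≤ T * N q := mul_nonneg hT (hf.nonneg q)
  rw [← integral_finsetSum]
  · congr 1; ext y
    simp only [rieszSlope, Finset.mul_sum]
    exact Finset.sum_congr rfl fun c _ => by ring
  · intro c _
    refine P.integrableOn_cell (B := (P.d ^ 2)⁻¹ * (T * N q * B)) ?_ fun y hy => ?_
    · exact (((continuous_regRiesz hd c).measurable.comp (by fun_prop)).mul
        ((hf.measurable_comp q measurable_const).mul
          ((by fun_prop : Measurable fun v : E3 => v c).comp he))).aestronglyMeasurable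
    · rw [abs_mul, abs_mul]
      refine mul_le_mul ((abs_regRiesz_le hd c _).trans (by gcongr; exact le_regNorm _ _))
        (mul_le_mul (hf.bound q y t) ((abs_coord_le _ c).trans (hB y hy)) (abs_nonneg _) hTN)
        (by positivity) (by positivity)

/-- Total oscillation of the potentials over the cells. -/
lemma exists_sum_potential_sub_le (hσ : QuadraticGrowth μ C₀) (hC₀ : 0 ≤ C₀) (hb : 0 ≤ b)
    (hc₀ : 0 < c₀) (hT : 0 ≤ T) (hD : 0 ≤ D) (hC₂ : 0 ≤ C₂) (hR : RieszBound μ C₂) (θ : ℝ) :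
    ∃ C : ℝ, 0 ≤ C ∧ ∀ (Q : Type) [Fintype Q] (P : Cloud μ a b D n₀ Q) (N : Q → ℝ)
      (ft : Q → E3 → ℝ → ℝ), IsDensity T N ft → ∀ (t : ℝ) (x : Q → E3), (∀ p, x p ∈ P.cell p) →
      ∑ p, (∑ q, pattern θ (P.label p) (P.label q) *
        (P.potential c₀ ft q (P.z p) t - P.potential c₀ ft q (x p) t)) ^ 2 ≤
      C * (P.d ^ 2 * ∑ q, N q ^ 2) := by
  obtain ⟨CW, hCW, hW⟩ := exists_W_bound (a := a) (n₀ := n₀) hσ hC₀ hb hD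
  obtain ⟨CS, hCS, hS⟩ := exists_sampled_riesz_bound (a := a) (n₀ := n₀) hσ hC₀ hb hD hC₂ hR θ
  obtain ⟨K, hK, hpot⟩ := exists_abs_potential_sub_le (a := a) (D := D) (n₀ := n₀) hσ hC₀ hb hc₀ hT
  refine ⟨2 * ((1 + |θ|) * K) ^ 2 * CW + 2 * (9 * b ^ 2 * CS * T ^ 2), by positivity,
    fun Q _ P N ft hf t x hx => ?_⟩
  have hd := P.d_pos
  have hmain : ∑ p, (∑ q, pattern θ (P.label p) (P.label q) *
      ∫ y in P.cell q, ft q y t * rieszSlope P.d (x p - y) (x p - P.z p) ∂μ) ^ 2 ≤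
      9 * b ^ 2 * CS * T ^ 2 * (P.d ^ 2 * ∑ q, N q ^ 2) := by
    -- Here the displacement x p - z p depends on the target only; it is pulled out of the integral,
    -- each coordinate being at most b d.
    set S : Fin 3 → Q → ℝ := fun c p => ∑ q, pattern θ (P.label p) (P.label q) *
      ∫ y in P.cell q, regRiesz P.d c (x p - y) * ft q y t ∂μ with hSdef
    have hSc : ∀ c, ∑ p, S c p ^ 2 ≤ CS * ∑ q, (T * N q) ^ 2 := fun c =>
      hS Q P c (fun q y => ft q y t) (fun q => hf.measurable_comp q measurable_const)
        (fun q => T * N q) (fun q => mul_nonneg hT (hf.nonneg q)) (fun q y _ => hf.bound q y t) x hx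
    have e : ∀ p, ∑ q, pattern θ (P.label p) (P.label q) *
        ∫ y in P.cell q, ft q y t * rieszSlope P.d (x p - y) (x p - P.z p) ∂μ =
        ∑ c, (x p - P.z p) c * S c p := by
      intro p
      simp only [hSdef, Finset.mul_sum]
      rw [Finset.sum_comm]
      refine Finset.sum_congr rfl fun q _ => ?_
      rw [P.setIntegral_density_slope hf hT q t (x p) (e := fun _ => x p - P.z p) measurable_const
        (B := ‖x p - P.z p‖) (fun _ _ => le_rfl), Finset.mul_sum]
      refine Finset.sum_congr rfl fun c _ => ?_
      rw [mul_left_comm ((x p - P.z p) c)]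
      congr 1
      rw [← integral_const_mul]
      congr 1; ext y; ring
    simp_rw [e]
    calc _ ≤ ∑ p, 3 * ∑ c, (b * P.d) ^ 2 * S c p ^ 2 := by
          refine Finset.sum_le_sum fun p _ => (sum_fin_three_sq_le _).trans ?_
          gcongr with c
          rw [mul_pow, ← sq_abs ((x p - P.z p) c)]
          gcongr
          refine (abs_coord_le _ c).trans ?_
          rw [← dist_eq_norm]
          exact P.diam p _ (hx p) _ (P.z_mem p)
      _ = 3 * (b * P.d) ^ 2 * ∑ c, ∑ p, S c p ^ 2 := by
          rw [Finset.sum_comm, Finset.mul_sum]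
          simp only [Finset.mul_sum, mul_assoc]
      _ ≤ 3 * (b * P.d) ^ 2 * ∑ _c : Fin 3, CS * ∑ q, (T * N q) ^ 2 := by
          gcongr with c
          exact hSc c
      _ = _ := by
          simp only [mul_pow, ← Finset.mul_sum, Finset.sum_const, Finset.card_univ,
            Fintype.card_fin]
          ring
  refine (P.sum_sq_pattern_sum_le (hW Q P) hK (fun p q => hpot Q P N ft hf p q t (x p) (hx p))
    hmain).trans (le_of_eq ?_)
  ring

/-- Total deviation of the potentials from those of point sources at the marked points. -/
lemma exists_sum_point_sub_potential_le (hσ : QuadraticGrowth μ C₀) (hC₀ : 0 ≤ C₀) (ha : 0 < a)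
    (hb : 0 ≤ b) (hc₀ : 0 < c₀) (hT : 0 ≤ T) (hD : 0 ≤ D) (hC₂ : 0 ≤ C₂) (hR : RieszBound μ C₂)
    (θ : ℝ) :
    ∃ C : ℝ, 0 ≤ C ∧ ∀ (Q : Type) [Fintype Q] (P : Cloud μ a b D n₀ Q) (N : Q → ℝ)
      (ft : Q → E3 → ℝ → ℝ), IsDensity T N ft → ∀ (t : ℝ),
      ∑ p, (∑ q, pattern θ (P.label p) (P.label q) *
        ((if P.block p = P.block q then 0 else
          ∫ y in P.cell q, (dist (P.z p) (P.z q))⁻¹ * ft q y (t - dist (P.z p) (P.z q) / c₀) ∂μ)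
        - P.potential c₀ ft q (P.z p) t)) ^ 2 ≤
      C * (P.d ^ 2 * ∑ q, N q ^ 2) := by
  obtain ⟨CW, hCW, hW⟩ := exists_W_bound (a := a) (n₀ := n₀) hσ hC₀ hb hD
  obtain ⟨CS, hCS, hS⟩ := exists_sampled_riesz_bound (a := a) (n₀ := n₀) hσ hC₀ hb hD hC₂ hR θ
  obtain ⟨K, hK, hpot⟩ := exists_abs_point_sub_potential_le (D := D) (n₀ := n₀) hσ hC₀ ha hb hc₀ hT
  refine ⟨2 * ((1 + |θ|) * K) ^ 2 * CW + 2 * (9 * b ^ 2 * CS * T ^ 2), by positivity,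
    fun Q _ P N ft hf t => ?_⟩
  have hd := P.d_pos
  have hsl : ∀ q, ∀ y ∈ P.cell q, ‖P.z q - y‖ ≤ b * P.d := fun q y hy => by
    rw [← dist_eq_norm]; exact P.diam q _ (P.z_mem q) _ hy
  have hmain : ∑ p, (∑ q, pattern θ (P.label p) (P.label q) *
      ∫ y in P.cell q, ft q y t * rieszSlope P.d (P.z p - y) (P.z q - y) ∂μ) ^ 2 ≤
      9 * b ^ 2 * CS * T ^ 2 * (P.d ^ 2 * ∑ q, N q ^ 2) := by
    -- Now the displacement z q - y varies over the source cell, so it is absorbed into the density,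
    -- which supplies the factor b d.
    set S : Fin 3 → Q → ℝ := fun c p => ∑ q, pattern θ (P.label p) (P.label q) *
      ∫ y in P.cell q, regRiesz P.d c (P.z p - y) * (ft q y t * (P.z q - y) c) ∂μ with hSdef
    have hSc : ∀ c, ∑ p, S c p ^ 2 ≤ CS * ∑ q, (T * N q * (b * P.d)) ^ 2 := fun c =>
      hS Q P c (fun q y => ft q y t * (P.z q - y) c)
        (fun q => (hf.measurable_comp q measurable_const).mul (by fun_prop))
        (fun q => T * N q * (b * P.d))
        (fun q => mul_nonneg (mul_nonneg hT (hf.nonneg q)) (by positivity))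
        (fun q y hy => by
          rw [abs_mul]
          exact mul_le_mul (hf.bound q y t) ((abs_coord_le _ c).trans (hsl q y hy)) (abs_nonneg _)
            (mul_nonneg hT (hf.nonneg q))) P.z P.z_mem
    have e : ∀ p, ∑ q, pattern θ (P.label p) (P.label q) *
        ∫ y in P.cell q, ft q y t * rieszSlope P.d (P.z p - y) (P.z q - y) ∂μ = ∑ c, S c p := by
      intro p
      simp only [hSdef]
      rw [Finset.sum_comm]
      refine Finset.sum_congr rfl fun q _ => ?_
      rw [P.setIntegral_density_slope hf hT q t (P.z p) (e := fun y => P.z q - y) (by fun_prop)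
        (hsl q), Finset.mul_sum]
    simp_rw [e]
    calc _ ≤ ∑ p, 3 * ∑ c, S c p ^ 2 := Finset.sum_le_sum fun p _ => sum_fin_three_sq_le _
      _ = 3 * ∑ c, ∑ p, S c p ^ 2 := by rw [Finset.sum_comm, Finset.mul_sum]
      _ ≤ 3 * ∑ _c : Fin 3, CS * ∑ q, (T * N q * (b * P.d)) ^ 2 := by
          gcongr with c
          exact hSc c
      _ = _ := by
          simp only [mul_pow, ← Finset.mul_sum, ← Finset.sum_mul, Finset.sum_const, Finset.card_univ,
            Fintype.card_fin]
          ring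
  refine (P.sum_sq_pattern_sum_le (hW Q P) hK (fun p q => hpot Q P N ft hf p q t)
    hmain).trans (le_of_eq ?_)
  ring

end Cloud

end BubbleScreen

/-! ### Exponentially weighted norms and stability of delayed oscillators -/

namespace BubbleScreen

/-- The square of the exponentially weighted `L²` norm on `(0, τ)`. -/
noncomputable def weightedSq (α τ : ℝ) (g : ℝ → ℝ) : ℝ :=
  ∫ s in (0 : ℝ)..τ, Real.exp (-(2 * α * s)) * g s ^ 2

/-- The second antiderivative vanishing to second order at the origin. -/
noncomputable def secondPrimitive (g : ℝ → ℝ) (t : ℝ) : ℝ :=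
  ∫ s in (0 : ℝ)..t, ∫ r in (0 : ℝ)..s, g r

lemma continuous_primitive {g : ℝ → ℝ} (hg : Continuous g) :
    Continuous fun s => ∫ r in (0 : ℝ)..s, g r :=
  intervalIntegral.continuous_primitive (fun _ _ => hg.intervalIntegrable _ _) 0

lemma continuous_secondPrimitive {g : ℝ → ℝ} (hg : Continuous g) :
    Continuous (secondPrimitive g) :=
  continuous_primitive (continuous_primitive hg)

lemma secondPrimitive_sub {g h : ℝ → ℝ} (hg : Continuous g) (hh : Continuous h) (t : ℝ) :
    secondPrimitive (fun s => g s - h s) t = secondPrimitive g t - secondPrimitive h t := by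
  unfold secondPrimitive
  rw [← intervalIntegral.integral_sub ((continuous_primitive hg).intervalIntegrable _ _)
    ((continuous_primitive hh).intervalIntegrable _ _)]
  congr 1; ext s
  rw [intervalIntegral.integral_sub (hg.intervalIntegrable _ _) (hh.intervalIntegrable _ _)]

section weightedSq

variable {α τ T : ℝ} {g h : ℝ → ℝ}

lemma intervalIntegrable_weighted (hg : Continuous g) (x y : ℝ) :
    IntervalIntegrable (fun s => Real.exp (-(2 * α * s)) * g s ^ 2) volume x y :=
  (by fun_prop : Continuous fun s => Real.exp (-(2 * α * s)) * g s ^ 2).intervalIntegrable _ _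

lemma weightedSq_nonneg (hτ : 0 ≤ τ) : 0 ≤ weightedSq α τ g :=
  intervalIntegral.integral_nonneg hτ fun s _ => by positivity

lemma weightedSq_le_integral (hα : 0 ≤ α) (hτ : 0 ≤ τ) (hg : Continuous g) :
    weightedSq α τ g ≤ ∫ s in (0 : ℝ)..τ, g s ^ 2 := by
  refine intervalIntegral.integral_mono_on hτ (intervalIntegrable_weighted hg _ _)
    ((by fun_prop : Continuous fun s => g s ^ 2).intervalIntegrable _ _) fun s hs => ?_
  have : Real.exp (-(2 * α * s)) ≤ 1 := Real.exp_le_one_iff.2 (by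
    have := mul_nonneg hα hs.1; linarith)
  nlinarith [sq_nonneg (g s)]

lemma integral_sq_le_weightedSq (hα : 0 ≤ α) (hτ : 0 ≤ τ) (hτT : τ ≤ T) (hg : Continuous g) :
    ∫ s in (0 : ℝ)..τ, g s ^ 2 ≤ Real.exp (2 * α * T) * weightedSq α τ g := by
  rw [weightedSq, ← intervalIntegral.integral_const_mul]
  refine intervalIntegral.integral_mono_on hτ
    ((by fun_prop : Continuous fun s => g s ^ 2).intervalIntegrable _ _)
    ((intervalIntegrable_weighted hg _ _).const_mul _) fun s hs => ?_
  rw [← mul_assoc, ← Real.exp_add]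
  have : 1 ≤ Real.exp (2 * α * T + -(2 * α * s)) := Real.one_le_exp (by
    have := mul_le_mul_of_nonneg_left (hs.2.trans hτT) hα; linarith)
  nlinarith [sq_nonneg (g s)]

/-- Delaying a causal function gains an exponential factor. -/
lemma weightedSq_delay_le {δ : ℝ} (hδ : 0 ≤ δ) (hτ : 0 ≤ τ) (hg : Continuous g)
    (hg0 : ∀ s ≤ 0, g s = 0) :
    weightedSq α τ (fun s => g (s - δ)) ≤ Real.exp (-(2 * α * δ)) * weightedSq α τ g := by
  set φ : ℝ → ℝ := fun s => Real.exp (-(2 * α * s)) * g s ^ 2 with hφ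
  have hint : ∀ x y, IntervalIntegrable φ volume x y := intervalIntegrable_weighted hg
  have e : weightedSq α τ (fun s => g (s - δ)) = Real.exp (-(2 * α * δ)) * ∫ s in (-δ)..(τ - δ), φ s := by
    have := intervalIntegral.integral_comp_sub_right (a := 0) (b := τ) φ δ
    rw [zero_sub] at this
    rw [← this, ← intervalIntegral.integral_const_mul, weightedSq]
    congr 1; ext s
    simp only [hφ]
    rw [← mul_assoc, ← Real.exp_add]
    congr 3; ring
  have h0 : ∫ s in (-δ)..0, φ s = 0 := by
    rw [intervalIntegral.integral_congr (g := fun _ => (0 : ℝ)), intervalIntegral.integral_zero]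
    intro s hs
    rw [uIcc_of_le (by linarith)] at hs
    simp [hφ, hg0 s hs.2]
  rw [e]
  gcongr
  calc ∫ s in (-δ)..(τ - δ), φ s ≤ ∫ s in (-δ)..τ, φ s :=
        intervalIntegral.integral_mono_interval le_rfl (by linarith) (by linarith)
          (Eventually.of_forall fun s => by simp only [hφ, Pi.zero_apply]; positivity) (hint _ _)
    _ = _ := by
        rw [← intervalIntegral.integral_add_adjacent_intervals (hint (-δ) 0) (hint 0 τ), h0, zero_add]
        rfl

/-- Integrating twice is a small operation in a strongly weighted norm. -/
lemma weightedSq_secondPrimitive_le (hα : 0 < α) (hτ : 0 ≤ τ) (hτT : τ ≤ T) (hg : Continuous g) :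
    weightedSq α τ (secondPrimitive g) ≤ (T / (2 * α)) ^ 2 * weightedSq α τ g := by
  have hT : 0 ≤ T := hτ.trans hτT
  set w := weightedSq α τ g with hw
  have hw0 : 0 ≤ w := weightedSq_nonneg hτ
  have hexp : ∀ s : ℝ, ∫ r in (0 : ℝ)..s, Real.exp (2 * α * r) ≤ Real.exp (2 * α * s) / (2 * α) := by
    intro s
    rw [intervalIntegral.integral_comp_mul_left (fun x => Real.exp x) (by positivity), integral_exp,
      smul_eq_mul, mul_zero, Real.exp_zero, div_eq_inv_mul]
    gcongr
    linarith
  -- Cauchy–Schwarz with weight exp(2αr): each of the two integrations will gain a factor 1/(2α) on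
  -- the level of squares.
  have h1 : ∀ s ∈ Icc 0 τ, (∫ r in (0 : ℝ)..s, g r) ^ 2 ≤ Real.exp (2 * α * s) / (2 * α) * w := by
    intro s hs
    have hcs := sq_integral_mul_le (μ := volume.restrict (Ioc 0 s))
      (w := fun r => Real.exp (2 * α * r)) (f := fun r => Real.exp (-(2 * α * r)) * g r)
      (fun _ => (Real.exp_pos _).le)
      (by exact ((by fun_prop : Continuous fun r => Real.exp (2 * α * r)).intervalIntegrable 0 s).1)
      (by
        have : Continuous fun r => Real.exp (2 * α * r) * (Real.exp (-(2 * α * r)) * g r) := by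
          fun_prop
        exact (this.intervalIntegrable 0 s).1)
      (by
        have : Continuous fun r => Real.exp (2 * α * r) * (Real.exp (-(2 * α * r)) * g r) ^ 2 := by
          fun_prop
        exact (this.intervalIntegrable 0 s).1)
    simp only [← intervalIntegral.integral_of_le hs.1] at hcs
    have e1 : ∀ r, Real.exp (2 * α * r) * (Real.exp (-(2 * α * r)) * g r) = g r := fun r => by
      rw [← mul_assoc, ← Real.exp_add, add_neg_cancel, Real.exp_zero, one_mul]
    have e2 : ∀ r, Real.exp (2 * α * r) * (Real.exp (-(2 * α * r)) * g r) ^ 2 =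
        Real.exp (-(2 * α * r)) * g r ^ 2 := fun r => by
      rw [sq, ← mul_assoc, e1]; ring
    simp only [e1, e2] at hcs
    refine hcs.trans ?_
    refine mul_le_mul (hexp s) ?_ (intervalIntegral.integral_nonneg hs.1 fun r _ => by positivity)
      (by positivity)
    exact intervalIntegral.integral_mono_interval le_rfl hs.1 hs.2
      (Eventually.of_forall fun r => by simp only [Pi.zero_apply]; positivity)
      (intervalIntegrable_weighted hg _ _)
  have h2 : ∀ t ∈ Icc 0 τ, secondPrimitive g t ^ 2 ≤ T / (4 * α ^ 2) * Real.exp (2 * α * t) * w := by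
    intro t ht
    have hcs := sq_integral_mul_le (μ := volume.restrict (Ioc 0 t))
      (w := fun _ => (1 : ℝ)) (f := fun s => ∫ r in (0 : ℝ)..s, g r)
      (fun _ => zero_le_one) (by simp)
      (by
        have : Continuous fun s => 1 * ∫ r in (0 : ℝ)..s, g r :=
          continuous_const.mul (continuous_primitive hg)
        exact (this.intervalIntegrable 0 t).1)
      (by
        have : Continuous fun s => 1 * (∫ r in (0 : ℝ)..s, g r) ^ 2 :=
          continuous_const.mul ((continuous_primitive hg).pow 2)
        exact (this.intervalIntegrable 0 t).1)
    simp only [← intervalIntegral.integral_of_le ht.1, one_mul] at hcs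
    refine hcs.trans ?_
    have hle : ∫ s in (0 : ℝ)..t, (∫ r in (0 : ℝ)..s, g r) ^ 2 ≤
        ∫ s in (0 : ℝ)..t, Real.exp (2 * α * s) / (2 * α) * w := by
      refine intervalIntegral.integral_mono_on ht.1
        (((continuous_primitive hg).pow 2).intervalIntegrable _ _)
        ((by fun_prop : Continuous fun s => Real.exp (2 * α * s) / (2 * α) * w).intervalIntegrable _ _)
        fun s hs => h1 s ⟨hs.1, hs.2.trans ht.2⟩
    have e3 : ∫ s in (0 : ℝ)..t, Real.exp (2 * α * s) / (2 * α) * w =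
        (∫ s in (0 : ℝ)..t, Real.exp (2 * α * s)) * (w / (2 * α)) := by
      rw [← intervalIntegral.integral_mul_const]
      congr 1; ext s; ring
    rw [e3] at hle
    simp only [intervalIntegral.integral_const, sub_zero, smul_eq_mul, mul_one]
    calc _ ≤ T * (Real.exp (2 * α * t) / (2 * α) * (w / (2 * α))) := by
          refine mul_le_mul (ht.2.trans hτT) (hle.trans ?_)
            (intervalIntegral.integral_nonneg ht.1 fun r _ => sq_nonneg _) hT
          gcongr
          exact hexp t
      _ = _ := by field_simp; ring
  calc weightedSq α τ (secondPrimitive g) ≤ ∫ _ in (0 : ℝ)..τ, T / (4 * α ^ 2) * w := by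
        refine intervalIntegral.integral_mono_on hτ
          (intervalIntegrable_weighted (continuous_secondPrimitive hg) _ _)
          intervalIntegrable_const fun t ht => ?_
        calc _ ≤ Real.exp (-(2 * α * t)) * (T / (4 * α ^ 2) * Real.exp (2 * α * t) * w) := by
              gcongr; exact h2 t ht
          _ = T / (4 * α ^ 2) * (Real.exp (-(2 * α * t)) * Real.exp (2 * α * t)) * w := by ring
          _ = _ := by rw [← Real.exp_add, neg_add_cancel, Real.exp_zero, mul_one]
    _ = τ * (T / (4 * α ^ 2) * w) := by
        rw [intervalIntegral.integral_const, sub_zero, smul_eq_mul]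
    _ ≤ T * (T / (4 * α ^ 2) * w) := by gcongr
    _ = _ := by field_simp; ring

/-- Schur's test for matrices of delays. -/
lemma sum_weightedSq_delay_le {Q : Type} [Fintype Q] {k c δ : Q → Q → ℝ} {ε : ℝ} (hε : 0 ≤ ε)
    (hδ : ∀ p q, 0 ≤ δ p q) (hkc : ∀ p q, |k p q| * Real.exp (-(α * δ p q)) ≤ c p q)
    (hrow : ∀ p, ∑ q, c p q ≤ ε) (hcol : ∀ q, ∑ p, c p q ≤ ε) (hτ : 0 ≤ τ) {e : Q → ℝ → ℝ}
    (he : ∀ q, Continuous (e q)) (he0 : ∀ q, ∀ s ≤ 0, e q s = 0) :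
    ∑ p, weightedSq α τ (fun t => ∑ q, k p q * e q (t - δ p q)) ≤
      ε ^ 2 * ∑ q, weightedSq α τ (e q) := by
  have hec : ∀ p q, Continuous fun t => e q (t - δ p q) := fun p q =>
    (he q).comp (continuous_id.sub continuous_const)
  have hp : ∀ p, weightedSq α τ (fun t => ∑ q, k p q * e q (t - δ p q)) ≤
      ε * ∑ q, c p q * weightedSq α τ (e q) := by
    intro p
    calc weightedSq α τ (fun t => ∑ q, k p q * e q (t - δ p q))
        ≤ ∫ t in (0 : ℝ)..τ, ε * ∑ q, |k p q| * Real.exp (α * δ p q) *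
            (Real.exp (-(2 * α * t)) * e q (t - δ p q) ^ 2) := by
          refine intervalIntegral.integral_mono_on hτ (intervalIntegrable_weighted
            (continuous_finsetSum _ fun q _ => continuous_const.mul (hec p q)) _ _) ?_ fun t _ => ?_
          · refine Continuous.intervalIntegrable (continuous_const.mul
              (continuous_finsetSum _ fun q _ => ?_)) _ _
            have := hec p q
            fun_prop
          -- The coefficient is split asymmetrically: exp(-αδ) makes the row sums small, and the
          -- opposite factor exp(αδ) is repaid by the gain exp(-2αδ) from the delay.
          · have hcs := Finset.sum_sq_le_sum_mul_sum_of_sq_le_mul Finset.univ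
              (r := fun q => k p q * e q (t - δ p q))
              (f := fun q => |k p q| * Real.exp (-(α * δ p q)))
              (g := fun q => |k p q| * Real.exp (α * δ p q) * e q (t - δ p q) ^ 2)
              (fun q _ => by positivity) (fun q _ => by positivity) (fun q _ => le_of_eq (by
                rw [show |k p q| * Real.exp (-(α * δ p q)) *
                  (|k p q| * Real.exp (α * δ p q) * e q (t - δ p q) ^ 2) =
                  |k p q| ^ 2 * (Real.exp (-(α * δ p q)) * Real.exp (α * δ p q)) *
                    e q (t - δ p q) ^ 2 by ring, ← Real.exp_add, neg_add_cancel, Real.exp_zero,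
                  sq_abs]
                ring))
            have hs : ∑ q, |k p q| * Real.exp (-(α * δ p q)) ≤ ε :=
              (Finset.sum_le_sum fun q _ => hkc p q).trans (hrow p)
            calc _ ≤ Real.exp (-(2 * α * t)) *
                  (ε * ∑ q, |k p q| * Real.exp (α * δ p q) * e q (t - δ p q) ^ 2) := by
                  gcongr
                  refine hcs.trans ?_
                  gcongr
              _ = _ := by
                  simp only [Finset.mul_sum]
                  exact Finset.sum_congr rfl fun q _ => by ring
      _ = ε * ∑ q, |k p q| * Real.exp (α * δ p q) * weightedSq α τ (fun t => e q (t - δ p q)) := by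
          rw [intervalIntegral.integral_const_mul, intervalIntegral.integral_finsetSum]
          · simp only [intervalIntegral.integral_const_mul, weightedSq]
          · exact fun q _ => (intervalIntegrable_weighted (hec p q) _ _).const_mul _
      _ ≤ _ := by
          refine mul_le_mul_of_nonneg_left (Finset.sum_le_sum fun q _ => ?_) hε
          calc _ ≤ |k p q| * Real.exp (α * δ p q) *
                (Real.exp (-(2 * α * δ p q)) * weightedSq α τ (e q)) := by
                gcongr
                exact weightedSq_delay_le (hδ p q) hτ (he q) (he0 q)
            _ = |k p q| * (Real.exp (α * δ p q) * Real.exp (-(2 * α * δ p q))) *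
                weightedSq α τ (e q) := by ring
            _ = |k p q| * Real.exp (-(α * δ p q)) * weightedSq α τ (e q) := by
                rw [← Real.exp_add]; congr 3; ring
            _ ≤ _ := by
                gcongr
                · exact weightedSq_nonneg hτ
                · exact hkc p q
  calc _ ≤ ∑ p, ε * ∑ q, c p q * weightedSq α τ (e q) := Finset.sum_le_sum fun p _ => hp p
    _ = ε * ∑ q, (∑ p, c p q) * weightedSq α τ (e q) := by
        rw [← Finset.mul_sum, Finset.sum_comm]
        simp only [Finset.sum_mul]
    _ ≤ ε * ∑ q, ε * weightedSq α τ (e q) := by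
        gcongr with q _
        · exact weightedSq_nonneg hτ
        · exact hcol q
    _ = _ := by rw [← Finset.mul_sum]; ring

/-- Stability of oscillators with small delayed coupling. -/
lemma sum_weightedSq_le_residual {Q : Type} [Fintype Q] {k c δ : Q → Q → ℝ} {ε ω : ℝ} (hω : 0 < ω)
    (hε : 0 ≤ ε) (hα : 0 < α) (hsmall : 3 * (T / (2 * α)) ^ 2 + 3 * ε ^ 2 ≤ ω ^ 4 / 2)
    (hδ : ∀ p q, 0 ≤ δ p q) (hkc : ∀ p q, |k p q| * Real.exp (-(α * δ p q)) ≤ c p q)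
    (hrow : ∀ p, ∑ q, c p q ≤ ε) (hcol : ∀ q, ∑ p, c p q ≤ ε) (hτ : 0 ≤ τ) (hτT : τ ≤ T)
    {e : Q → ℝ → ℝ} (he : ∀ q, Continuous (e q)) (he0 : ∀ q, ∀ s ≤ 0, e q s = 0) :
    ∑ p, weightedSq α τ (e p) ≤ 6 / ω ^ 4 * ∑ p, weightedSq α τ (fun t =>
      ω ^ 2 * e p t + secondPrimitive (e p) t + ∑ q, k p q * e q (t - δ p q)) := by
  set R : Q → ℝ → ℝ := fun p t =>
    ω ^ 2 * e p t + secondPrimitive (e p) t + ∑ q, k p q * e q (t - δ p q) with hR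
  have hS : ∀ p, Continuous fun t => ∑ q, k p q * e q (t - δ p q) := fun p =>
    continuous_finsetSum _ fun q _ =>
      continuous_const.mul ((he q).comp (continuous_id.sub continuous_const))
  have hRc : ∀ p, Continuous (R p) := fun p =>
    (((he p).const_smul (ω ^ 2)).add (continuous_secondPrimitive (he p))).add (hS p)
  have h1 : ∀ p, ω ^ 4 * weightedSq α τ (e p) ≤ 3 * weightedSq α τ (R p) +
      3 * weightedSq α τ (secondPrimitive (e p)) +
      3 * weightedSq α τ (fun t => ∑ q, k p q * e q (t - δ p q)) := by
    intro p
    have i1 := intervalIntegrable_weighted (α := α) (hRc p) 0 τ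
    have i2 := intervalIntegrable_weighted (α := α) (continuous_secondPrimitive (he p)) 0 τ
    have i3 := intervalIntegrable_weighted (α := α) (hS p) 0 τ
    simp only [weightedSq]
    rw [← intervalIntegral.integral_const_mul, ← intervalIntegral.integral_const_mul,
      ← intervalIntegral.integral_const_mul, ← intervalIntegral.integral_const_mul,
      ← intervalIntegral.integral_add (i1.const_mul 3) (i2.const_mul 3),
      ← intervalIntegral.integral_add ((i1.const_mul 3).add (i2.const_mul 3)) (i3.const_mul 3)]
    refine intervalIntegral.integral_mono_on hτ ((intervalIntegrable_weighted (he p) _ _).const_mul _)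
      (((i1.const_mul 3).add (i2.const_mul 3)).add (i3.const_mul 3)) fun t _ => ?_
    have hE := Real.exp_pos (-(2 * α * t))
    have : (ω ^ 2 * e p t) ^ 2 ≤ 3 * R p t ^ 2 + 3 * secondPrimitive (e p) t ^ 2 +
        3 * (∑ q, k p q * e q (t - δ p q)) ^ 2 := by
      have e1 : ω ^ 2 * e p t = R p t - secondPrimitive (e p) t - ∑ q, k p q * e q (t - δ p q) := by
        simp only [hR]; ring
      rw [e1]
      nlinarith [sq_nonneg (R p t + secondPrimitive (e p) t),
        sq_nonneg (R p t + ∑ q, k p q * e q (t - δ p q)),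
        sq_nonneg (secondPrimitive (e p) t - ∑ q, k p q * e q (t - δ p q))]
    calc _ = Real.exp (-(2 * α * t)) * (ω ^ 2 * e p t) ^ 2 := by ring
      _ ≤ _ := (mul_le_mul_of_nonneg_left this hE.le).trans_eq (by ring)
  -- After summation, `hsmall` absorbs the double integral and the coupling into half of the left
  -- side.
  have h2 := Finset.sum_le_sum fun p (_ : p ∈ Finset.univ) => h1 p
  simp only [Finset.sum_add_distrib, ← Finset.mul_sum] at h2
  have h3 : ∑ p, weightedSq α τ (secondPrimitive (e p)) ≤
      (T / (2 * α)) ^ 2 * ∑ p, weightedSq α τ (e p) := by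
    rw [Finset.mul_sum]
    exact Finset.sum_le_sum fun p _ => weightedSq_secondPrimitive_le hα hτ hτT (he p)
  have h4 := sum_weightedSq_delay_le hε hδ hkc hrow hcol hτ he he0
  have h5 : 0 ≤ ∑ p, weightedSq α τ (e p) := Finset.sum_nonneg fun p _ => weightedSq_nonneg hτ
  have h6 := mul_le_mul_of_nonneg_right hsmall h5
  have hω4 : 0 < ω ^ 4 := by positivity
  rw [div_mul_eq_mul_div, le_div_iff₀ hω4]
  nlinarith

end weightedSq

end BubbleScreen

/-! ### Smallness of the damped coupling; cell averages -/

namespace BubbleScreen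

lemma sum_weightedSq_le_of_pointwise {Q : Type} [Fintype Q] {α τ T M : ℝ} (hα : 0 ≤ α)
    (hτ : 0 ≤ τ) (hτT : τ ≤ T) (hM : 0 ≤ M) {R : Q → ℝ → ℝ} (hR : ∀ p, Continuous (R p))
    (h : ∀ t ∈ Icc 0 τ, ∑ p, R p t ^ 2 ≤ M) : ∑ p, weightedSq α τ (R p) ≤ T * M := by
  calc ∑ p, weightedSq α τ (R p) ≤ ∑ p, ∫ s in (0 : ℝ)..τ, R p s ^ 2 :=
        Finset.sum_le_sum fun p _ => weightedSq_le_integral hα hτ (hR p)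
    _ = ∫ s in (0 : ℝ)..τ, ∑ p, R p s ^ 2 := by
        rw [intervalIntegral.integral_finsetSum]
        exact fun p _ => ((hR p).pow 2).intervalIntegrable _ _
    _ ≤ ∫ _ in (0 : ℝ)..τ, M := by
        refine intervalIntegral.integral_mono_on hτ ?_ intervalIntegrable_const h
        exact (continuous_finsetSum _ fun p _ => (hR p).pow 2).intervalIntegrable _ _
    _ = τ * M := by rw [intervalIntegral.integral_const, sub_zero, smul_eq_mul]
    _ ≤ T * M := by gcongr

lemma IsDensity.continuous {Q : Type} {T : ℝ} {N : Q → ℝ} {ft : Q → E3 → ℝ → ℝ}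
    (h : IsDensity T N ft) (q : Q) (y : E3) : Continuous (ft q y) := by
  have : LipschitzWith ⟨N q, h.nonneg q⟩ (ft q y) :=
    LipschitzWith.of_dist_le_mul fun s s' => h.lip q y s s'
  exact this.continuous

namespace Cloud

variable {μ : Measure E3} [IsFiniteMeasure μ] {a b D C₀ C₂ c₀ T θ κ ω : ℝ} {n₀ : ℕ} {Q : Type}
  [Fintype Q] (P : Cloud μ a b D n₀ Q) {N : Q → ℝ} {ft : Q → E3 → ℝ → ℝ}

/-- Cells with H ≤ R contribute little because their total weight is O(R); for the others the
exponential is at most the inverse of αcR. One α serves all clouds, since the bounds do not involve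
d. The lower bound α₀ leaves room for further requirements on α. -/
lemma exists_decay_rate (hσ : QuadraticGrowth μ C₀) (hC₀ : 0 ≤ C₀) (hb : 0 ≤ b) (hD : 0 ≤ D)
    {c ε : ℝ} (hc : 0 < c) (hε : 0 < ε) (α₀ : ℝ) :
    ∃ α : ℝ, α₀ ≤ α ∧ 0 < α ∧ ∀ (Q : Type) [Fintype Q] (P : Cloud μ a b D n₀ Q) (p : Q),
      ∑ q, P.d ^ 2 / P.H p q * Real.exp (-(α * (c * P.H p q))) ≤ ε := by
  set B := n₀ * (4 * C₀ * (1 + 2 * b) ^ 2) with hB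
  have hB0 : 0 ≤ B := by positivity
  -- Makes the near part at most BR ≤ ε/2; the term added to α below does the same for the far part.
  set R := ε / (2 * (B + 1)) with hR
  have hRpos : 0 < R := by positivity
  have hx : 0 ≤ 2 * B * (D + 1) / (ε * c * R) := by positivity
  refine ⟨max α₀ 1 + 2 * B * (D + 1) / (ε * c * R), by linarith [le_max_left α₀ 1],
    by linarith [le_max_right α₀ 1], fun Q _ P p => ?_⟩
  set α := max α₀ 1 + 2 * B * (D + 1) / (ε * c * R) with hαdef
  have hα : 0 < α := by linarith [le_max_right α₀ 1]
  have hd := P.d_pos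
  have hnear : ∑ q with P.H p q ≤ R, P.d ^ 2 / P.H p q * Real.exp (-(α * (c * P.H p q))) ≤ ε / 2 := by
    calc _ ≤ ∑ q with P.H p q ≤ R, P.d ^ 2 / P.H p q := by
          refine Finset.sum_le_sum fun q _ => ?_
          have hH := P.H_pos p q
          refine mul_le_of_le_one_right (by positivity) (Real.exp_le_one_iff.2 ?_)
          rw [neg_nonpos]; positivity
      _ ≤ B * R := P.sum_near_le hσ hC₀ hb p hRpos
      _ ≤ ε / 2 := by
          rw [hR, ← mul_div_assoc, div_le_div_iff₀ (by positivity) (by positivity)]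
          nlinarith
  have hfar : ∑ q with ¬ P.H p q ≤ R, P.d ^ 2 / P.H p q * Real.exp (-(α * (c * P.H p q))) ≤ ε / 2 := by
    have hy : 0 < α * (c * R) := by positivity
    calc _ ≤ ∑ q with ¬ P.H p q ≤ R, P.d ^ 2 / P.H p q * (α * (c * R))⁻¹ := by
          refine Finset.sum_le_sum fun q hq => ?_
          have hH := P.H_pos p q
          have hqR : R ≤ P.H p q := (not_le.1 (Finset.mem_filter.1 hq).2).le
          gcongr
          rw [Real.exp_neg]
          refine inv_anti₀ hy ?_
          calc α * (c * R) ≤ α * (c * P.H p q) := by gcongr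
            _ ≤ _ := by linarith [Real.add_one_le_exp (α * (c * P.H p q))]
      _ ≤ ∑ q, P.d ^ 2 / P.H p q * (α * (c * R))⁻¹ :=
          Finset.sum_le_sum_of_subset_of_nonneg (Finset.filter_subset _ _) fun q _ _ => by
            have hH := P.H_pos p q
            positivity
      _ ≤ B * (D + 1) * (α * (c * R))⁻¹ := by
          rw [← Finset.sum_mul]
          gcongr
          exact P.sum_div_le hσ hC₀ hb p
      _ ≤ ε / 2 := by
          rw [← div_eq_mul_inv, div_le_div_iff₀ hy two_pos]
          have : 2 * B * (D + 1) / (ε * c * R) ≤ α := by linarith [le_max_right α₀ 1]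
          rw [div_le_iff₀ (by positivity)] at this
          linarith
  rw [← Finset.sum_filter_add_sum_filter_not Finset.univ (fun q => P.H p q ≤ R)]
  linarith

/-- The coefficients of the delay system. -/
noncomputable def coupling (κ θ : ℝ) (p q : Q) : ℝ :=
  if P.block p = P.block q then 0
  else pattern θ (P.label p) (P.label q) * (κ * P.d ^ 2 / dist (P.z p) (P.z q))

lemma H_le_dist (ha : 0 < a) {p q : Q} (h : P.block p ≠ P.block q) :
    P.H p q ≤ (1 + 1 / a) * dist (P.z p) (P.z q) := by
  have h1 := P.separated p q h
  have h2 : P.d ≤ dist (P.z p) (P.z q) / a := by rw [le_div_iff₀ ha]; linarith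
  have h5 : dist (P.z p) (P.z q) + P.d = P.H p q := rfl
  rw [← h5, add_mul, one_mul, one_div_mul_eq_div]
  linarith

/-- Separation of the centres makes their distance comparable to H both in the coefficient and in
the delay. The majorant is symmetric in p and q, so a single bound gives row and column sums. -/
lemma abs_coupling_mul_exp_le (ha : 0 < a) (hc₀ : 0 < c₀) (hκ : 0 ≤ κ) {α : ℝ} (hα : 0 ≤ α)
    (p q : Q) :
    |P.coupling κ θ p q| * Real.exp (-(α * (dist (P.z p) (P.z q) / c₀))) ≤
      (1 + |θ|) * κ * (1 + 1 / a) *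
        (P.d ^ 2 / P.H p q * Real.exp (-(α * ((c₀ * (1 + 1 / a))⁻¹ * P.H p q)))) := by
  have hd := P.d_pos
  have hH := P.H_pos p q
  unfold coupling
  split_ifs with h
  · rw [abs_zero, zero_mul]; positivity
  · have h1 := P.H_le_dist ha h
    have hpos : 0 < dist (P.z p) (P.z q) := by
      by_contra hcon
      have : dist (P.z p) (P.z q) = 0 := le_antisymm (not_lt.1 hcon) dist_nonneg
      rw [this] at h1; linarith
    have h2 : κ * P.d ^ 2 / dist (P.z p) (P.z q) ≤ κ * (1 + 1 / a) * (P.d ^ 2 / P.H p q) := by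
      rw [← mul_div_assoc, div_le_div_iff₀ hpos hH]
      calc κ * P.d ^ 2 * P.H p q ≤ κ * P.d ^ 2 * ((1 + 1 / a) * dist (P.z p) (P.z q)) := by gcongr
        _ = _ := by ring
    have h3 : (c₀ * (1 + 1 / a))⁻¹ * P.H p q ≤ dist (P.z p) (P.z q) / c₀ := by
      rw [inv_mul_eq_div, div_le_div_iff₀ (by positivity) hc₀]
      nlinarith
    rw [abs_mul, abs_of_nonneg (by positivity : 0 ≤ κ * P.d ^ 2 / dist (P.z p) (P.z q))]
    calc _ ≤ (1 + |θ|) * (κ * (1 + 1 / a) * (P.d ^ 2 / P.H p q)) *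
          Real.exp (-(α * ((c₀ * (1 + 1 / a))⁻¹ * P.H p q))) := by
          gcongr
          exact abs_pattern_le _ _ _
      _ = _ := by ring

/-- A point of a cell at which a density deviates at least as much as its mean value. -/
lemma exists_mem_integral_sq_sub_average_le (hf : IsDensity T N ft) (q : Q) {τ : ℝ}
    (hτ : 0 ≤ τ) {h : ℝ → ℝ} (hh : Continuous h) {p : E3 → Prop}
    (hp : ∀ᵐ y ∂μ.restrict (P.cell q), p y) :
    ∃ x ∈ P.cell q, p x ∧
      ∫ s in (0 : ℝ)..τ, (h s - (P.d ^ 2)⁻¹ * ∫ y in P.cell q, ft q y s ∂μ) ^ 2 ≤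
        ∫ s in (0 : ℝ)..τ, (h s - ft q x s) ^ 2 := by
  have hd := P.d_pos
  set ν := μ.restrict (P.cell q) with hν
  have hνr : ν.real univ = P.d ^ 2 := by rw [hν, measureReal_restrict_apply_univ, P.area]
  set Φ : E3 → ℝ := fun y => ∫ s in (0 : ℝ)..τ, (h s - ft q y s) ^ 2 with hΦ
  obtain ⟨B, hB⟩ := isCompact_Icc.exists_bound_of_continuousOn (s := Icc 0 τ) hh.continuousOn
  have hm : Measurable fun z : ℝ × E3 => (h z.1 - ft q z.2 z.1) ^ 2 :=
    ((hh.measurable.comp measurable_fst).sub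
      ((hf.meas q).comp (measurable_snd.prodMk measurable_fst))).pow_const 2
  have hsq : ∀ s ∈ Icc 0 τ, ∀ y, |(h s - ft q y s) ^ 2| ≤ (B + T * N q) ^ 2 := by
    intro s hs y
    rw [abs_pow]
    gcongr
    exact (abs_sub _ _).trans (add_le_add (hB s hs) (hf.bound q y s))
  have hprod : Integrable (Function.uncurry fun (s : ℝ) (y : E3) => (h s - ft q y s) ^ 2)
      ((volume.restrict (Ioc 0 τ)).prod ν) := by
    refine (integrable_const ((B + T * N q) ^ 2)).mono' hm.aestronglyMeasurable ?_
    have : ∀ᵐ z ∂(volume.restrict (Ioc 0 τ)).prod ν, z.1 ∈ Ioc 0 τ :=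
      Measure.quasiMeasurePreserving_fst.ae (ae_restrict_mem measurableSet_Ioc)
    filter_upwards [this] with z hz
    exact hsq z.1 ⟨hz.1.le, hz.2⟩ z.2
  have hΦint : Integrable Φ ν := by
    have := hprod.swap.integral_prod_left
    refine this.congr (Eventually.of_forall fun y => ?_)
    simp only [hΦ, intervalIntegral.integral_of_le hτ]
    rfl
  have hν0 : ν ≠ 0 := fun h0 => by
    rw [h0] at hνr
    simp only [measureReal_zero, Pi.zero_apply] at hνr
    exact (pow_pos hd 2).ne hνr
  have hN : ν {y | ¬ (y ∈ P.cell q ∧ p y)} = 0 := by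
    have : ∀ᵐ y ∂ν, y ∈ P.cell q ∧ p y := (ae_restrict_mem (P.measurable_cell q)).and hp
    exact this
  -- A function exceeds its mean somewhere off any null set. The null set contains the points where
  -- p fails, which allows the regular version to be replaced by the solution at x.
  obtain ⟨x, hx, hxle⟩ := exists_notMem_null_average_le hν0 hΦint hN
  simp only [mem_ofPred_eq, not_not] at hx
  refine ⟨x, hx.1, hx.2, le_trans ?_ hxle⟩
  have hft1 : ∀ s, Integrable (fun y => ft q y s) ν := fun s =>
    P.integrableOn_cell (hf.measurable_comp q measurable_const).aestronglyMeasurable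
      fun y _ => hf.bound q y s
  rw [average_eq, hνr, smul_eq_mul]
  have hswap : ∫ y, Φ y ∂ν = ∫ s in (0 : ℝ)..τ, ∫ y, (h s - ft q y s) ^ 2 ∂ν := by
    rw [intervalIntegral.integral_of_le hτ, integral_integral_swap hprod]
    simp only [hΦ, intervalIntegral.integral_of_le hτ]
  rw [hswap, ← intervalIntegral.integral_const_mul]
  have havg : Continuous fun s => ∫ y, ft q y s ∂ν :=
    continuous_of_dominated (fun s => (hft1 s).aestronglyMeasurable)
      (fun s => Eventually.of_forall fun y => hf.bound q y s) (integrable_const _)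
      (Eventually.of_forall fun y => hf.continuous q y)
  refine intervalIntegral.integral_mono_on hτ ?_ ?_ fun s hs => ?_
  · exact ((hh.sub (continuous_const.mul havg)).pow 2).intervalIntegrable _ _
  · rw [intervalIntegrable_iff_integrableOn_Ioc_of_le hτ]
    exact (hprod.integral_prod_left).const_mul _
  · have i1 : Integrable (fun y => 1 * (h s - ft q y s)) ν :=
      ((integrable_const _).sub (hft1 s)).const_mul 1
    have i2 : Integrable (fun y => 1 * (h s - ft q y s) ^ 2) ν := by
      refine ((integrable_const ((B + T * N q) ^ 2)).mono' ?_
        (Eventually.of_forall (hsq s hs))).const_mul 1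
      exact (hm.comp (measurable_const.prodMk measurable_id)).aestronglyMeasurable
    -- Jensen's inequality: the squared deviation from the cell mean is at most the mean squared
    -- deviation.
    have hcs := sq_integral_mul_le (μ := ν) (w := fun _ => (1 : ℝ)) (fun _ => zero_le_one)
      (integrable_const _) i1 i2
    simp only [one_mul, integral_const, hνr, smul_eq_mul, mul_one] at hcs
    rw [integral_sub (integrable_const _) (hft1 s), integral_const, hνr, smul_eq_mul] at hcs
    have e : h s - (P.d ^ 2)⁻¹ * ∫ y, ft q y s ∂ν =
        (P.d ^ 2)⁻¹ * (P.d ^ 2 * h s - ∫ y, ft q y s ∂ν) := by field_simp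
    rw [e, mul_pow]
    calc _ ≤ ((P.d ^ 2)⁻¹) ^ 2 * (P.d ^ 2 * ∫ y, (h s - ft q y s) ^ 2 ∂ν) := by gcongr
      _ = _ := by field_simp

end Cloud

end BubbleScreen

/-! ### Error estimates for the once integrated systems -/

namespace BubbleScreen

namespace Cloud

/-- Once integrated solutions `f` of the surface equation and `v` of the delay system, with a
regular version `ft` of the densities, on the time interval `[0, τ]`. -/
structure SolutionPair {μ : Measure E3} {a b D : ℝ} {n₀ : ℕ} {Q : Type} [Fintype Q]
    (P : Cloud μ a b D n₀ Q) (T c₀ κ θ ω τ : ℝ) (N B : Q → ℝ) (ft f : Q → E3 → ℝ → ℝ)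
    (v : Q → ℝ → ℝ) (U : E3 → ℝ → ℝ) : Prop where
  nonneg : 0 ≤ τ
  le : τ ≤ T
  density : IsDensity T N ft
  density_causal : ∀ q y, ∀ s ≤ 0, ft q y s = 0
  continuous : ∀ q, ∀ y ∈ P.cell q, Continuous (f q y)
  causal : ∀ q, ∀ y ∈ P.cell q, ∀ s ≤ 0, f q y s = 0
  continuous_delay : ∀ q, Continuous (v q)
  causal_delay : ∀ q, ∀ s ≤ 0, v q s = 0
  ae_eq : ∀ q, ∀ᵐ y ∂μ.restrict (P.cell q), ∀ s ∈ Icc 0 τ, ft q y s = f q y s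
  source : ∀ p, ∀ x ∈ P.cell p, ∀ t ∈ Icc 0 τ, |U (P.z p) t - U x t| ≤ P.d * B p
  surface : ∀ p, ∀ x ∈ P.cell p, ∀ t ∈ Icc 0 τ, ω ^ 2 * f p x t + secondPrimitive (f p x) t +
    κ * ∑ q, pattern θ (P.label p) (P.label q) * P.potential c₀ ft q x t = U x t
  delay : ∀ p, ∀ t ∈ Icc 0 τ, ω ^ 2 * v p t + secondPrimitive (v p) t +
    ∑ q, P.coupling κ θ p q * v q (t - dist (P.z p) (P.z q) / c₀) = U (P.z p) t

variable {μ : Measure E3} [IsFiniteMeasure μ] {a b D C₀ C₂ c₀ T θ κ ω : ℝ} {n₀ : ℕ}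

/-- The solutions of the surface equation vary little over the cells. -/
lemma exists_sum_integral_sub_sq_le (hσ : QuadraticGrowth μ C₀) (hC₀ : 0 ≤ C₀) (hb : 0 ≤ b)
    (hc₀ : 0 < c₀) (hT : 0 < T) (hD : 0 ≤ D) (hC₂ : 0 ≤ C₂) (hR : RieszBound μ C₂) (hω : 0 < ω)
    (κ θ : ℝ) :
    ∃ C : ℝ, 0 ≤ C ∧ ∀ (Q : Type) [Fintype Q] (P : Cloud μ a b D n₀ Q) (τ : ℝ) (N B : Q → ℝ)
      (ft f : Q → E3 → ℝ → ℝ) (v : Q → ℝ → ℝ) (U : E3 → ℝ → ℝ),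
      P.SolutionPair T c₀ κ θ ω τ N B ft f v U → ∀ x : Q → E3, (∀ p, x p ∈ P.cell p) →
      ∑ p, ∫ s in (0 : ℝ)..τ, (f p (P.z p) s - f p (x p) s) ^ 2 ≤
        C * (P.d ^ 2 * ∑ q, (N q ^ 2 + B q ^ 2)) := by
  obtain ⟨C₃, hC₃, hpot⟩ := exists_sum_potential_sub_le (a := a) (n₀ := n₀) hσ hC₀ hb hc₀ hT.le hD
    hC₂ hR θ
  -- Then T/(2α) = ω²/4, and 3/16 ≤ 1/2 gives the smallness condition.
  set α := 2 * T / ω ^ 2 with hαdef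
  have hα : 0 < α := by positivity
  refine ⟨Real.exp (2 * α * T) * (6 / ω ^ 4 * (T * (2 + 2 * κ ^ 2 * C₃))), by positivity,
    fun Q _ P τ N B ft f v U hS x hx => ?_⟩
  have hd := P.d_pos
  set e : Q → ℝ → ℝ := fun p s => f p (P.z p) s - f p (x p) s with he
  have hec : ∀ p, Continuous (e p) := fun p =>
    (hS.continuous p _ (P.z_mem p)).sub (hS.continuous p _ (hx p))
  have he0 : ∀ p, ∀ s ≤ 0, e p s = 0 := fun p s hs => by
    simp only [he, hS.causal p _ (P.z_mem p) s hs, hS.causal p _ (hx p) s hs, sub_zero]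
  have hsmall : 3 * (T / (2 * α)) ^ 2 + 3 * (0 : ℝ) ^ 2 ≤ ω ^ 4 / 2 := by
    have : T / (2 * α) = ω ^ 2 / 4 := by rw [hαdef]; field_simp; norm_num
    rw [this]
    have : 0 < ω ^ 4 := by positivity
    nlinarith
  -- No coupling is needed: the difference of the potentials at the two points is treated as a given
  -- residual, bounded by the accelerations.
  have key := sum_weightedSq_le_residual (k := fun _ _ : Q => 0) (c := fun _ _ => 0)
    (δ := fun _ _ => 0) hω le_rfl hα hsmall (fun _ _ => le_rfl) (fun _ _ => by simp)
    (fun _ => by simp) (fun _ => by simp) hS.nonneg hS.le hec he0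
  simp only [zero_mul, Finset.sum_const_zero, add_zero] at key
  have hRc : ∀ p, Continuous fun t => ω ^ 2 * e p t + secondPrimitive (e p) t := fun p =>
    (continuous_const.mul (hec p)).add (continuous_secondPrimitive (hec p))
  have hpt : ∀ t ∈ Icc 0 τ, ∑ p, (ω ^ 2 * e p t + secondPrimitive (e p) t) ^ 2 ≤
      (2 + 2 * κ ^ 2 * C₃) * (P.d ^ 2 * ∑ q, (N q ^ 2 + B q ^ 2)) := by
    intro t ht
    set X : Q → ℝ := fun p => ∑ q, pattern θ (P.label p) (P.label q) *
      (P.potential c₀ ft q (P.z p) t - P.potential c₀ ft q (x p) t) with hX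
    have hXs : ∑ p, X p ^ 2 ≤ C₃ * (P.d ^ 2 * ∑ q, N q ^ 2) := hpot Q P N ft hS.density t x hx
    have hres : ∀ p, ω ^ 2 * e p t + secondPrimitive (e p) t =
        (U (P.z p) t - U (x p) t) - κ * X p := by
      intro p
      have h1 := hS.surface p _ (P.z_mem p) t ht
      have h2 := hS.surface p _ (hx p) t ht
      have h3 : X p = ∑ q, pattern θ (P.label p) (P.label q) * P.potential c₀ ft q (P.z p) t -
          ∑ q, pattern θ (P.label p) (P.label q) * P.potential c₀ ft q (x p) t := by
        rw [hX, ← Finset.sum_sub_distrib]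
        exact Finset.sum_congr rfl fun q _ => by ring
      have h4 := secondPrimitive_sub (hS.continuous p _ (P.z_mem p)) (hS.continuous p _ (hx p)) t
      have h5 : secondPrimitive (e p) t = secondPrimitive (f p (P.z p)) t - secondPrimitive (f p (x p)) t :=
        h4
      rw [h5, h3, ← h1, ← h2]
      simp only [he]
      ring
    calc ∑ p, (ω ^ 2 * e p t + secondPrimitive (e p) t) ^ 2
        ≤ ∑ p, (2 * P.d ^ 2 * B p ^ 2 + 2 * κ ^ 2 * X p ^ 2) := by
          refine Finset.sum_le_sum fun p _ => ?_
          rw [hres]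
          have h1 := hS.source p _ (hx p) t ht
          have h2 : (U (P.z p) t - U (x p) t) ^ 2 ≤ (P.d * B p) ^ 2 := by
            rw [← sq_abs]; gcongr
          nlinarith [sq_nonneg (U (P.z p) t - U (x p) t + κ * X p)]
      _ ≤ 2 * P.d ^ 2 * ∑ q, B q ^ 2 + 2 * κ ^ 2 * (C₃ * (P.d ^ 2 * ∑ q, N q ^ 2)) := by
          rw [Finset.sum_add_distrib, ← Finset.mul_sum, ← Finset.mul_sum]
          gcongr
      _ ≤ _ := by
          rw [Finset.sum_add_distrib]
          have h1 : 0 ≤ ∑ q, N q ^ 2 := Finset.sum_nonneg fun _ _ => sq_nonneg _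
          have h2 : 0 ≤ ∑ q, B q ^ 2 := Finset.sum_nonneg fun _ _ => sq_nonneg _
          have h3 : 0 ≤ P.d ^ 2 * ∑ q, N q ^ 2 := by positivity
          have h4 : 0 ≤ κ ^ 2 * C₃ * (P.d ^ 2 * ∑ q, B q ^ 2) := by positivity
          nlinarith
  have hM : 0 ≤ (2 + 2 * κ ^ 2 * C₃) * (P.d ^ 2 * ∑ q, (N q ^ 2 + B q ^ 2)) := by
    have : 0 ≤ ∑ q, (N q ^ 2 + B q ^ 2) := Finset.sum_nonneg fun _ _ => by positivity
    positivity
  calc ∑ p, ∫ s in (0 : ℝ)..τ, e p s ^ 2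
      ≤ ∑ p, Real.exp (2 * α * T) * weightedSq α τ (e p) :=
        Finset.sum_le_sum fun p _ => integral_sq_le_weightedSq hα.le hS.nonneg hS.le (hec p)
    _ ≤ Real.exp (2 * α * T) * (6 / ω ^ 4 *
          (T * ((2 + 2 * κ ^ 2 * C₃) * (P.d ^ 2 * ∑ q, (N q ^ 2 + B q ^ 2))))) := by
        rw [← Finset.mul_sum]
        gcongr
        refine key.trans ?_
        gcongr
        exact sum_weightedSq_le_of_pointwise hα.le hS.nonneg hS.le hM hRc hpt
    _ = _ := by ring

/-- The solutions of the surface equation and of the delay system are close. -/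
theorem exists_sum_integral_error_le (hσ : QuadraticGrowth μ C₀) (hC₀ : 0 ≤ C₀) (ha : 0 < a)
    (hb : 0 ≤ b) (hc₀ : 0 < c₀) (hT : 0 < T) (hD : 0 ≤ D) (hC₂ : 0 ≤ C₂) (hR : RieszBound μ C₂)
    (hω : 0 < ω) (hκ : 0 ≤ κ) (θ : ℝ) :
    ∃ C : ℝ, 0 ≤ C ∧ ∀ (Q : Type) [Fintype Q] (P : Cloud μ a b D n₀ Q) (τ : ℝ) (N B : Q → ℝ)
      (ft f : Q → E3 → ℝ → ℝ) (v : Q → ℝ → ℝ) (U : E3 → ℝ → ℝ),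
      P.SolutionPair T c₀ κ θ ω τ N B ft f v U →
      ∑ p, ∫ s in (0 : ℝ)..τ, (f p (P.z p) s - v p s) ^ 2 ≤
        C * (P.d ^ 2 * ∑ q, (N q ^ 2 + B q ^ 2)) := by
  obtain ⟨C₄, hC₄, hdiff⟩ := exists_sum_integral_sub_sq_le (a := a) (n₀ := n₀) hσ hC₀ hb hc₀ hT hD
    hC₂ hR hω κ θ
  obtain ⟨C₅, hC₅, hpoint⟩ := exists_sum_point_sub_potential_le (a := a) (n₀ := n₀) hσ hC₀ ha hb hc₀
    hT.le hD hC₂ hR θ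
  set K := (1 + |θ|) * κ * (1 + 1 / a) with hK
  have hK0 : 0 ≤ K := by positivity
  -- Both small terms become at most 3ω⁴/16, together below ω⁴/2.
  set ε := ω ^ 2 / 4 with hε
  have hε0 : 0 < ε := by positivity
  obtain ⟨α, hα0, hα, hdec⟩ := exists_decay_rate (a := a) (n₀ := n₀) hσ hC₀ hb hD
    (c := (c₀ * (1 + 1 / a))⁻¹) (ε := ε / (K + 1)) (by positivity) (by positivity) (2 * T / ω ^ 2)
  refine ⟨Real.exp (2 * α * T) * (6 / ω ^ 4 * (2 * (T * (κ ^ 2 * C₅)) + 2 * (ε ^ 2 * C₄))),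
    by positivity, fun Q _ P τ N B ft f v U hS => ?_⟩
  have hd := P.d_pos
  set G := P.d ^ 2 * ∑ q, (N q ^ 2 + B q ^ 2) with hG
  have hG0 : 0 ≤ G := by
    have : 0 ≤ ∑ q, (N q ^ 2 + B q ^ 2) := Finset.sum_nonneg fun _ _ => by positivity
    positivity
  have hNG : P.d ^ 2 * ∑ q, N q ^ 2 ≤ G := by
    rw [hG]; gcongr with q _; nlinarith [sq_nonneg (B q)]
  have hτ := hS.nonneg
  set e : Q → ℝ → ℝ := fun p s => f p (P.z p) s - v p s with he
  have hfz : ∀ p, Continuous (f p (P.z p)) := fun p => hS.continuous p _ (P.z_mem p)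
  have hec : ∀ p, Continuous (e p) := fun p => (hfz p).sub (hS.continuous_delay p)
  have he0 : ∀ p, ∀ s ≤ 0, e p s = 0 := fun p s hs => by
    simp only [he, hS.causal p _ (P.z_mem p) s hs, hS.causal_delay p s hs, sub_zero]
  set k : Q → Q → ℝ := P.coupling κ θ with hk
  set δ : Q → Q → ℝ := fun p q => dist (P.z p) (P.z q) / c₀ with hδdef
  have hδ : ∀ p q, 0 ≤ δ p q := fun p q => by positivity
  set c : Q → Q → ℝ := fun p q => K * (P.d ^ 2 / P.H p q *
    Real.exp (-(α * ((c₀ * (1 + 1 / a))⁻¹ * P.H p q)))) with hc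
  have hkc : ∀ p q, |k p q| * Real.exp (-(α * δ p q)) ≤ c p q := fun p q =>
    P.abs_coupling_mul_exp_le ha hc₀ hκ hα.le p q
  have hrow : ∀ p, ∑ q, c p q ≤ ε := fun p => by
    simp only [hc, ← Finset.mul_sum]
    calc _ ≤ K * (ε / (K + 1)) := by gcongr; exact hdec Q P p
      _ ≤ ε := by
        rw [← mul_div_assoc, div_le_iff₀ (by positivity)]
        nlinarith
  have hcol : ∀ q, ∑ p, c p q ≤ ε := fun q => by
    refine le_trans (le_of_eq ?_) (hrow q)
    simp only [hc, P.H_comm _ q]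
  have hsmall : 3 * (T / (2 * α)) ^ 2 + 3 * ε ^ 2 ≤ ω ^ 4 / 2 := by
    have h1 : T / (2 * α) ≤ ω ^ 2 / 4 := by
      rw [div_le_div_iff₀ (by positivity) (by norm_num)]
      rw [div_le_iff₀ (by positivity)] at hα0
      linarith
    have h2 : (T / (2 * α)) ^ 2 ≤ (ω ^ 2 / 4) ^ 2 := by gcongr
    have : 0 < ω ^ 4 := by positivity
    rw [hε]
    nlinarith
  have key := sum_weightedSq_le_residual hω hε0.le hα hsmall hδ hkc hrow hcol hτ hS.le hec he0
  -- The surface equation contains cell integrals, the delay system centre values times d². Passing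
  -- from centre values to cell means costs g, and for means the comparison with point sources is
  -- available.
  set g : Q → ℝ → ℝ := fun q s => f q (P.z q) s - (P.d ^ 2)⁻¹ * ∫ y in P.cell q, ft q y s ∂μ with hg
  have hgc : ∀ q, Continuous (g q) := fun q => (hfz q).sub (continuous_const.mul
    (continuous_of_dominated (fun s => (hS.density.measurable_comp q measurable_const).aestronglyMeasurable)
      (fun s => Eventually.of_forall fun y => hS.density.bound q y s) (integrable_const _)
      (Eventually.of_forall fun y => hS.density.continuous q y)))
  have hg0 : ∀ q, ∀ s ≤ 0, g q s = 0 := fun q s hs => by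
    simp only [hg, hS.causal q _ (P.z_mem q) s hs, hS.density_causal q _ s hs, integral_zero,
      mul_zero, sub_zero]
  have hgsum : ∑ q, weightedSq α τ (g q) ≤ C₄ * G := by
    -- The cell mean is dominated by a single worst point, which reduces this to the oscillation of
    -- f over cells already estimated.
    choose x hx hpx hle using fun q =>
      P.exists_mem_integral_sq_sub_average_le hS.density q hτ (hfz q) (hS.ae_eq q)
    calc _ ≤ ∑ q, ∫ s in (0 : ℝ)..τ, g q s ^ 2 :=
          Finset.sum_le_sum fun q _ => weightedSq_le_integral hα.le hτ (hgc q)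
      _ ≤ ∑ q, ∫ s in (0 : ℝ)..τ, (f q (P.z q) s - f q (x q) s) ^ 2 := by
          refine Finset.sum_le_sum fun q _ => (hle q).trans (le_of_eq ?_)
          refine intervalIntegral.integral_congr fun s hs => ?_
          rw [uIcc_of_le hτ] at hs
          simp only [hpx q s hs]
      _ ≤ _ := hdiff Q P τ N B ft f v U hS x hx
  set R : Q → ℝ → ℝ := fun p t =>
    ω ^ 2 * e p t + secondPrimitive (e p) t + ∑ q, k p q * e q (t - δ p q) with hRdef
  set R₂ : Q → ℝ → ℝ := fun p t => ∑ q, k p q * g q (t - δ p q) with hR₂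
  have hcomp : ∀ (w : Q → ℝ → ℝ), (∀ q, Continuous (w q)) → ∀ p,
      Continuous fun t => ∑ q, k p q * w q (t - δ p q) := fun w hw p =>
    continuous_finsetSum _ fun q _ =>
      continuous_const.mul ((hw q).comp (continuous_id.sub continuous_const))
  have hRc : ∀ p, Continuous (R p) := fun p =>
    ((continuous_const.mul (hec p)).add (continuous_secondPrimitive (hec p))).add (hcomp e hec p)
  have hR₂c : ∀ p, Continuous (R₂ p) := hcomp g hgc
  have hdc : ∀ p, Continuous fun t => R p t - R₂ p t := fun p => (hRc p).sub (hR₂c p)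
  -- With g removed, the residual is exactly κ times the deviation of the point sources from the
  -- potentials; the incident terms cancel.
  have hR₁ : ∀ t ∈ Icc 0 τ, ∑ p, (R p t - R₂ p t) ^ 2 ≤ κ ^ 2 * C₅ * G := by
    intro t ht
    have hres : ∀ p, R p t - R₂ p t = κ * ∑ q, pattern θ (P.label p) (P.label q) *
        ((if P.block p = P.block q then 0 else
          ∫ y in P.cell q, (dist (P.z p) (P.z q))⁻¹ * ft q y (t - dist (P.z p) (P.z q) / c₀) ∂μ)
        - P.potential c₀ ft q (P.z p) t) := by
      intro p
      have h1 := hS.surface p _ (P.z_mem p) t ht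
      have h2 := hS.delay p t ht
      have h3 : secondPrimitive (e p) t = secondPrimitive (f p (P.z p)) t - secondPrimitive (v p) t :=
        secondPrimitive_sub (hfz p) (hS.continuous_delay p) t
      have h4 : ∑ q, k p q * e q (t - δ p q) - R₂ p t = ∑ q, κ * (pattern θ (P.label p) (P.label q) *
          (if P.block p = P.block q then 0 else
            ∫ y in P.cell q, (dist (P.z p) (P.z q))⁻¹ * ft q y (t - dist (P.z p) (P.z q) / c₀) ∂μ)) -
          ∑ q, k p q * v q (t - δ p q) := by
        simp only [hR₂, ← Finset.sum_sub_distrib]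
        refine Finset.sum_congr rfl fun q _ => ?_
        simp only [he, hg, hk, coupling, hδdef]
        split_ifs
        · ring
        · rw [integral_const_mul]
          field_simp
          ring
      have h5 : R p t - R₂ p t = ω ^ 2 * e p t + secondPrimitive (e p) t +
          (∑ q, k p q * e q (t - δ p q) - R₂ p t) := by simp only [hRdef]; ring
      rw [h5, h4, h3]
      simp only [mul_sub, Finset.sum_sub_distrib, he]
      simp only [Finset.mul_sum] at h1 ⊢
      simp only [hk, hδdef]
      linarith
    have := hpoint Q P N ft hS.density t
    simp_rw [hres, mul_pow κ]
    rw [← Finset.mul_sum, mul_assoc]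
    gcongr
    exact this.trans (by gcongr)
  have hsplit : ∑ p, weightedSq α τ (R p) ≤
      2 * ∑ p, weightedSq α τ (fun t => R p t - R₂ p t) + 2 * ∑ p, weightedSq α τ (R₂ p) := by
    rw [Finset.mul_sum, Finset.mul_sum, ← Finset.sum_add_distrib]
    refine Finset.sum_le_sum fun p _ => ?_
    have i1 := intervalIntegrable_weighted (α := α) (hdc p) 0 τ
    have i2 := intervalIntegrable_weighted (α := α) (hR₂c p) 0 τ
    simp only [weightedSq]
    rw [← intervalIntegral.integral_const_mul, ← intervalIntegral.integral_const_mul,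
      ← intervalIntegral.integral_add (i1.const_mul 2) (i2.const_mul 2)]
    refine intervalIntegral.integral_mono_on hτ (intervalIntegrable_weighted (hRc p) _ _)
      ((i1.const_mul 2).add (i2.const_mul 2)) fun t _ => ?_
    have : R p t ^ 2 ≤ 2 * (R p t - R₂ p t) ^ 2 + 2 * R₂ p t ^ 2 := by
      nlinarith [sq_nonneg (R p t - 2 * R₂ p t)]
    calc _ ≤ Real.exp (-(2 * α * t)) * (2 * (R p t - R₂ p t) ^ 2 + 2 * R₂ p t ^ 2) := by gcongr
      _ = _ := by ring
  have hs1 := sum_weightedSq_le_of_pointwise hα.le hτ hS.le (by positivity : 0 ≤ κ ^ 2 * C₅ * G)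
    hdc hR₁
  have hs2 : ∑ p, weightedSq α τ (R₂ p) ≤ ε ^ 2 * (C₄ * G) :=
    (sum_weightedSq_delay_le hε0.le hδ hkc hrow hcol hτ hgc hg0).trans (by gcongr)
  calc ∑ p, ∫ s in (0 : ℝ)..τ, e p s ^ 2
      ≤ ∑ p, Real.exp (2 * α * T) * weightedSq α τ (e p) :=
        Finset.sum_le_sum fun p _ => integral_sq_le_weightedSq hα.le hτ hS.le (hec p)
    _ ≤ Real.exp (2 * α * T) * (6 / ω ^ 4 * (2 * (T * (κ ^ 2 * C₅ * G)) + 2 * (ε ^ 2 * (C₄ * G)))) := by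
        rw [← Finset.mul_sum]
        gcongr
        refine key.trans ?_
        gcongr
        refine hsplit.trans ?_
        gcongr
    _ = _ := by ring

end Cloud

end BubbleScreen

/-! ### Causal functions of time and jointly measurable versions -/

namespace BubbleScreen

namespace CausalC2

variable {T s : ℝ} {f : ℝ → ℝ}

lemma hasDerivAt (h : CausalC2 T f) (hs : s < T) : HasDerivAt f (deriv f s) s :=
  (((h.1.contDiffAt (isOpen_Iio.mem_nhds hs)).differentiableAt two_ne_zero)).hasDerivAt

lemma contDiffOn_deriv (h : CausalC2 T f) : ContDiffOn ℝ 1 (deriv f) (Iio T) :=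
  h.1.deriv_of_isOpen isOpen_Iio (by norm_num)

lemma hasDerivAt_deriv (h : CausalC2 T f) (hs : s < T) :
    HasDerivAt (deriv f) (iteratedDeriv 2 f s) s := by
  rw [iteratedDeriv_succ, iteratedDeriv_one]
  exact ((h.contDiffOn_deriv.contDiffAt (isOpen_Iio.mem_nhds hs)).differentiableAt
    one_ne_zero).hasDerivAt

lemma continuousOn_deriv (h : CausalC2 T f) : ContinuousOn (deriv f) (Iio T) :=
  h.contDiffOn_deriv.continuousOn

lemma continuousOn_iteratedDeriv (h : CausalC2 T f) :
    ContinuousOn (iteratedDeriv 2 f) (Iio T) := by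
  rw [iteratedDeriv_succ, iteratedDeriv_one]
  exact h.contDiffOn_deriv.continuousOn_deriv_of_isOpen isOpen_Iio le_rfl

lemma continuousOn (h : CausalC2 T f) : ContinuousOn f (Iio T) := h.1.continuousOn

/-- Continuity reaches the endpoint 0, where the one-sided information is not an open condition;
derivatives therefore also vanish at time 0. -/
lemma eq_zero_of_eqOn_neg {g : ℝ → ℝ} (hT : 0 < T) (hg : ContinuousOn g (Iio T))
    (h0 : ∀ s < 0, g s = 0) (hs : s ≤ 0) : g s = 0 := by
  rcases hs.lt_or_eq with hs | rfl
  · exact h0 s hs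
  · have h1 : Tendsto g (𝓝[<] 0) (𝓝 (g 0)) :=
      ((hg 0 hT).continuousAt (isOpen_Iio.mem_nhds hT)).tendsto.mono_left nhdsWithin_le_nhds
    have h2 : Tendsto g (𝓝[<] 0) (𝓝 0) := tendsto_const_nhds.congr' (by
      filter_upwards [self_mem_nhdsWithin] with s hs using (h0 s hs).symm)
    exact tendsto_nhds_unique h1 h2

lemma deriv_eq_zero_of_neg {g : ℝ → ℝ} (h0 : ∀ s < 0, g s = 0) (hs : s < 0) : deriv g s = 0 := by
  have : g =ᶠ[𝓝 s] fun _ => 0 := by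
    filter_upwards [isOpen_Iio.mem_nhds hs] with r hr using h0 r hr
  rw [this.deriv_eq, deriv_const]

lemma deriv_eq_zero (h : CausalC2 T f) (hT : 0 < T) (hs : s ≤ 0) : deriv f s = 0 :=
  eq_zero_of_eqOn_neg hT h.continuousOn_deriv
    (fun _ => deriv_eq_zero_of_neg fun r hr => h.2 r hr.le) hs

lemma iteratedDeriv_eq_zero (h : CausalC2 T f) (hT : 0 < T) (hs : s ≤ 0) :
    iteratedDeriv 2 f s = 0 := by
  refine eq_zero_of_eqOn_neg hT h.continuousOn_iteratedDeriv (fun r hr => ?_) hs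
  rw [iteratedDeriv_succ, iteratedDeriv_one]
  exact deriv_eq_zero_of_neg (fun _ hr => h.deriv_eq_zero hT hr.le) hr

lemma uIcc_subset_Iio (hT : 0 < T) (hs : s < T) : uIcc 0 s ⊆ Iio T := fun r hr => by
  have := hr.2
  exact lt_of_le_of_lt this (max_lt hT hs)

lemma intervalIntegrable {g : ℝ → ℝ} (hT : 0 < T) (hg : ContinuousOn g (Iio T)) (hs : s < T) :
    IntervalIntegrable g volume 0 s :=
  (hg.mono (uIcc_subset_Iio hT hs)).intervalIntegrable

lemma integral_iteratedDeriv (h : CausalC2 T f) (hT : 0 < T) (hs : s < T) :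
    ∫ r in (0 : ℝ)..s, iteratedDeriv 2 f r = deriv f s := by
  rw [intervalIntegral.integral_eq_sub_of_hasDerivAt
    (fun r hr => h.hasDerivAt_deriv (uIcc_subset_Iio hT hs hr))
    (intervalIntegrable hT h.continuousOn_iteratedDeriv hs), h.deriv_eq_zero hT le_rfl, sub_zero]

lemma integral_deriv (h : CausalC2 T f) (hT : 0 < T) (hs : s < T) :
    ∫ r in (0 : ℝ)..s, deriv f r = f s := by
  rw [intervalIntegral.integral_eq_sub_of_hasDerivAt
    (fun r hr => h.hasDerivAt (uIcc_subset_Iio hT hs hr))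
    (intervalIntegrable hT h.continuousOn_deriv hs), h.2 0 le_rfl, sub_zero]

/-- Freezing time after τ < T turns functions given on a half line into globally continuous ones, as
the weighted estimates require, without changing them on [0, τ]. -/
lemma continuous_comp_min {g : ℝ → ℝ} {τ : ℝ} (hg : ContinuousOn g (Iio T)) (hτ : τ < T) :
    Continuous fun s => g (min s τ) :=
  hg.comp_continuous (by fun_prop) fun _ => lt_of_le_of_lt (min_le_right _ _) hτ

lemma secondPrimitive_deriv (h : CausalC2 T f) (hT : 0 < T) {τ : ℝ} (hτ : τ < T)
    (hs : s ∈ Icc 0 τ) :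
    secondPrimitive (fun r => deriv f (min r τ)) s = ∫ r in (0 : ℝ)..s, f r := by
  unfold secondPrimitive
  refine intervalIntegral.integral_congr fun r hr => ?_
  rw [uIcc_of_le hs.1] at hr
  have hrτ := hr.2.trans hs.2
  simp only
  rw [← h.integral_deriv hT (hrτ.trans_lt hτ)]
  refine intervalIntegral.integral_congr fun w hw => ?_
  rw [uIcc_of_le hr.1] at hw
  simp only [min_eq_left (hw.2.trans hrτ)]

lemma abs_deriv_le (h : CausalC2 T f) (hT : 0 < T) {N : ℝ}
    (hN : ∀ r ≤ s, |iteratedDeriv 2 f r| ≤ N) (hs0 : 0 ≤ s) (hs : s < T) : |deriv f s| ≤ T * N := by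
  have hN0 : 0 ≤ N := (abs_nonneg _).trans (hN s le_rfl)
  rw [← h.integral_iteratedDeriv hT hs, ← Real.norm_eq_abs]
  refine (intervalIntegral.norm_integral_le_of_norm_le_const (C := N) fun r hr => ?_).trans ?_
  · rw [uIoc_of_le hs0] at hr
    exact hN r hr.2
  · rw [sub_zero, abs_of_nonneg hs0, mul_comm]
    gcongr

lemma abs_le (h : CausalC2 T f) (hT : 0 < T) {N : ℝ}
    (hN : ∀ r ≤ s, |iteratedDeriv 2 f r| ≤ N) (hs0 : 0 ≤ s) (hs : s < T) : |f s| ≤ T ^ 2 * N := by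
  have hN0 : 0 ≤ N := (abs_nonneg _).trans (hN s le_rfl)
  rw [← h.integral_deriv hT hs, ← Real.norm_eq_abs]
  refine (intervalIntegral.norm_integral_le_of_norm_le_const (C := T * N) fun r hr => ?_).trans ?_
  · rw [uIoc_of_le hs0] at hr
    exact h.abs_deriv_le hT (fun w hw => hN w (hw.trans hr.2)) hr.1.le (hr.2.trans_lt hs)
  · rw [sub_zero, abs_of_nonneg hs0, sq, mul_comm (T * N), mul_assoc]
    gcongr

end CausalC2

/-- A jointly measurable version of a family of continuous functions of time. -/
lemma exists_measurable_version {ν : Measure E3} {A : Set E3} {T τ N : ℝ} (hτ : τ < T)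
    (hN : 0 ≤ N) {G : E3 → ℝ → ℝ} (hc : ∀ y ∈ A, ContinuousOn (G y) (Iio T))
    (h0 : ∀ y ∈ A, ∀ s ≤ 0, G y s = 0)
    (hm : ∀ s < T, AEStronglyMeasurable (fun y => G y s) ν)
    (hb : ∀ᵐ y ∂ν, y ∈ A ∧ ∀ s < T, |G y s| ≤ N) :
    ∃ H : E3 → ℝ → ℝ, Measurable (Function.uncurry H) ∧ (∀ y, Continuous (H y)) ∧
      (∀ y s, |H y s| ≤ N) ∧ (∀ y, ∀ s ≤ 0, H y s = 0) ∧
      ∀ᵐ y ∂ν, ∀ s ≤ τ, H y s = G y s := by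
  classical
  -- Measurability at a fixed time holds only up to null sets; restricting to rational times keeps
  -- the exceptional set null, and continuity in time recovers the rest.
  have hrat : ∀ᵐ y ∂ν, ∀ r : ℚ, ∀ hr : (r : ℝ) < T, G y r = (hm r hr).mk _ y := by
    rw [ae_all_iff]
    intro r
    by_cases hr : (r : ℝ) < T
    · filter_upwards [(hm r hr).ae_eq_mk] with y hy _ using hy
    · exact Eventually.of_forall fun y hy => absurd hy hr
  have hgood := hb.and hrat
  set Z := toMeasurable ν {y | ¬ ((y ∈ A ∧ ∀ s < T, |G y s| ≤ N) ∧
    ∀ r : ℚ, ∀ hr : (r : ℝ) < T, G y r = (hm r hr).mk _ y)} with hZ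
  have hZm : MeasurableSet Z := measurableSet_toMeasurable _ _
  have hZ0 : ν Z = 0 := by rw [hZ, measure_toMeasurable]; exact hgood
  have hZc : ∀ y, y ∉ Z → (y ∈ A ∧ ∀ s < T, |G y s| ≤ N) ∧
      ∀ r : ℚ, ∀ hr : (r : ℝ) < T, G y r = (hm r hr).mk _ y := fun y hy => by
    by_contra hcon
    exact hy (subset_toMeasurable _ _ hcon)
  set H : E3 → ℝ → ℝ := fun y s => Zᶜ.indicator (fun y => G y (min s τ)) y with hH
  have hHin : ∀ y ∉ Z, ∀ s, H y s = G y (min s τ) := fun y hy s => indicator_of_mem hy _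
  have hHout : ∀ y ∈ Z, ∀ s, H y s = 0 := fun y hy s => indicator_of_notMem (not_not.2 hy) _
  have hcont : ∀ y, Continuous (H y) := fun y => by
    by_cases hy : y ∈ Z
    · rw [show H y = fun _ => 0 from funext (hHout y hy)]; exact continuous_const
    · rw [show H y = fun s => G y (min s τ) from funext (hHin y hy)]
      exact CausalC2.continuous_comp_min (hc y (hZc y hy).1.1) hτ
  have hmeasrat : ∀ r : ℚ, (r : ℝ) < T → Measurable (Zᶜ.indicator fun y => G y r) := fun r hr => by
    have e : (Zᶜ.indicator fun y => G y r) = Zᶜ.indicator ((hm r hr).mk _) := by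
      ext y
      by_cases hy : y ∈ Z
      · rw [indicator_of_notMem (not_not.2 hy), indicator_of_notMem (not_not.2 hy)]
      · rw [indicator_of_mem hy, indicator_of_mem hy, (hZc y hy).2 r hr]
    rw [e]
    exact (hm r hr).stronglyMeasurable_mk.measurable.indicator hZm.compl
  have hmeas : ∀ s, Measurable fun y => H y s := fun s => by
    have hs : min s τ < T := lt_of_le_of_lt (min_le_right _ _) hτ
    -- An approximation from below keeps the rational times before T.
    obtain ⟨u, -, hu, hlim⟩ := Real.exists_seq_rat_strictMono_tendsto (min s τ)
    refine measurable_of_tendsto_metrizable (fun n => hmeasrat (u n) ((hu n).trans hs)) ?_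
    rw [tendsto_pi_nhds]
    intro y
    by_cases hy : y ∈ Z
    · have hy' : y ∉ Zᶜ := not_not.2 hy
      simp only [hHout y hy, indicator_of_notMem hy']
      exact tendsto_const_nhds
    · rw [hHin y hy]
      have hc' := ((hc y (hZc y hy).1.1) _ hs).continuousAt (isOpen_Iio.mem_nhds hs)
      refine (hc'.tendsto.comp hlim).congr fun n => ?_
      rw [indicator_of_mem (show y ∈ Zᶜ from hy)]
      rfl
  refine ⟨H, ?_, hcont, fun y s => ?_, fun y s hs => ?_, ?_⟩
  · have := measurable_uncurry_of_continuous_of_measurable (u := fun s y => H y s)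
      (fun y => hcont y) hmeas
    exact this.comp measurable_swap
  · by_cases hy : y ∈ Z
    · rw [hHout y hy, abs_zero]; exact hN
    · rw [hHin y hy]
      exact (hZc y hy).1.2 _ (lt_of_le_of_lt (min_le_right _ _) hτ)
  · by_cases hy : y ∈ Z
    · exact hHout y hy s
    · rw [hHin y hy]
      exact h0 y (hZc y hy).1.1 _ ((min_le_left _ _).trans hs)
  · filter_upwards [measure_eq_zero_iff_ae_notMem.1 hZ0] with y hy s hs
    rw [hHin y hy, min_eq_left hs]

/-- Almost everywhere bounds at almost all times are uniform in time, by continuity. -/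
lemma ae_forall_abs_le {ν : Measure E3} {A : Set E3} {T N : ℝ} (hN : 0 ≤ N)
    {G : E3 → ℝ → ℝ} (hc : ∀ y ∈ A, ContinuousOn (G y) (Iio T))
    (h0 : ∀ y ∈ A, ∀ s ≤ 0, G y s = 0) (hA : ∀ᵐ y ∂ν, y ∈ A)
    (hb : ∀ᵐ s ∂volume.restrict (Ioo 0 T), ∀ᵐ y ∂ν, |G y s| ≤ N) :
    ∀ᵐ y ∂ν, y ∈ A ∧ ∀ s < T, |G y s| ≤ N := by
  -- D has full measure, hence is dense; a countable dense subset of it yields one exceptional null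
  -- set for all times.
  set D := {s ∈ Ioo 0 T | ∀ᵐ y ∂ν, |G y s| ≤ N} with hD
  obtain ⟨c, hcD, hcc, hDc⟩ := (TopologicalSpace.IsSeparable.of_separableSpace D).exists_countable_dense_subset
  have hdense : Ioo 0 T ⊆ closure D := by
    intro s hs
    rw [mem_closure_iff]
    intro O hO hsO
    by_contra hcon
    rw [not_nonempty_iff_eq_empty] at hcon
    have hpos : 0 < volume (O ∩ Ioo 0 T) := (hO.inter isOpen_Ioo).measure_pos volume ⟨s, hsO, hs⟩
    have : volume (O ∩ Ioo 0 T) ≤ 0 := by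
      have hz : volume.restrict (Ioo 0 T) {s | ¬ ∀ᵐ y ∂ν, |G y s| ≤ N} = 0 := hb
      rw [Measure.restrict_apply' measurableSet_Ioo] at hz
      rw [← hz]
      refine measure_mono fun r hr => ⟨fun hr' => ?_, hr.2⟩
      have : r ∈ O ∩ D := ⟨hr.1, hr.2, hr'⟩
      rw [hcon] at this
      exact this
    exact absurd hpos (not_lt.2 this)
  have hall : ∀ᵐ y ∂ν, ∀ s ∈ c, |G y s| ≤ N :=
    (ae_ball_iff hcc).2 fun s hs => (hcD hs).2
  filter_upwards [hA, hall] with y hy hyc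
  refine ⟨hy, fun s hs => ?_⟩
  rcases le_or_gt s 0 with h | h
  · rw [h0 y hy s h, abs_zero]; exact hN
  · have hcl : s ∈ closure c := by
      have := closure_minimal hDc isClosed_closure (hdense ⟨h, hs⟩)
      exact this
    have hcont := ((hc y hy) s hs).continuousAt (isOpen_Iio.mem_nhds hs)
    refine le_of_tendsto_of_frequently (hcont.abs.tendsto) ?_
    rw [mem_closure_iff_frequently] at hcl
    exact hcl.mono fun r hr => hyc r hr

end BubbleScreen

/-! ### Integrating the two systems once in time -/

namespace BubbleScreen

namespace Cloud

/-- Solutions `F` of the surface equation and `Y` of the delay system for the cells of a cloud,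
with a jointly measurable version `A` of the second time derivative of `F`, up to the time `τ`. -/
structure AccelPair {μ : Measure E3} {a b D : ℝ} {n₀ : ℕ} {Q : Type} [Fintype Q]
    (P : Cloud μ a b D n₀ Q) (T c₀ κ θ ω τ : ℝ) (N : Q → ℝ) (A F : Q → E3 → ℝ → ℝ)
    (Y : Q → ℝ → ℝ) (u : E3 → ℝ → ℝ) : Prop where
  pos : 0 < τ
  lt : τ < T
  nonneg : ∀ q, 0 ≤ N q
  meas : ∀ q, Measurable (Function.uncurry (A q))
  continuous : ∀ q y, Continuous (A q y)
  bound : ∀ q y s, |A q y s| ≤ N q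
  zero : ∀ q y, ∀ s ≤ 0, A q y s = 0
  ae_eq : ∀ q, ∀ᵐ y ∂μ.restrict (P.cell q), ∀ s ≤ τ, A q y s = iteratedDeriv 2 (F q y) s
  causal : ∀ q, ∀ y ∈ P.cell q, CausalC2 T (F q y)
  causal_delay : ∀ q, CausalC2 T (Y q)
  surface : ∀ p, ∀ x ∈ P.cell p, ∀ s ∈ Ioc 0 τ, ω ^ 2 * iteratedDeriv 2 (F p x) s + F p x s +
    κ * ∑ q, pattern θ (P.label p) (P.label q) * P.potential c₀ A q x s = iteratedDeriv 2 (u x) s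
  delay : ∀ p, ∀ s ∈ Ioc 0 τ, ω ^ 2 * iteratedDeriv 2 (Y p) s + Y p s +
    ∑ q, P.coupling κ θ p q * iteratedDeriv 2 (Y q) (s - dist (P.z p) (P.z q) / c₀) =
      iteratedDeriv 2 (u (P.z p)) s

/-- The time integral of a density, frozen after the time `τ`. -/
noncomputable def frozenPrimitive {Q : Type} (τ : ℝ) (A : Q → E3 → ℝ → ℝ) (q : Q) (y : E3)
    (s : ℝ) : ℝ := ∫ r in (0 : ℝ)..min s τ, A q y r

variable {μ : Measure E3} [IsFiniteMeasure μ] {a b D C₀ C₂ c₀ T θ κ ω τ : ℝ} {n₀ : ℕ} {Q : Type}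
  [Fintype Q] {P : Cloud μ a b D n₀ Q} {N : Q → ℝ} {A F : Q → E3 → ℝ → ℝ} {Y : Q → ℝ → ℝ}
  {u : E3 → ℝ → ℝ}

namespace AccelPair

omit [IsFiniteMeasure μ]

lemma frozenPrimitive_of_nonpos (h : P.AccelPair T c₀ κ θ ω τ N A F Y u) (q : Q) (y : E3) {s : ℝ}
    (hs : s ≤ 0) : frozenPrimitive τ A q y s = 0 := by
  have hm : min s τ ≤ 0 := (min_le_left _ _).trans hs
  rw [frozenPrimitive, intervalIntegral.integral_congr (g := fun _ => (0 : ℝ)),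
    intervalIntegral.integral_zero]
  intro r hr
  rw [uIcc_of_ge hm] at hr
  exact h.zero q y r hr.2

lemma integral_sub_le (h : P.AccelPair T c₀ κ θ ω τ N A F Y u) (q : Q) (y : E3) (s s' : ℝ) :
    |∫ r in s'..s, A q y r| ≤ N q * |s - s'| := by
  rw [← Real.norm_eq_abs]
  exact intervalIntegral.norm_integral_le_of_norm_le_const fun r _ => h.bound q y r

/-- One integration turns the bound N on the acceleration into a Lipschitz constant in time, and
causality gives the bound T N. -/
lemma isDensity (h : P.AccelPair T c₀ κ θ ω τ N A F Y u) :
    IsDensity T N (frozenPrimitive τ A) := by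
  have hlip : ∀ q y s s', |frozenPrimitive τ A q y s - frozenPrimitive τ A q y s'| ≤
      N q * |s - s'| := fun q y s s' => by
    have hi := fun x z => (h.continuous q y).intervalIntegrable (μ := volume) x z
    rw [frozenPrimitive, frozenPrimitive, intervalIntegral.integral_interval_sub_left (hi _ _) (hi _ _)]
    refine (h.integral_sub_le q y _ _).trans ?_
    exact mul_le_mul_of_nonneg_left ((abs_min_sub_min_le_max s τ s' τ).trans
      (by rw [sub_self, abs_zero, max_eq_left (abs_nonneg _)])) (h.nonneg q)
  refine ⟨h.nonneg, fun q => ?_, fun q y s => ?_, hlip⟩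
  · have hcont : ∀ y, Continuous fun s => frozenPrimitive τ A q y s := fun y =>
      (continuous_primitive (h.continuous q y)).comp (by fun_prop)
    have hmeas : ∀ s, Measurable fun y => frozenPrimitive τ A q y s := fun s => by
      have hsm : StronglyMeasurable (Function.uncurry (A q)) := (h.meas q).stronglyMeasurable
      rcases le_total 0 (min s τ) with hs | hs
      · simp only [frozenPrimitive, intervalIntegral.integral_of_le hs]
        exact (hsm.integral_prod_right (ν := volume.restrict (Ioc 0 (min s τ)))).measurable
      · simp only [frozenPrimitive, intervalIntegral.integral_of_ge hs]
        exact (hsm.integral_prod_right (ν := volume.restrict (Ioc (min s τ) 0))).measurable.neg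
    exact (measurable_uncurry_of_continuous_of_measurable
      (u := fun s y => frozenPrimitive τ A q y s) hcont hmeas).comp measurable_swap
  · have hN := h.nonneg q
    have hTpos : 0 < T := h.pos.trans h.lt
    rcases le_total s 0 with hs | hs
    · rw [h.frozenPrimitive_of_nonpos q y hs, abs_zero]; positivity
    · refine (h.integral_sub_le q y _ _).trans ?_
      rw [sub_zero, abs_of_nonneg (le_min hs h.pos.le), mul_comm]
      gcongr
      exact (min_le_right _ _).trans h.lt.le

lemma frozenPrimitive_eq_delayed (h : P.AccelPair T c₀ κ θ ω τ N A F Y u) (q : Q) (y : E3)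
    {t δ : ℝ} (hδ : 0 ≤ δ) (ht : t ∈ Icc 0 τ) :
    ∫ s in (0 : ℝ)..t, A q y (s - δ) = frozenPrimitive τ A q y (t - δ) := by
  have hi := fun x z => (h.continuous q y).intervalIntegrable (μ := volume) x z
  have hz : ∫ r in (0 - δ)..0, A q y r = 0 := by
    rw [intervalIntegral.integral_congr (g := fun _ => (0 : ℝ)), intervalIntegral.integral_zero]
    intro r hr
    rw [uIcc_of_le (by linarith)] at hr
    exact h.zero q y r hr.2
  rw [intervalIntegral.integral_comp_sub_right (fun r => A q y r) δ,
    ← intervalIntegral.integral_add_adjacent_intervals (hi _ 0) (hi 0 _), hz, zero_add,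
    frozenPrimitive, min_eq_left (by linarith [ht.2])]

end AccelPair

/-- Fubini; for each y the delay is constant in time, and causality removes the part of the shifted
interval before time 0. -/
lemma AccelPair.integral_potential (h : P.AccelPair T c₀ κ θ ω τ N A F Y u)
    (hσ : QuadraticGrowth μ C₀) (hC₀ : 0 ≤ C₀) (hb : 0 ≤ b) (hc₀ : 0 < c₀) {p : Q} (q : Q) {x : E3}
    (hx : x ∈ P.cell p) {t : ℝ} (ht : t ∈ Icc 0 τ) :
    IntervalIntegrable (P.potential c₀ A q x) volume 0 t ∧
    ∫ s in (0 : ℝ)..t, P.potential c₀ A q x s = P.potential c₀ (frozenPrimitive τ A) q x t := by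
  have hdist := (P.setIntegral_inv_dist_cell_le hσ hC₀ hb (q := q) hx).1
  have hmeas : Measurable fun z : ℝ × E3 => A q z.2 (z.1 - dist x z.2 / c₀) :=
    (h.meas q).comp (measurable_snd.prodMk
      (measurable_fst.sub ((measurable_const.dist measurable_snd).div_const c₀)))
  have hprod : Integrable (Function.uncurry fun (s : ℝ) (y : E3) =>
      (dist x y)⁻¹ * A q y (s - dist x y / c₀))
      ((volume.restrict (Ioc 0 t)).prod (μ.restrict (P.cell q))) :=
    Integrable.mul_bdd (c := N q) (Integrable.comp_snd hdist _) hmeas.aestronglyMeasurable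
      (Eventually.of_forall fun z => h.bound q _ _)
  refine ⟨?_, ?_⟩
  · rw [intervalIntegrable_iff_integrableOn_Ioc_of_le ht.1]
    exact hprod.integral_prod_left
  · simp only [potential]
    rw [intervalIntegral.integral_of_le ht.1, integral_integral_swap hprod]
    refine integral_congr_ae (Eventually.of_forall fun y => ?_)
    simp only
    rw [integral_const_mul, ← intervalIntegral.integral_of_le ht.1,
      h.frozenPrimitive_eq_delayed q y (by positivity) ht]

/-- The once integrated equations. -/
lemma AccelPair.solutionPair (h : P.AccelPair T c₀ κ θ ω τ N A F Y u)
    (hσ : QuadraticGrowth μ C₀) (hC₀ : 0 ≤ C₀) (hb : 0 ≤ b) (hc₀ : 0 < c₀) {B : Q → ℝ}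
    (hB : ∀ p, ∀ x ∈ P.cell p, ∀ t ∈ Icc 0 τ,
      |(∫ s in (0 : ℝ)..t, iteratedDeriv 2 (u (P.z p)) s) - ∫ s in (0 : ℝ)..t, iteratedDeriv 2 (u x) s| ≤
        P.d * B p) :
    P.SolutionPair T c₀ κ θ ω τ N B (frozenPrimitive τ A) (fun q y s => deriv (F q y) (min s τ))
      (fun q s => deriv (Y q) (min s τ)) (fun x t => ∫ s in (0 : ℝ)..t, iteratedDeriv 2 (u x) s) := by
  have hT : 0 < T := h.pos.trans h.lt
  have hmin : ∀ s : ℝ, s ≤ 0 → min s τ ≤ 0 := fun s hs => (min_le_left _ _).trans hs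
  have hci : ∀ {g : ℝ → ℝ} {t : ℝ}, ContinuousOn g (Iio T) → t ∈ Icc 0 τ →
      IntervalIntegrable g volume 0 t := fun hg ht =>
    CausalC2.intervalIntegrable hT hg (ht.2.trans_lt h.lt)
  refine ⟨h.pos.le, h.lt.le, h.isDensity, fun q y s hs => h.frozenPrimitive_of_nonpos q y hs,
    fun q y hy => CausalC2.continuous_comp_min (h.causal q y hy).continuousOn_deriv h.lt,
    fun q y hy s hs => (h.causal q y hy).deriv_eq_zero hT (hmin s hs),
    fun q => CausalC2.continuous_comp_min (h.causal_delay q).continuousOn_deriv h.lt,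
    fun q s hs => (h.causal_delay q).deriv_eq_zero hT (hmin s hs), fun q => ?_, hB,
    fun p x hx t ht => ?_, fun p t ht => ?_⟩
  · filter_upwards [h.ae_eq q, ae_restrict_mem (P.measurable_cell q)] with y hy hyq s hs
    rw [frozenPrimitive, min_eq_left hs.2, ← (h.causal q y hyq).integral_iteratedDeriv hT
      (hs.2.trans_lt h.lt)]
    refine intervalIntegral.integral_congr fun r hr => ?_
    rw [uIcc_of_le hs.1] at hr
    exact hy r (hr.2.trans hs.2)
  · have hF := h.causal p x hx
    have htT := ht.2.trans_lt h.lt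
    rw [min_eq_left ht.2, hF.secondPrimitive_deriv hT h.lt ht, ← hF.integral_iteratedDeriv hT htT,
      Finset.mul_sum]
    simp_rw [← (h.integral_potential hσ hC₀ hb hc₀ _ hx ht).2]
    have i1 := hci hF.continuousOn_iteratedDeriv ht
    have i2 := hci hF.continuousOn ht
    have i3 : ∀ q ∈ (Finset.univ : Finset Q), IntervalIntegrable (fun s =>
        κ * (pattern θ (P.label p) (P.label q) * P.potential c₀ A q x s)) volume 0 t := fun q _ =>
      ((h.integral_potential hσ hC₀ hb hc₀ q hx ht).1.const_mul _).const_mul _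
    simp_rw [← intervalIntegral.integral_const_mul]
    rw [← intervalIntegral.integral_finsetSum i3, ← intervalIntegral.integral_add (i1.const_mul _) i2,
      ← intervalIntegral.integral_add ((i1.const_mul _).add i2) (by
        have := IntervalIntegrable.sum _ i3
        rwa [Finset.sum_fn] at this),
      intervalIntegral.integral_of_le ht.1, intervalIntegral.integral_of_le ht.1]
    refine setIntegral_congr_fun measurableSet_Ioc fun s hs => ?_
    have := h.surface p x hx s ⟨hs.1, hs.2.trans ht.2⟩
    simp only [Finset.mul_sum] at this
    exact this
  · have hY := h.causal_delay p
    have htT := ht.2.trans_lt h.lt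
    have hdel : ∀ q (δ : ℝ), 0 ≤ δ →
        IntervalIntegrable (fun s => iteratedDeriv 2 (Y q) (s - δ)) volume 0 t ∧
        ∫ s in (0 : ℝ)..t, iteratedDeriv 2 (Y q) (s - δ) = deriv (Y q) (min (t - δ) τ) := by
      intro q δ hδ
      have hsub : uIcc 0 t ⊆ {s | s - δ < T} := fun s hs => by
        rw [uIcc_of_le ht.1] at hs
        show s - δ < T
        linarith [hs.2]
      have hii : IntervalIntegrable (fun s => iteratedDeriv 2 (Y q) (s - δ)) volume 0 t :=
        ((h.causal_delay q).continuousOn_iteratedDeriv.comp (by fun_prop) hsub).intervalIntegrable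
      refine ⟨hii, ?_⟩
      rw [intervalIntegral.integral_eq_sub_of_hasDerivAt (f := fun s => deriv (Y q) (s - δ))
        (fun s hs => ((h.causal_delay q).hasDerivAt_deriv (hsub hs)).comp_sub_const s δ) hii,
        min_eq_left (by linarith [ht.2]),
        (h.causal_delay q).deriv_eq_zero hT (s := 0 - δ) (by linarith), sub_zero]
    rw [min_eq_left ht.2, hY.secondPrimitive_deriv hT h.lt ht, ← hY.integral_iteratedDeriv hT htT]
    simp_rw [← (hdel _ (dist (P.z p) (P.z _) / c₀) (by positivity)).2]
    have i1 := hci hY.continuousOn_iteratedDeriv ht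
    have i2 := hci hY.continuousOn ht
    have i3 : ∀ q ∈ (Finset.univ : Finset Q), IntervalIntegrable (fun s =>
        P.coupling κ θ p q * iteratedDeriv 2 (Y q) (s - dist (P.z p) (P.z q) / c₀)) volume 0 t :=
      fun q _ => (hdel q _ (by positivity)).1.const_mul _
    simp_rw [← intervalIntegral.integral_const_mul]
    rw [← intervalIntegral.integral_finsetSum i3, ← intervalIntegral.integral_add (i1.const_mul _) i2,
      ← intervalIntegral.integral_add ((i1.const_mul _).add i2) (by
        have := IntervalIntegrable.sum _ i3
        rwa [Finset.sum_fn] at this),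
      intervalIntegral.integral_of_le ht.1, intervalIntegral.integral_of_le ht.1]
    refine setIntegral_congr_fun measurableSet_Ioc fun s hs => ?_
    exact h.delay p s ⟨hs.1, hs.2.trans ht.2⟩

/-- The source is controlled by the accelerations. -/
lemma exists_abs_source_le (hσ : QuadraticGrowth μ C₀) (hC₀ : 0 ≤ C₀) (hb : 0 ≤ b) (hκ : 0 ≤ κ)
    (T c₀ θ ω : ℝ) :
    ∃ C : ℝ, 0 ≤ C ∧ ∀ (Q : Type) [Fintype Q] (P : Cloud μ a b D n₀ Q) (τ : ℝ) (N : Q → ℝ)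
      (A F : Q → E3 → ℝ → ℝ) (Y : Q → ℝ → ℝ) (u : E3 → ℝ → ℝ), P.AccelPair T c₀ κ θ ω τ N A F Y u →
      ∀ p, ∀ x ∈ P.cell p, (∀ s ≤ τ, A p x s = iteratedDeriv 2 (F p x) s) → ∀ s ∈ Ioc 0 τ,
        |iteratedDeriv 2 (u x) s| ≤ C * (N p + ∑ q, P.W p q * N q) := by
  set KP := 2 * (1 + 2 * b) + 16 * C₀ * (1 + 2 * b) ^ 3
  refine ⟨ω ^ 2 + T ^ 2 + κ * ((1 + |θ|) * KP), by positivity,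
    fun Q _ P τ N A F Y u h p x hx hA s hs => ?_⟩
  have hd := P.d_pos
  have hT : 0 < T := h.pos.trans h.lt
  have hF := h.causal p x hx
  have hsT : s < T := hs.2.trans_lt h.lt
  have hN : ∀ r ≤ s, |iteratedDeriv 2 (F p x) r| ≤ N p := fun r hr => by
    rw [← hA r (hr.trans hs.2)]; exact h.bound p x r
  have h1 := hN s le_rfl
  have h2 := hF.abs_le hT hN hs.1.le hsT
  have h3 : |∑ q, pattern θ (P.label p) (P.label q) * P.potential c₀ A q x s| ≤
      (1 + |θ|) * KP * ∑ q, P.W p q * N q := by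
    rw [Finset.mul_sum]
    refine (Finset.abs_sum_le_sum_abs _ _).trans (Finset.sum_le_sum fun q _ => ?_)
    obtain ⟨j1, j2⟩ := P.setIntegral_inv_dist_cell_le hσ hC₀ hb (q := q) hx
    have hNq := h.nonneg q
    have hH := P.H_pos p q
    have h4 : |P.potential c₀ A q x s| ≤ KP * (P.W p q) * N q := by
      calc _ ≤ ∫ y in P.cell q, N q * (dist x y)⁻¹ ∂μ := by
            rw [potential, ← Real.norm_eq_abs]
            refine norm_integral_le_of_norm_le (j1.const_mul _) (Eventually.of_forall fun y => ?_)
            rw [Real.norm_eq_abs, abs_mul, abs_of_nonneg (inv_nonneg.2 dist_nonneg), mul_comm]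
            gcongr
            exact h.bound q y _
        _ ≤ N q * (KP * (P.d ^ 2 / P.H p q)) := by
            rw [integral_const_mul]; gcongr
        _ ≤ N q * (KP * P.W p q) := by
            gcongr
            unfold W
            have : 0 ≤ P.d ^ 3 / P.H p q ^ 3 := by positivity
            linarith
        _ = _ := by ring
    rw [abs_mul]
    calc _ ≤ (1 + |θ|) * (KP * P.W p q * N q) :=
          mul_le_mul (abs_pattern_le _ _ _) h4 (abs_nonneg _) (by positivity)
      _ = _ := by ring
  have hS : 0 ≤ ∑ q, P.W p q * N q :=
    Finset.sum_nonneg fun q _ => mul_nonneg (P.W_nonneg p q) (h.nonneg q)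
  -- The equation is read backwards, as a formula for the source in terms of the solution.
  rw [← h.surface p x hx s hs]
  calc _ ≤ |ω ^ 2 * iteratedDeriv 2 (F p x) s| + |F p x s| +
        |κ * ∑ q, pattern θ (P.label p) (P.label q) * P.potential c₀ A q x s| := abs_add_three _ _ _
    _ ≤ ω ^ 2 * N p + T ^ 2 * N p + κ * ((1 + |θ|) * KP * ∑ q, P.W p q * N q) := by
        rw [abs_mul, abs_mul κ, abs_of_nonneg hκ, abs_of_nonneg (sq_nonneg ω)]
        gcongr
    _ ≤ _ := by
        have hNp := h.nonneg p
        have e1 : 0 ≤ (ω ^ 2 + T ^ 2) * ∑ q, P.W p q * N q := by positivity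
        have e2 : 0 ≤ κ * ((1 + |θ|) * KP) * N p := by positivity
        nlinarith

end Cloud

end BubbleScreen

/-! ### The incident spherical wave and its control by the accelerations -/

namespace BubbleScreen

lemma iteratedDeriv_two_incident (ρc c₀ : ℝ) (x₀ : E3) {lam : ℝ → ℝ} (x : E3) (s : ℝ) :
    iteratedDeriv 2 (incident ρc c₀ x₀ lam x) s =
      ρc * iteratedDeriv 2 lam (s - dist x x₀ / c₀) / dist x x₀ := by
  have h1 : ∀ g : ℝ → ℝ, deriv (fun t => ρc * g (t - dist x x₀ / c₀) / dist x x₀) =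
      fun t => ρc * deriv g (t - dist x x₀ / c₀) / dist x x₀ := fun g => by
    ext t
    rw [deriv_div_const, deriv_const_mul_field, deriv_comp_sub_const]
  have h2 : incident ρc c₀ x₀ lam x = fun t => ρc * lam (t - dist x x₀ / c₀) / dist x x₀ := rfl
  simp only [iteratedDeriv_succ, iteratedDeriv_zero, h2, h1]

section Source

variable {ρc c₀ T τ : ℝ} {x₀ : E3} {lam : ℝ → ℝ}

lemma causalC2_of_contDiff (hl : ContDiff ℝ 2 lam) (h0 : ∀ s < 0, lam s = 0) (T : ℝ) :
    CausalC2 T lam :=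
  ⟨hl.contDiffOn, fun _ hs => CausalC2.eq_zero_of_eqOn_neg one_pos hl.continuous.continuousOn h0 hs⟩

lemma continuousAt_iteratedDeriv_incident (hl : ContDiff ℝ 2 lam) {x : E3} (hx : 0 < dist x x₀)
    (s : ℝ) : ContinuousAt (fun y => iteratedDeriv 2 (incident ρc c₀ x₀ lam y) s) x := by
  have h := hl.continuous_iteratedDeriv 2 le_rfl
  simp_rw [iteratedDeriv_two_incident]
  exact ContinuousAt.div (by fun_prop) (by fun_prop) hx.ne'

lemma integral_iteratedDeriv_incident (hl : ContDiff ℝ 2 lam) (h0 : ∀ s < 0, lam s = 0)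
    (hc₀ : 0 < c₀) (x : E3) (t : ℝ) :
    ∫ s in (0 : ℝ)..t, iteratedDeriv 2 (incident ρc c₀ x₀ lam x) s =
      ρc * deriv lam (t - dist x x₀ / c₀) / dist x x₀ := by
  simp_rw [iteratedDeriv_two_incident, mul_div_assoc, mul_comm ρc, div_mul_eq_mul_div,
    mul_div_assoc]
  rw [intervalIntegral.integral_mul_const]
  congr 1
  set δ := dist x x₀ / c₀ with hδ
  have hδ0 : 0 ≤ δ := by positivity
  have hL := causalC2_of_contDiff hl h0 (max (t - δ) 0 + 1)
  have hT : 0 < max (t - δ) 0 + 1 := by positivity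
  rw [intervalIntegral.integral_comp_sub_right (fun s => iteratedDeriv 2 lam s),
    ← intervalIntegral.integral_add_adjacent_intervals (b := 0)
      ((hl.continuous_iteratedDeriv 2 le_rfl).intervalIntegrable _ _)
      ((hl.continuous_iteratedDeriv 2 le_rfl).intervalIntegrable _ _),
    hL.integral_iteratedDeriv hT (by linarith [le_max_left (t - δ) 0]),
    intervalIntegral.integral_symm, hL.integral_iteratedDeriv hT (by linarith),
    hL.deriv_eq_zero hT (by linarith), neg_zero, zero_add]

/-- Modulus of continuity in space of the time derivative of the incident wave, in terms of its
second time derivative at the two points. -/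
lemma abs_integral_incident_sub_le (hl : ContDiff ℝ 2 lam) (h0 : ∀ s < 0, lam s = 0)
    (hρ : 0 < ρc) (hc₀ : 0 < c₀) {r₀ R η M : ℝ} (hr₀ : 0 < r₀) (hM : 0 ≤ M) {x x' : E3}
    (hx : r₀ ≤ dist x x₀) (hx' : r₀ ≤ dist x' x₀) (hxR : dist x x₀ ≤ R) (hxR' : dist x' x₀ ≤ R)
    (hη : dist x x' ≤ η) (hτT : τ < T)
    (hMx : ∀ s ∈ Ioc 0 τ, |iteratedDeriv 2 (incident ρc c₀ x₀ lam x) s| ≤ M)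
    (hMx' : ∀ s ∈ Ioc 0 τ, |iteratedDeriv 2 (incident ρc c₀ x₀ lam x') s| ≤ M)
    {t : ℝ} (ht : t ∈ Icc 0 τ) :
    |(∫ s in (0 : ℝ)..t, iteratedDeriv 2 (incident ρc c₀ x₀ lam x) s) -
      ∫ s in (0 : ℝ)..t, iteratedDeriv 2 (incident ρc c₀ x₀ lam x') s| ≤
      R * (1 / (c₀ * r₀) + T / r₀ ^ 2) * η * M := by
  -- The nearer point receives the signal first: its record up to time t determines all of the
  -- signal that has reached either point.
  wlog hxx : dist x x₀ ≤ dist x' x₀ generalizing x x'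
  · rw [abs_sub_comm]
    exact this hx' hx hxR' hxR (by rwa [dist_comm]) hMx' hMx (le_of_not_ge hxx)
  rw [integral_iteratedDeriv_incident hl h0 hc₀, integral_iteratedDeriv_incident hl h0 hc₀]
  set r := dist x x₀ with hr
  set r' := dist x' x₀ with hr'
  have hrpos : 0 < r := hr₀.trans_le hx
  have hrpos' : 0 < r' := hr₀.trans_le hx'
  have hRpos : 0 < R := hrpos.trans_le hxR
  have hT : 0 < T := by linarith [ht.1, ht.2]
  have hη0 : 0 ≤ η := dist_nonneg.trans hη
  have hrr : |r - r'| ≤ η := (abs_dist_sub_le x x' x₀).trans hη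
  have hL := causalC2_of_contDiff hl h0 T
  set S := t - r / c₀ with hS
  -- The bound on the wave at x is solved for the signal; the factor R/ρc undoes the amplitude
  -- decay. This makes the constant independent of the signal.
  have hlam : ∀ s ≤ S, |iteratedDeriv 2 lam s| ≤ R * M / ρc := by
    intro s hs
    rcases le_or_gt s 0 with h | h
    · rw [hL.iteratedDeriv_eq_zero hT h, abs_zero]; positivity
    · have hrc : 0 < r / c₀ := by positivity
      have := hMx (s + r / c₀) ⟨by linarith, by linarith [ht.2]⟩
      rw [iteratedDeriv_two_incident, ← hr, add_sub_cancel_right, abs_div, abs_mul, abs_of_pos hρ,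
        abs_of_pos hrpos, div_le_iff₀ hrpos] at this
      rw [le_div_iff₀ hρ]
      nlinarith
  have hS' : t - r' / c₀ ≤ S := by rw [hS]; gcongr
  have hST : S < T := by
    have : 0 < r / c₀ := by positivity
    linarith [ht.2]
  have hlip : |deriv lam S - deriv lam (t - r' / c₀)| ≤ R * M / ρc * (η / c₀) := by
    have := Convex.norm_image_sub_le_of_norm_hasDerivWithin_le (s := Iic S) (f := deriv lam)
      (f' := iteratedDeriv 2 lam) (C := R * M / ρc)
      (fun s hs => (hL.hasDerivAt_deriv (lt_of_le_of_lt hs hST)).hasDerivWithinAt)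
      (fun s hs => hlam s hs) (convex_Iic S) (x := t - r' / c₀) (y := S) hS' self_mem_Iic
    rw [Real.norm_eq_abs, Real.norm_eq_abs] at this
    refine this.trans ?_
    gcongr
    rw [show S - (t - r' / c₀) = (r' - r) / c₀ by rw [hS]; ring, abs_div, abs_of_pos hc₀, abs_sub_comm]
    gcongr
  have hbd : |deriv lam (t - r' / c₀)| ≤ T * (R * M / ρc) := by
    rcases le_or_gt (t - r' / c₀) 0 with h | h
    · rw [hL.deriv_eq_zero hT h, abs_zero]; positivity
    · exact hL.abs_deriv_le hT (fun s hs => hlam s (hs.trans hS')) h.le (hS'.trans_lt hST)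
  have e : ρc * deriv lam S / r - ρc * deriv lam (t - r' / c₀) / r' =
      ρc * (deriv lam S - deriv lam (t - r' / c₀)) / r -
        ρc * deriv lam (t - r' / c₀) * (r - r') / (r * r') := by field_simp; ring
  rw [e]
  have t1 : |ρc * (deriv lam S - deriv lam (t - r' / c₀)) / r| ≤ R * M * (η / c₀) / r₀ := by
    rw [abs_div, abs_mul, abs_of_pos hρ, abs_of_pos hrpos]
    calc _ ≤ ρc * (R * M / ρc * (η / c₀)) / r₀ := by gcongr
      _ = _ := by field_simp
  have t2 : |ρc * deriv lam (t - r' / c₀) * (r - r') / (r * r')| ≤ T * (R * M) * η / r₀ ^ 2 := by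
    rw [abs_div, abs_mul, abs_mul, abs_of_pos hρ, abs_of_pos (mul_pos hrpos hrpos'), sq]
    calc _ ≤ ρc * (T * (R * M / ρc)) * η / (r₀ * r₀) := by gcongr
      _ = _ := by field_simp
  refine (abs_sub _ _).trans ((add_le_add t1 t2).trans_eq ?_)
  field_simp

end Source

namespace Cloud

variable {μ : Measure E3} [IsFiniteMeasure μ] {a b D C₀ C₂ c₀ T θ κ ω : ℝ} {n₀ : ℕ}

/-- Pointwise bound on the source by the accelerations at nearby cells. -/
lemma exists_forall_abs_source_le (hσ : QuadraticGrowth μ C₀) (hC₀ : 0 ≤ C₀) (hb : 0 ≤ b)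
    (hκ : 0 ≤ κ) (T c₀ θ ω : ℝ) :
    ∃ C : ℝ, 0 ≤ C ∧ ∀ (Q : Type) [Fintype Q] (P : Cloud μ a b D n₀ Q) (τ : ℝ) (N : Q → ℝ)
      (A F : Q → E3 → ℝ → ℝ) (Y : Q → ℝ → ℝ) (u : E3 → ℝ → ℝ), P.AccelPair T c₀ κ θ ω τ N A F Y u →
      (∀ p, ∀ x ∈ P.cell p, ∀ ε > 0, μ ((⋃ q, P.cell q) ∩ Metric.closedBall x ε) ≠ 0) →
      (∀ p, ∀ x ∈ P.cell p, ∀ s, ContinuousAt (fun y => iteratedDeriv 2 (u y) s) x) →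
      ∀ p, ∀ x ∈ P.cell p, ∀ s ∈ Ioc 0 τ,
        |iteratedDeriv 2 (u x) s| ≤ C * ∑ q, P.W p q * (N q + ∑ r, P.W q r * N r) := by
  obtain ⟨C, hC, hsrc⟩ := exists_abs_source_le (a := a) (D := D) (n₀ := n₀) hσ hC₀ hb hκ T c₀ θ ω
  -- When the cell q has a point within d of x, W p q is at least the inverse of this cube, so a
  -- value on the cell q is dominated by a W-weighted sum.
  refine ⟨C * (2 * (1 + 2 * b)) ^ 3, by positivity,
    fun Q _ P τ N A F Y u h hdense hcont p x hx s hs => ?_⟩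
  have hd := P.d_pos
  set V : Q → ℝ := fun q => N q + ∑ r, P.W q r * N r with hV
  have hV0 : ∀ q, 0 ≤ V q := fun q =>
    add_nonneg (h.nonneg q) (Finset.sum_nonneg fun r _ => mul_nonneg (P.W_nonneg q r) (h.nonneg r))
  by_contra hcon
  push Not at hcon
  have hev : ∀ᶠ y in 𝓝 x, C * (2 * (1 + 2 * b)) ^ 3 * ∑ q, P.W p q * V q <
      |iteratedDeriv 2 (u y) s| := (hcont p x hx s).abs.eventually (lt_mem_nhds hcon)
  obtain ⟨ε, hε, hball⟩ := Metric.nhds_basis_closedBall.eventually_iff.1 hev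
  have hae : ∀ᵐ y ∂μ, ∀ q, y ∈ P.cell q → ∀ s ≤ τ, A q y s = iteratedDeriv 2 (F q y) s :=
    ae_all_iff.2 fun q => (ae_restrict_iff' (P.measurable_cell q)).1 (h.ae_eq q)
  -- The bound is known only where the measurable version agrees with the true acceleration. Such
  -- points are arbitrarily close to x, perhaps in another cell, and the wave is continuous.
  obtain ⟨y, hy, hyg⟩ : ∃ y ∈ (⋃ q, P.cell q) ∩ Metric.closedBall x (min ε P.d),
      ∀ q, y ∈ P.cell q → ∀ s ≤ τ, A q y s = iteratedDeriv 2 (F q y) s := by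
    by_contra hno
    push Not at hno
    refine hdense p x hx (min ε P.d) (lt_min hε hd) (measure_mono_null (fun y hy => ?_) hae)
    obtain ⟨q, hq, s, hs1, hs2⟩ := hno y hy
    exact fun hall => hs2 (hall q hq s hs1)
  obtain ⟨q, hq⟩ := mem_iUnion.1 hy.1
  have hyd : dist x y ≤ min ε P.d := by rw [dist_comm]; exact hy.2
  have h1 := hsrc Q P τ N A F Y u h q y hq (hyg q hq) s hs
  have h2 : C * (2 * (1 + 2 * b)) ^ 3 * ∑ q, P.W p q * V q < |iteratedDeriv 2 (u y) s| :=
    hball (Metric.closedBall_subset_closedBall (min_le_left _ _) hy.2)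
  have hH := P.H_pos p q
  have hHd : P.H p q ≤ 2 * (1 + 2 * b) * P.d := by
    have h3 := P.H_le_dist_add hb hx hq
    have h4 : dist x y ≤ P.d := hyd.trans (min_le_right _ _)
    nlinarith
  have h3 : V q ≤ (2 * (1 + 2 * b)) ^ 3 * (P.W p q * V q) := by
    rw [← mul_assoc]
    refine le_mul_of_one_le_left (hV0 q) ?_
    have : 1 ≤ (2 * (1 + 2 * b)) ^ 3 * (P.d ^ 3 / P.H p q ^ 3) := by
      rw [← mul_div_assoc, one_le_div (by positivity), ← mul_pow]
      gcongr
    refine this.trans ?_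
    have : 0 ≤ P.d ^ 2 / P.H p q := by positivity
    gcongr
    unfold W
    linarith
  have h4 : P.W p q * V q ≤ ∑ q, P.W p q * V q :=
    Finset.single_le_sum (f := fun q => P.W p q * V q)
      (fun q _ => mul_nonneg (P.W_nonneg p q) (hV0 q)) (Finset.mem_univ q)
  have h5 : C * V q ≤ C * (2 * (1 + 2 * b)) ^ 3 * ∑ q, P.W p q * V q := by
    rw [mul_assoc]
    gcongr
    exact h3.trans (by gcongr)
  linarith

/-- Comparison of the surface equation and the delay system for an incident spherical wave. -/
theorem exists_sum_sq_sub_le (hσ : QuadraticGrowth μ C₀) (hC₀ : 0 ≤ C₀) (ha : 0 < a)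
    (hb : 0 ≤ b) (hc₀ : 0 < c₀) (hT : 0 < T) (hD : 0 ≤ D) (hC₂ : 0 ≤ C₂) (hR : RieszBound μ C₂)
    (hω : 0 < ω) (hκ : 0 ≤ κ) (θ : ℝ) {ρc r₀ R : ℝ} (hρ : 0 < ρc) (hr₀ : 0 < r₀) (hR0 : 0 ≤ R)
    (x₀ : E3) :
    ∃ C : ℝ, 0 ≤ C ∧ ∀ (Q : Type) [Fintype Q] (P : Cloud μ a b D n₀ Q) (τ : ℝ) (N : Q → ℝ)
      (A F : Q → E3 → ℝ → ℝ) (Y : Q → ℝ → ℝ) (lam : ℝ → ℝ), ContDiff ℝ 2 lam →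
      (∀ s < 0, lam s = 0) → P.AccelPair T c₀ κ θ ω τ N A F Y (incident ρc c₀ x₀ lam) →
      (∀ p, ∀ x ∈ P.cell p, ∀ ε > 0, μ ((⋃ q, P.cell q) ∩ Metric.closedBall x ε) ≠ 0) →
      (∀ p, ∀ x ∈ P.cell p, r₀ ≤ dist x x₀ ∧ dist x x₀ ≤ R) →
      ∑ p, (F p (P.z p) τ - Y p τ) ^ 2 ≤ C * (P.d ^ 2 * ∑ q, N q ^ 2) := by
  obtain ⟨CW, hCW, hW⟩ := exists_W_bound (a := a) (n₀ := n₀) hσ hC₀ hb hD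
  obtain ⟨Cs, hCs, hsrc⟩ := exists_forall_abs_source_le (a := a) (D := D) (n₀ := n₀) hσ hC₀ hb hκ
    T c₀ θ ω
  obtain ⟨C, hC, hmain⟩ := exists_sum_integral_error_le (a := a) (n₀ := n₀) hσ hC₀ ha hb hc₀ hT hD
    hC₂ hR hω hκ θ
  set L := R * (1 / (c₀ * r₀) + T / r₀ ^ 2) * b with hL
  have hL0 : 0 ≤ L := by positivity
  refine ⟨T * (C * (1 + (L * Cs) ^ 2 * (CW * (2 + 2 * CW)))), by positivity,
    fun Q _ P τ N A F Y lam hl h0 h hdense hr => ?_⟩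
  have hd := P.d_pos
  set V : Q → ℝ := fun q => N q + ∑ r, P.W q r * N r with hV
  have hV0 : ∀ q, 0 ≤ V q := fun q =>
    add_nonneg (h.nonneg q) (Finset.sum_nonneg fun r _ => mul_nonneg (P.W_nonneg q r) (h.nonneg r))
  set M : Q → ℝ := fun p => Cs * ∑ q, P.W p q * V q with hM
  have hM0 : ∀ p, 0 ≤ M p := fun p =>
    mul_nonneg hCs (Finset.sum_nonneg fun q _ => mul_nonneg (P.W_nonneg p q) (hV0 q))
  have hbound := hsrc Q P τ N A F Y _ h hdense fun p x hx s =>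
    continuousAt_iteratedDeriv_incident hl (hr₀.trans_le (hr p x hx).1) s
  set B : Q → ℝ := fun p => L * M p with hB
  have hsol := h.solutionPair hσ hC₀ hb hc₀ (B := B) fun p x hx t ht => by
    have hz := P.z_mem p
    refine (abs_integral_incident_sub_le hl h0 hρ hc₀ hr₀ (hM0 p) (hr p _ hz).1 (hr p _ hx).1
      (hr p _ hz).2 (hr p _ hx).2 (P.diam p _ hz _ hx) h.lt (hbound p _ hz) (hbound p _ hx) ht).trans
      (le_of_eq ?_)
    simp only [hB, hL]; ring
  have hVs : ∑ q, V q ^ 2 ≤ (2 + 2 * CW) * ∑ q, N q ^ 2 := by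
    calc ∑ q, V q ^ 2 ≤ ∑ q, (2 * N q ^ 2 + 2 * (∑ r, P.W q r * N r) ^ 2) :=
          Finset.sum_le_sum fun q _ => by
            have := add_sq_le (a := N q) (b := ∑ r, P.W q r * N r)
            simp only [hV]; linarith
      _ ≤ 2 * ∑ q, N q ^ 2 + 2 * (CW * ∑ q, N q ^ 2) := by
          rw [Finset.sum_add_distrib, ← Finset.mul_sum, ← Finset.mul_sum]
          gcongr
          exact hW Q P N
      _ = _ := by ring
  have hBs : ∑ q, B q ^ 2 ≤ (L * Cs) ^ 2 * (CW * ((2 + 2 * CW) * ∑ q, N q ^ 2)) := by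
    have e : ∀ q, B q ^ 2 = (L * Cs) ^ 2 * (∑ r, P.W q r * V r) ^ 2 := fun q => by
      simp only [hB, hM]; ring
    simp_rw [e]
    rw [← Finset.mul_sum]
    gcongr
    exact (hW Q P V).trans (by gcongr)
  have hint := hmain Q P τ N B _ _ _ _ hsol
  have hτ := h.pos
  -- The undifferentiated error is the time integral of f - v, so Cauchy–Schwarz turns the L² bound
  -- in time into a pointwise one.
  have hpt : ∀ p, (F p (P.z p) τ - Y p τ) ^ 2 ≤
      T * ∫ s in (0 : ℝ)..τ, (deriv (F p (P.z p)) (min s τ) - deriv (Y p) (min s τ)) ^ 2 := by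
    intro p
    have hF := h.causal p _ (P.z_mem p)
    have hY := h.causal_delay p
    set e : ℝ → ℝ := fun s => deriv (F p (P.z p)) (min s τ) - deriv (Y p) (min s τ) with he
    have hec : Continuous e := (CausalC2.continuous_comp_min hF.continuousOn_deriv h.lt).sub
      (CausalC2.continuous_comp_min hY.continuousOn_deriv h.lt)
    have heq : F p (P.z p) τ - Y p τ = ∫ s in (0 : ℝ)..τ, e s := by
      rw [← hF.integral_deriv hT h.lt, ← hY.integral_deriv hT h.lt,
        ← intervalIntegral.integral_sub (CausalC2.intervalIntegrable hT hF.continuousOn_deriv h.lt)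
          (CausalC2.intervalIntegrable hT hY.continuousOn_deriv h.lt)]
      refine intervalIntegral.integral_congr fun s hs => ?_
      rw [uIcc_of_le hτ.le] at hs
      simp only [he, min_eq_left hs.2]
    have hcs := sq_integral_mul_le (μ := volume.restrict (Ioc 0 τ)) (w := fun _ => (1 : ℝ)) (f := e)
      (fun _ => zero_le_one) (by simp)
      (by
        have : Continuous fun s => 1 * e s := continuous_const.mul hec
        exact (this.intervalIntegrable 0 τ).1)
      (by
        have : Continuous fun s => 1 * e s ^ 2 := continuous_const.mul (hec.pow 2)
        exact (this.intervalIntegrable 0 τ).1)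
    simp only [← intervalIntegral.integral_of_le hτ.le, one_mul, intervalIntegral.integral_const,
      sub_zero, smul_eq_mul, mul_one] at hcs
    rw [heq]
    refine hcs.trans ?_
    exact mul_le_mul_of_nonneg_right h.lt.le
      (intervalIntegral.integral_nonneg hτ.le fun s _ => sq_nonneg _)
  calc ∑ p, (F p (P.z p) τ - Y p τ) ^ 2
      ≤ T * ∑ p, ∫ s in (0 : ℝ)..τ, (deriv (F p (P.z p)) (min s τ) - deriv (Y p) (min s τ)) ^ 2 := by
        rw [Finset.mul_sum]; exact Finset.sum_le_sum fun p _ => hpt p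
    _ ≤ T * (C * (P.d ^ 2 * (∑ q, N q ^ 2 +
          (L * Cs) ^ 2 * (CW * ((2 + 2 * CW) * ∑ q, N q ^ 2))))) := by
        gcongr
        refine hint.trans ?_
        rw [Finset.sum_add_distrib]
        gcongr
    _ = _ := by ring

end Cloud

end BubbleScreen

/-! ### From distributions of bubbles to clouds -/

namespace BubbleScreen

namespace IsC2Domain

variable {Ω : Set E3}

lemma measurableSet_frontier (_ : IsC2Domain Ω) : MeasurableSet (frontier Ω) :=
  isClosed_frontier.measurableSet

lemma exists_quadraticGrowth (h : IsC2Domain Ω) :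
    ∃ C : ℝ, 0 ≤ C ∧ QuadraticGrowth (surf.restrict (frontier Ω)) C := by
  obtain ⟨C, hC, H⟩ := h.surf_frontier_inter_closedBall_le
  refine ⟨C, hC.le, fun x r hr => ?_⟩
  rw [Measure.restrict_apply Metric.isClosed_closedBall.measurableSet, inter_comm]
  exact H x r hr

lemma exists_oddCancellation (h : IsC2Domain Ω) :
    ∃ C : ℝ, 0 ≤ C ∧ OddCancellation (surf.restrict (frontier Ω)) C := by
  obtain ⟨C, hC, H⟩ := h.abs_setIntegral_oddBump_le
  exact ⟨C, hC.le, by filter_upwards [ae_restrict_mem h.measurableSet_frontier] with x hx using H x hx⟩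

lemma isFiniteMeasure (h : IsC2Domain Ω) : IsFiniteMeasure (surf.restrict (frontier Ω)) := by
  obtain ⟨C, -, H⟩ := h.surf_frontier_inter_closedBall_le
  obtain ⟨r, hr, hsub⟩ := h.isCompact_frontier.isBounded.subset_closedBall_lt 0 0
  refine ⟨?_⟩
  rw [Measure.restrict_apply_univ, ← inter_eq_left.2 hsub]
  exact (H 0 r hr).trans_lt ENNReal.ofReal_lt_top

end IsC2Domain

lemma IsUnitC2Surface.surf_inter_closedBall_pos {Γ : Set E3} (h : IsUnitC2Surface Γ) {x : E3}
    (hx : x ∈ Γ) {r : ℝ} (hr : 0 < r) : 0 < surf (Γ ∩ Metric.closedBall x r) := by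
  obtain ⟨Ω, hΩ, rfl | ⟨V, hV, rfl⟩⟩ := h.exists_domain
  · exact hΩ.surf_frontier_inter_closedBall_pos hx hr
  · obtain ⟨ε, hε, hsub⟩ := Metric.nhds_basis_closedBall.mem_iff.1 (hV.mem_nhds hx.2)
    refine (hΩ.surf_frontier_inter_closedBall_pos hx.1 (lt_min hε hr)).trans_le
      (measure_mono fun y hy => ⟨⟨hy.1, hsub ?_⟩, ?_⟩)
    · exact Metric.closedBall_subset_closedBall (min_le_left _ _) hy.2
    · exact Metric.closedBall_subset_closedBall (min_le_right _ _) hy.2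

namespace Distribution

variable {Γ S : Set E3} {K : E3 → ℝ} {a b : ℝ} (P : Distribution Γ K a b)

lemma nonempty_index (hΓ : surf Γ = 1) : Nonempty (Fin P.M) := by
  by_contra hne
  rw [not_nonempty_iff] at hne
  have := P.patch_cover
  rw [iUnion_of_empty, sdiff_empty, hΓ] at this
  exact one_ne_zero this

/-- A patch has area d² inside a surface of unit area. -/
lemma d_le_one (hΓ : surf Γ = 1) : P.d ≤ 1 := by
  obtain ⟨m⟩ := P.nonempty_index hΓ
  have h1 : ENNReal.ofReal (P.d ^ 2) ≤ 1 := by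
    rw [← P.patch_area m, ← hΓ]
    exact measure_mono (P.patch_subset m)
  rw [ENNReal.ofReal_le_one] at h1
  exact (sq_le_one_iff₀ P.d_pos.le).1 h1

lemma count_le {B : ℝ} (hB : ∀ x ∈ Γ, K x ≤ B) (m : Fin P.M) : P.count m ≤ ⌊B + 1⌋₊ := by
  rw [P.count_eq m]
  gcongr
  exact hB _ (P.patch_subset m (P.center_mem m _))

/-- The bubbles of a distribution, as a cloud of cells. -/
noncomputable def cloud (hΓS : Γ ⊆ S) {D : ℝ} {n₀ : ℕ}
    (hn : ∀ m, P.count m ≤ n₀) (hd : P.d ≤ 1) (hD : ∀ x ∈ S, ∀ y ∈ S, dist x y ≤ D) :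
    Cloud (surf.restrict S) a b D n₀ (Σ m, Fin (P.count m)) where
  d := P.d
  d_pos := P.d_pos
  d_le_one := hd
  cell q := P.patch q.1
  measurable_cell q := P.patch_measurable q.1
  area q := by
    rw [measureReal_def, Measure.restrict_apply (P.patch_measurable q.1),
      inter_eq_left.2 ((P.patch_subset q.1).trans hΓS), P.patch_area,
      ENNReal.toReal_ofReal (sq_nonneg _)]
  diam q := P.patch_diam q.1
  z q := P.center q.1 q.2
  z_mem q := P.center_mem q.1 q.2
  dist_le p q := hD _ (hΓS (P.patch_subset _ (P.center_mem p.1 p.2))) _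
    (hΓS (P.patch_subset _ (P.center_mem q.1 q.2)))
  block q := q.1
  label q := q.2
  label_lt q := q.2.2.trans_le (hn q.1)
  separated p q h := P.separated p q fun e => h (by rw [e])
  cell_eq p q h := by rw [Fin.ext h]
  overlap := by
    -- Each patch is repeated once for every bubble it carries, so almost every point lies in at
    -- most as many cells as one patch has bubbles.
    have hdis : ∀ᵐ x ∂surf.restrict S, ∀ m j, m ≠ j → x ∉ P.patch m ∩ P.patch j := by
      refine ae_restrict_of_ae ?_
      simp only [ae_all_iff]
      exact fun m j hmj => measure_eq_zero_iff_ae_notMem.1 (P.patch_disjoint hmj)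
    filter_upwards [hdis] with x hx
    rcases eq_empty_or_nonempty {q : Σ m, Fin (P.count m) | x ∈ P.patch q.1} with h | ⟨q₀, hq₀⟩
    · rw [h, ncard_empty]; exact Nat.zero_le _
    · have hsub : {q : Σ m, Fin (P.count m) | x ∈ P.patch q.1} ⊆
          range fun i : Fin (P.count q₀.1) => (⟨q₀.1, i⟩ : Σ m, Fin (P.count m)) := by
        rintro ⟨m, l⟩ hq
        have hm : m = q₀.1 := by
          by_contra hne
          exact hx m q₀.1 hne ⟨hq, hq₀⟩
        subst hm
        exact ⟨l, rfl⟩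
      refine (ncard_le_ncard hsub (toFinite _)).trans (le_trans ?_ (hn q₀.1))
      rw [← image_univ]
      refine (ncard_image_le (toFinite _)).trans ?_
      simp

end Distribution

section Conversion

variable {Γ S : Set E3} {K : E3 → ℝ} {a b T ω Cb c₀ θ τ : ℝ} {P : Distribution Γ K a b}
  {uin : E3 → ℝ → ℝ} {F : (m : Fin P.M) → Fin (P.count m) → E3 → ℝ → ℝ}
  {Y : (m : Fin P.M) → Fin (P.count m) → ℝ → ℝ}

/-- The norm bounds almost every point at almost every time; continuity in time allows the order of
the two quantifiers to be exchanged. -/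
lemma SolvesSurfaceEquation.ae_abs_le (h : SolvesSurfaceEquation P T ω Cb c₀ θ uin F) (hT : 0 < T)
    (m : Fin P.M) (l : Fin (P.count m)) :
    ∀ᵐ y ∂surf.restrict (P.patch m), y ∈ P.patch m ∧
      ∀ s < T, |iteratedDeriv 2 (F m l y) s| ≤ (accelNorm P T F m).toReal := by
  refine ae_forall_abs_le ENNReal.toReal_nonneg
    (fun y hy => (h.causal m l y hy).continuousOn_iteratedDeriv)
    (fun y hy s hs => (h.causal m l y hy).iteratedDeriv_eq_zero hT hs)
    (ae_restrict_mem (P.patch_measurable m)) ?_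
  have h1 : ∀ᵐ s ∂volume.restrict (Ioo 0 T),
      eLpNorm (fun y => accel P F m y s) ∞ (surf.restrict (P.patch m)) ≤ accelNorm P T F m :=
    ENNReal.ae_le_essSup _
  filter_upwards [h1] with s hs
  rw [eLpNorm_exponent_top] at hs
  filter_upwards [ae_le_eLpNormEssSup (f := fun y => accel P F m y s)
    (μ := surf.restrict (P.patch m))] with y hy
  have h2 : ‖accel P F m y s‖ ≤ (accelNorm P T F m).toReal := by
    rw [← toReal_enorm]
    exact ENNReal.toReal_mono (h.bounded m).ne (hy.trans hs)
  refine le_trans ?_ h2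
  exact PiLp.norm_apply_le (accel P F m y s) l

/-- With one cell per bubble, the double sums over patches and bubbles become single sums over the
cloud. The measure lives on the larger set S because the Riesz bound is proved on the whole closed
boundary. -/
lemma exists_accelPair [IsFiniteMeasure (surf.restrict S)] {C₀ : ℝ}
    (hσ : QuadraticGrowth (surf.restrict S) C₀) (hC₀ : 0 ≤ C₀) (hb : 0 ≤ b) (hc₀ : 0 < c₀)
    (hτ : 0 < τ) (hτT : τ < T) (hΓS : Γ ⊆ S) {D : ℝ} {n₀ : ℕ}
    (hn : ∀ m, P.count m ≤ n₀) (hd : P.d ≤ 1) (hD : ∀ x ∈ S, ∀ y ∈ S, dist x y ≤ D)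
    (hF : SolvesSurfaceEquation P T ω Cb c₀ θ uin F) (hY : SolvesDelaySystem P T ω Cb c₀ θ uin Y) :
    ∃ A, (P.cloud hΓS hn hd hD).AccelPair T c₀ (Cb / (4 * Real.pi)) θ ω τ
      (fun q => (accelNorm P T F q.1).toReal) A (fun q => F q.1 q.2) (fun q => Y q.1 q.2) uin := by
  have hT : 0 < T := hτ.trans hτT
  have hν : ∀ m, (surf.restrict S).restrict (P.patch m) = surf.restrict (P.patch m) := fun m =>
    Measure.restrict_restrict_of_subset ((P.patch_subset m).trans hΓS)
  choose A hA1 hA2 hA3 hA4 hA5 using fun q : Σ m, Fin (P.count m) =>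
    exists_measurable_version (ν := surf.restrict (P.patch q.1)) (A := P.patch q.1)
      (G := fun y s => iteratedDeriv 2 (F q.1 q.2 y) s)
      (N := (accelNorm P T F q.1).toReal) hτT ENNReal.toReal_nonneg
      (fun y hy => (hF.causal q.1 q.2 y hy).continuousOn_iteratedDeriv)
      (fun y hy s hs => (hF.causal q.1 q.2 y hy).iteratedDeriv_eq_zero hT hs)
      (fun s hs => hF.measurable q.1 q.2 s hs) (hF.ae_abs_le hT q.1 q.2)
  set C := P.cloud hΓS hn hd hD with hC
  refine ⟨A, hτ, hτT, fun _ => ENNReal.toReal_nonneg, hA1, hA2, hA3, hA4, fun q => ?_,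
    fun q y hy => hF.causal q.1 q.2 y hy, fun q => hY.causal q.1 q.2,
    fun p x hx s hs => ?_, fun p s hs => ?_⟩
  · have := hA5 q
    rw [← hν] at this
    exact this
  · rw [← hF.equation p.1 p.2 x hx s ⟨hs.1, hs.2.trans_lt hτT⟩, Fintype.sum_sigma, Finset.mul_sum]
    congr 1
    refine Finset.sum_congr rfl fun j _ => ?_
    have hae : ∀ᵐ y ∂surf.restrict (P.patch j), ∀ i : Fin (P.count j), ∀ s ≤ τ,
        A ⟨j, i⟩ y s = iteratedDeriv 2 (F j i y) s := ae_all_iff.2 fun i => hA5 ⟨j, i⟩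
    have hmeas : ∀ i : Fin (P.count j), Measurable fun y => A ⟨j, i⟩ y (s - dist x y / c₀) :=
      fun i => (hA1 ⟨j, i⟩).comp (measurable_id.prodMk (by fun_prop))
    have hint : ∀ i ∈ (Finset.univ : Finset (Fin (P.count j))), Integrable (fun y =>
        Cb / (4 * Real.pi) * (pattern θ p.2 i * ((dist x y)⁻¹ * A ⟨j, i⟩ y (s - dist x y / c₀))))
        (surf.restrict (P.patch j)) := fun i _ => by
      have := C.integrableOn_inv_dist_mul hσ hC₀ hb (p := p) ⟨j, i⟩ hx (hmeas i)
        (fun y => hA3 ⟨j, i⟩ y _)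
      rw [IntegrableOn] at this
      change Integrable _ ((surf.restrict S).restrict (P.patch j)) at this
      rw [hν] at this
      exact (this.const_mul _).const_mul _
    have e : ∫ y in P.patch j, ∑ i : Fin (P.count j), pattern θ p.2 i *
          (Cb / (4 * Real.pi * dist x y)) * iteratedDeriv 2 (F j i y) (s - dist x y / c₀) ∂surf =
        ∫ y in P.patch j, ∑ i : Fin (P.count j), Cb / (4 * Real.pi) *
          (pattern θ p.2 i * ((dist x y)⁻¹ * A ⟨j, i⟩ y (s - dist x y / c₀))) ∂surf := by
      refine integral_congr_ae ?_
      filter_upwards [hae] with y hy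
      refine Finset.sum_congr rfl fun i _ => ?_
      have hdel : 0 ≤ dist x y / c₀ := by positivity
      rw [hy i _ (by linarith [hs.2]), ← div_div, div_eq_mul_inv (Cb / (4 * Real.pi))]
      ring
    rw [e, integral_finsetSum _ hint, Finset.mul_sum]
    refine Finset.sum_congr rfl fun i _ => ?_
    rw [integral_const_mul, integral_const_mul, Cloud.potential]
    rw [show C.cell ⟨j, i⟩ = P.patch j from rfl, hν]
    rfl
  · change _ = iteratedDeriv 2 (uin (P.center p.1 p.2)) s
    rw [← hY.equation p.1 p.2 s ⟨hs.1, hs.2.trans_lt hτT⟩, Fintype.sum_sigma]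
    congr 1
    -- The coupling vanishes within a block, which matches the omission of the own patch in the
    -- delay system.
    rw [← Finset.sum_erase Finset.univ (a := p.1) (by
      refine Finset.sum_eq_zero fun i _ => ?_
      have : C.coupling (Cb / (4 * Real.pi)) θ p ⟨p.1, i⟩ = 0 := if_pos rfl
      rw [this, zero_mul])]
    refine Finset.sum_congr rfl fun j hj => Finset.sum_congr rfl fun i _ => ?_
    have hne : C.block p ≠ C.block ⟨j, i⟩ := fun h =>
      (Finset.ne_of_mem_erase hj) (Fin.ext h).symm
    rw [Cloud.coupling, if_neg hne]
    change pattern θ p.2 i * (Cb / (4 * Real.pi) * P.d ^ 2 / dist (P.center p.1 p.2) (P.center j i)) *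
      iteratedDeriv 2 (Y j i) (s - dist (P.center p.1 p.2) (P.center j i) / c₀) = _
    congr 2
    rw [div_mul_eq_mul_div, div_div]

end Conversion

end BubbleScreen

/-! ### The comparison estimate -/

theorem proposition2p6
    (Γ : Set BubbleScreen.E3) (hΓ : BubbleScreen.IsUnitC2Surface Γ)
    (K : BubbleScreen.E3 → ℝ) (hK : ContinuousOn K Γ) (hK0 : ∀ x ∈ Γ, 0 ≤ K x)
    (hKb : BddAbove (K '' Γ))
    (a b : ℝ) (ha : 0 < a) (hb : 0 < b)
    (T ω Cb c₀ ρc : ℝ) (hT : 0 < T) (hω : 0 < ω) (hCb : 0 < Cb) (hc₀ : 0 < c₀) (hρc : 0 < ρc)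
    (θ : ℝ) (x₀ : BubbleScreen.E3) (hx₀ : x₀ ∉ closure Γ) :
    ∃ C : ℝ, 0 < C ∧
      ∀ (P : BubbleScreen.Distribution Γ K a b)
        (lam : ℝ → ℝ), ContDiff ℝ 9 lam → (∀ s < 0, lam s = 0) →
      ∀ (F : (m : Fin P.M) → Fin (P.count m) → BubbleScreen.E3 → ℝ → ℝ)
        (Y : (m : Fin P.M) → Fin (P.count m) → ℝ → ℝ),
        BubbleScreen.SolvesSurfaceEquation P T ω Cb c₀ θ
          (BubbleScreen.incident ρc c₀ x₀ lam) F →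
        BubbleScreen.SolvesDelaySystem P T ω Cb c₀ θ
          (BubbleScreen.incident ρc c₀ x₀ lam) Y →
        ∀ t ∈ Set.Ioo 0 T,
          ∑ m, ∑ l, |F m l (P.center m l) t - Y m l t| ^ 2
            ≤ C * P.d ^ 2 * ∑ m, (BubbleScreen.accelNorm P T F m).toReal ^ 2 := by
  open BubbleScreen in
  obtain ⟨Ω, hΩ, hΓΩ⟩ := hΓ.exists_domain
  have hΓS : Γ ⊆ frontier Ω := by
    rcases hΓΩ with rfl | ⟨V, -, rfl⟩
    · exact subset_rfl
    · exact inter_subset_left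
  have := hΩ.isFiniteMeasure
  obtain ⟨C₀, hC₀, hσ⟩ := hΩ.exists_quadraticGrowth
  obtain ⟨C₁, hC₁, hodd⟩ := hΩ.exists_oddCancellation
  obtain ⟨C₂, hC₂, hR⟩ := BubbleScreen.exists_regRiesz_bound hσ hC₀ hC₁ hodd
  have hbdd := hΩ.isCompact_frontier.isBounded
  obtain ⟨D', hD'⟩ := Metric.isBounded_iff.1 hbdd
  have hD : ∀ x ∈ frontier Ω, ∀ y ∈ frontier Ω, dist x y ≤ max D' 0 := fun x hx y hy =>
    (hD' hx hy).trans (le_max_left _ _)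
  obtain ⟨R, hR0, hsub⟩ := hbdd.subset_closedBall_lt 0 x₀
  obtain ⟨r₀, hr₀, hball⟩ := Metric.isOpen_iff.1 isClosed_closure.isOpen_compl x₀ hx₀
  obtain ⟨B, hB⟩ := hKb
  have hKB : ∀ x ∈ Γ, K x ≤ B := fun x hx => hB (mem_image_of_mem K hx)
  have hr : ∀ x ∈ Γ, r₀ ≤ dist x x₀ ∧ dist x x₀ ≤ R := fun x hx => by
    refine ⟨?_, hsub (hΓS hx)⟩
    by_contra hlt
    exact hball (Metric.mem_ball.2 (not_le.1 hlt)) (subset_closure hx)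
  obtain ⟨C, hC, H⟩ := BubbleScreen.Cloud.exists_sum_sq_sub_le (μ := BubbleScreen.surf.restrict (frontier Ω))
    (a := a) (D := max D' 0) (n₀ := ⌊B + 1⌋₊) (κ := Cb / (4 * Real.pi)) hσ hC₀ ha hb.le hc₀ hT
    (le_max_right _ _) hC₂ hR hω (by positivity) θ hρc hr₀ hR0.le x₀
  -- The norm of a patch is counted once per bubble, hence at most ⌊B + 1⌋₊ times; the added 1 only
  -- ensures positivity.
  refine ⟨C * ⌊B + 1⌋₊ + 1, by positivity, fun P lam hlam hlam0 F Y hF hY t ht => ?_⟩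
  have hl : ContDiff ℝ 2 lam := hlam.of_le (by norm_num)
  have hn := P.count_le hKB
  have hd1 := P.d_le_one hΓ.area
  obtain ⟨A, hA⟩ := BubbleScreen.exists_accelPair hσ hC₀ hb.le hc₀ ht.1 ht.2 hΓS hn hd1 hD hF hY
  have hmain := H _ _ t _ A _ _ lam hl hlam0 hA (fun p x hx ε hε h0 => ?_)
    (fun p x hx => hr x (P.patch_subset p.1 hx))
  · rw [Fintype.sum_sigma, Fintype.sum_sigma] at hmain
    simp only [sq_abs]
    refine hmain.trans ?_
    change C * (P.d ^ 2 * ∑ m, ∑ _l : Fin (P.count m), (BubbleScreen.accelNorm P T F m).toReal ^ 2) ≤ _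
    have h1 : ∑ m, ∑ _l : Fin (P.count m), (BubbleScreen.accelNorm P T F m).toReal ^ 2 ≤
        ⌊B + 1⌋₊ * ∑ m, (BubbleScreen.accelNorm P T F m).toReal ^ 2 := by
      rw [Finset.mul_sum]
      refine Finset.sum_le_sum fun m _ => ?_
      rw [Finset.sum_const, Finset.card_univ, Fintype.card_fin, nsmul_eq_mul]
      gcongr
      exact hn m
    have h2 : 0 ≤ P.d ^ 2 * ∑ m, (BubbleScreen.accelNorm P T F m).toReal ^ 2 :=
      mul_nonneg (sq_nonneg _) (Finset.sum_nonneg fun _ _ => sq_nonneg _)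
    calc _ ≤ C * (P.d ^ 2 * (⌊B + 1⌋₊ * ∑ m, (BubbleScreen.accelNorm P T F m).toReal ^ 2)) := by
          gcongr
      _ = C * ⌊B + 1⌋₊ * (P.d ^ 2 * ∑ m, (BubbleScreen.accelNorm P T F m).toReal ^ 2) := by ring
      _ ≤ _ := by linarith
  -- Every ball about a surface point has positive area, and the patches cover Γ up to a null set,
  -- so they meet the ball in positive area.
  · have hpos := hΓ.surf_inter_closedBall_pos (P.patch_subset p.1 hx) hε
    have hsub' : Γ ∩ Metric.closedBall x ε ⊆
        (((⋃ q, (P.cloud hΓS hn hd1 hD).cell q) ∩ Metric.closedBall x ε) ∩ frontier Ω) ∪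
          (Γ \ ⋃ m, P.patch m) := by
      intro y hy
      by_cases hyP : y ∈ ⋃ m, P.patch m
      · obtain ⟨m, hm⟩ := mem_iUnion.1 hyP
        exact Or.inl ⟨⟨mem_iUnion.2 ⟨⟨m, ⟨0, P.count_pos m⟩⟩, hm⟩, hy.2⟩, hΓS hy.1⟩
      · exact Or.inr ⟨hy.1, hyP⟩
    rw [Measure.restrict_apply' hΩ.measurableSet_frontier] at h0
    exact hpos.ne' (measure_mono_null hsub' (measure_union_null h0 P.patch_cover))
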